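/- **Setting.** Let $\ell_2=\ell_2(\mathbb N_0)$ with standard orthonormal basis $(e_n)_{n\ge 0}$, identified with the closed linear span of the functions $u^n$, $n\ge 0$, in $L_2(\mathbb S^1)$ (normalized measure), where $u(\mathrm e^{\mathrm i t})=\mathrm e^{\mathrm i t}$, and let $P$ be the orthogonal projection of $L_2(\mathbb S^1)$ onto it. For $f\in C(\mathbb S^1)$ let $T_f\phi=P(f\phi)$ be the Toeplitz operator on $\ell_2$, let $\mathcal T\subset B(\ell_2)$ be the C*-algebra generated by all $T_f$, and let $\sigma:\mathcal T\to \mathcal T/K(\ell_2)\cong C(\mathbb S^1)$ be the symbol map, $\sigma(T_f)=f$, where $K(\ell_2)$ denotes the compact operators. Let $g\ge 1$ be an integer. For $k=1,\dots,g$ and $t\in[0,1]$ put $a_k(t)=\mathrm e^{\pi\mathrm i (k-1+t)/g}$, $b_k(t)=\mathrm e^{\pi\mathrm i(-k+t)/g}$, let $$W_g=\{f\in C(\mathbb S^1): f(a_k(t))=f(b_k(t))\ \text{for all } k=1,\dots,g,\ t\in[0,1]\},$$ and $$C(\mathbb P_{g,q})=\{x\in\mathcal T:\sigma(x)\in W_g\},\qquad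 C^\infty(\mathbb P_{g,q})=\{T_f\in C(\mathbb P_{g,q}): f\in W_g\cap C^\infty(\mathbb S^1)\}.$$ Let $\mathcal K_S$ be the set of operators $A\in B(\ell_2)$ whose matrix $a_{kn}=\langle e_k,Ae_n\rangle$ is of rapid decay, i.e. $k^\alpha a_{kn}n^\beta\to 0$ as $(k,n)\to\infty$ for all $\alpha,\beta\in\mathbb N_0$, and let $\mathcal A$ be the $*$-algebra generated by $\mathcal K_S$ and $C^\infty(\mathbb P_{g,q})$. Let $\mathcal H=\ell_2\oplus\ell_2$, $\pi(a)(v_+\oplus v_-)=av_+\oplus av_-$ for $a\in\mathcal A$, and $\gamma(v_+\oplus v_-)=v_+\oplus(-v_-)$. Let $S$ be the shift $Se_k=e_{k+1}$, let $N$ be the number operator $Ne_n=ne_n$ on its maximal domain, and let $$D=\begin{pmatrix}0&S^*N\\ S(N+1)&0\end{pmatrix},\qquad \mathrm{dom}(D)=\mathrm{dom}(N)\oplus\mathrm{dom}(N).$$ Let $D=F|D|$ be the polar decomposition of $D$. **Theorem.** $(\mathcal A,\mathcal H,D,\gamma)$, with the representation $\pi$, is a $1^+$-summable regular even spectral triple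 for $C(\mathbb P_{g,q})$. That is: 1. The norm closure of $\mathcal A$ is $C(\mathbb P_{g,q})$, $\mathcal A$ is stable under holomorphic functional calculus, and $\pi$ is a faithful $*$-representation. The operator $D$ is densely defined and self-adjoint with compact resolvent. The operator $\gamma$ is self-adjoint with $\gamma^2=1$, $\gamma D=-D\gamma$ and $\gamma\pi(a)=\pi(a)\gamma$ for all $a\in\mathcal A$. For every $a\in\mathcal A$, $\pi(a)$ maps $\mathrm{dom}(D)$ into itself and $[D,\pi(a)]$ extends to a bounded operator. 2. ($1^+$-summability) $(1+|D|)^{-(1+\epsilon)}$ is trace class for every $\epsilon>0$, and $(1+|D|)^{-1}$ is not trace class. 3. (Regularity) For all $a\in\mathcal A$, $\pi(a)$ and (the bounded extension of) $[D,\pi(a)]$ belong to $\bigcap_{n\in\mathbb N}\mathrm{dom}(\delta_{|D|}^n)$, where $\delta_{|D|}(x)=[|D|,x]$ is defined for those $x\in B(\mathcal H)$ that map $\mathrm{dom}(|D|)$ into itself and for which $[|D|,x]$ extends to a bounded operator. Moreover, the spectrum of $D$ is $\mathbb Z$ and every $k\in\mathbb Z$ is an eigenvalue of multiplicity $1$.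 The vectors $$b_k=\tfrac1{\sqrt2}(e_{k-1}\oplus e_k),\quad b_{-k}=\tfrac1{\sqrt2}(-e_{k-1}\oplus e_k)\quad(k>0),\qquad b_0=0\oplus e_0$$ form a complete orthonormal basis of $\mathcal H$ with $Db_k=kb_k$ for all $k\in\mathbb Z$. Finally, the fundamental class of $D$ is non-trivial: $(\pi,F,\gamma)$ is an even Fredholm module over $\mathcal A$, i.e. $\gamma F=-F\gamma$ and $F-F^*$, $F^2-1$ and $[F,\pi(a)]$ are compact for all $a\in\mathcal A$, and there are $n\in\mathbb N$ and a projection $p=p^2=p^*\in\mathrm{Mat}_{n\times n}(\mathcal A)$ such that the operator $\pi(p)F\pi(p):\pi(p)\mathcal H_-^n\to\pi(p)\mathcal H_+^n$ is Fredholm with non-zero index, where $\mathcal H_\pm$ is the eigenspace of $\gamma$ for the eigenvalue $\pm1$. -/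

import Mathlib

open scoped InnerProductSpace Topology ENNReal ContDiff

noncomputable section

/-! ## Unbounded operators on a Hilbert space -/

namespace Unbounded

variable {H : Type*} [NormedAddCommGroup H] [InnerProductSpace ℂ H] [CompleteSpace H]

/-- `R` is a bounded, everywhere defined, two-sided inverse of `T - z`. -/
def IsResolvent (T : H →ₗ.[ℂ] H) (z : ℂ) (R : H →L[ℂ] H) : Prop :=
  (∀ w : H, ∃ h : R w ∈ T.domain, T ⟨R w, h⟩ - z • R w = w) ∧
    ∀ v : T.domain, R (T v - z • (v : H)) = v

/-- The spectrum of an unbounded operator: the complement of its resolvent set. -/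
def spec (T : H →ₗ.[ℂ] H) : Set ℂ := {z | ¬ ∃ R : H →L[ℂ] H, IsResolvent T z R}

/-- The eigenspace `{v ∈ dom T : T v = z v}`. -/
def eigenspace (T : H →ₗ.[ℂ] H) (z : ℂ) : Submodule ℂ H :=
  (LinearMap.ker (T.toFun - z • T.domain.subtype)).map T.domain.subtype

/-- The resolvent set is non-empty and every resolvent operator is compact. -/
def HasCompactResolvent (T : H →ₗ.[ℂ] H) : Prop :=
  (∃ (z : ℂ) (R : H →L[ℂ] H), IsResolvent T z R) ∧
    ∀ (z : ℂ) (R : H →L[ℂ] H), IsResolvent T z R → IsCompactOperator R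

/-- The bounded operator `x` maps `dom T` into itself, and `[T, x] = T x - x T`, which is defined
on `dom T`, is the restriction to `dom T` of the bounded operator `y`. When `T` is densely defined,
`y` is unique; it is the closure of `[T, x]`. -/
def IsCommutator (T : H →ₗ.[ℂ] H) (x y : H →L[ℂ] H) : Prop :=
  ∀ v : T.domain, ∃ h : x v ∈ T.domain, T ⟨x v, h⟩ - x (T v) = y v

/-- `x` lies in the domain of the `n`-th power of the derivation `δ_T = [T, ·]` of `B(H)`. -/
def MemDomDelta (T : H →ₗ.[ℂ] H) : ℕ → (H →L[ℂ] H) → Prop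
  | 0, _ => True
  | n + 1, x => ∃ y : H →L[ℂ] H, IsCommutator T x y ∧ MemDomDelta T n y

/-- `D = F P` is the polar decomposition of `D`: the operator `P = |D|` is positive and
self-adjoint with `dom P = dom D`, and `F` is a partial isometry with `ker F = ker P`
(that is, its initial space is the closure of the range of `P`). -/
structure IsPolarDecomposition (D : H →ₗ.[ℂ] H) (F : H →L[ℂ] H) (P : H →ₗ.[ℂ] H) : Prop where
  dense_domain : Dense (P.domain : Set H)
  selfAdjoint : IsSelfAdjoint P
  nonneg : ∀ v : P.domain, 0 ≤ (⟪(v : H), P v⟫_ℂ).re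
  domain_eq : P.domain = D.domain
  apply_eq : ∀ (v : H) (hP : v ∈ P.domain) (hD : v ∈ D.domain), D ⟨v, hD⟩ = F (P ⟨v, hP⟩)
  partialIsometry : F * star F * F = F
  ker_eq : ∀ v : H, F v = 0 ↔ ∃ h : v ∈ P.domain, P ⟨v, h⟩ = 0

/-- `T` is trace class: `∑ ⟨b, |T| b⟩ < ∞` for some (equivalently, every) orthonormal basis. -/
def IsTraceClass (T : H →L[ℂ] H) : Prop :=
  ∃ (s : Set H) (b : HilbertBasis s ℂ H), Summable fun i => (⟪b i, CFC.abs T (b i)⟫_ℂ).re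

end Unbounded

/-! ## Spectral triples -/

namespace SpectralTriple

open Unbounded

section Calculus

variable {B : Type*} [CStarAlgebra B]

/-- The element `b` is the value `f(a)` of the holomorphic functional calculus:
`f` is holomorphic on an open neighbourhood `U` of the spectrum of `a`, and
`f(a) = (2πi)⁻¹ ∮_Γ f(z) (z - a)⁻¹ dz` for a cycle `Γ = γ₁ + ⋯ + γₘ` of closed curves in
`U` minus the spectrum, with winding number `1` around each point of the spectrum and `0` around
each point outside `U`. (`C¹` curves may have vanishing derivative, so polygons are included.) -/
def IsHolomorphicValue (f : ℂ → ℂ) (a b : B) : Prop :=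
  ∃ U : Set ℂ, IsOpen U ∧ spectrum ℂ a ⊆ U ∧ DifferentiableOn ℂ f U ∧
    ∃ (m : ℕ) (γ : Fin m → ℝ → ℂ),
      (∀ i, ContDiff ℝ 1 (γ i)) ∧ (∀ i, γ i 0 = γ i 1) ∧
      (∀ i, ∀ t ∈ Set.Icc (0 : ℝ) 1, γ i t ∈ U \ spectrum ℂ a) ∧
      (∀ z ∈ spectrum ℂ a,
        (2 * Real.pi * Complex.I)⁻¹ * ∑ i, ∫ t in (0 : ℝ)..1, deriv (γ i) t / (γ i t - z) = 1) ∧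
      (∀ z ∉ U,
        (2 * Real.pi * Complex.I)⁻¹ * ∑ i, ∫ t in (0 : ℝ)..1, deriv (γ i) t / (γ i t - z) = 0) ∧
      b = (2 * Real.pi * Complex.I : ℂ)⁻¹ •
        ∑ i, ∫ t in (0 : ℝ)..1, (f (γ i t) * deriv (γ i) t) • resolvent a (γ i t)

/-- Stability under holomorphic functional calculus. Spectra may be computed in the ambient
C*-algebra, because the spectrum of an element of a unital C*-subalgebra is the same in both. -/
def IsHolomorphicallyStable (A : StarSubalgebra ℂ B) : Prop :=
  ∀ a ∈ A, ∀ (f : ℂ → ℂ) (b : B), IsHolomorphicValue f a b → b ∈ A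

end Calculus

variable {B H : Type*} [CStarAlgebra B]
  [NormedAddCommGroup H] [InnerProductSpace ℂ H] [CompleteSpace H]

/-- `(A, H, D, γ)`, with the representation `π` of `A` on `H`, is an even spectral triple for
the C*-algebra `C`. Here `C` is a C*-subalgebra of an ambient C*-algebra `B`. -/
structure IsEven (C : Set B) (A : StarSubalgebra ℂ B) (π : A →⋆ₐ[ℂ] (H →L[ℂ] H))
    (D : H →ₗ.[ℂ] H) (γ : H →L[ℂ] H) : Prop where
  closure_eq : (A.topologicalClosure : Set B) = C
  holomorphicallyStable : IsHolomorphicallyStable A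
  faithful : Function.Injective π
  dense_domain : Dense (D.domain : Set H)
  selfAdjoint : IsSelfAdjoint D
  compactResolvent : HasCompactResolvent D
  grading_selfAdjoint : IsSelfAdjoint γ
  grading_sq : γ * γ = 1
  grading_anticomm : ∀ v : D.domain, ∃ h : γ v ∈ D.domain, D ⟨γ v, h⟩ = -γ (D v)
  grading_comm : ∀ a : A, γ * π a = π a * γ
  commutator_bounded : ∀ a : A, ∃ y : H →L[ℂ] H, IsCommutator D (π a) y

/-- `n⁺`-summability: `(1 + |D|)^(-(n + ε))` is trace class for all `ε > 0`, and `(1 + |D|)^(-n)`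
is not. The powers are those of the bounded positive operator `R = (1 + |D|)⁻¹`. -/
def IsPlusSummable (D : H →ₗ.[ℂ] H) (n : ℝ) : Prop :=
  ∃ (F : H →L[ℂ] H) (P : H →ₗ.[ℂ] H) (R : H →L[ℂ] H),
    IsPolarDecomposition D F P ∧ IsResolvent P (-1) R ∧
      (∀ ε : ℝ, 0 < ε → IsTraceClass (CFC.rpow R (n + ε))) ∧ ¬ IsTraceClass (CFC.rpow R n)

/-- Regularity: `π(a)` and `[D, π(a)]` lie in the domain of every power of `δ_{|D|}`. -/
def IsRegular {A : StarSubalgebra ℂ B} (π : A →⋆ₐ[ℂ] (H →L[ℂ] H)) (D : H →ₗ.[ℂ] H) : Prop :=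
  ∃ (F : H →L[ℂ] H) (P : H →ₗ.[ℂ] H), IsPolarDecomposition D F P ∧
    ∀ a : A, (∀ n, MemDomDelta P n (π a)) ∧
      ∃ y : H →L[ℂ] H, IsCommutator D (π a) y ∧ ∀ n, MemDomDelta P n y

/-- `(π, F, γ)` is an even Fredholm module over `A`. -/
structure IsEvenFredholmModule {A : StarSubalgebra ℂ B} (π : A →⋆ₐ[ℂ] (H →L[ℂ] H))
    (F γ : H →L[ℂ] H) : Prop where
  grading_selfAdjoint : IsSelfAdjoint γ
  grading_sq : γ * γ = 1
  grading_comm : ∀ a : A, γ * π a = π a * γ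
  grading_anticomm : γ * F = -(F * γ)
  compact_adjoint : IsCompactOperator (F - star F)
  compact_sq : IsCompactOperator (F * F - (1 : H →L[ℂ] H))
  compact_comm : ∀ a : A, IsCompactOperator (F * π a - π a * F)

/-- The operator on `Hⁿ` given by applying `π` to the entries of a matrix over `A`. -/
def matrixOp {A : StarSubalgebra ℂ B} (π : A →⋆ₐ[ℂ] (H →L[ℂ] H)) {n : ℕ}
    (p : Matrix (Fin n) (Fin n) A) : (Fin n → H) →L[ℂ] (Fin n → H) :=
  ContinuousLinearMap.pi fun i => ∑ j, π (p i j) ∘L ContinuousLinearMap.proj j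

/-- The subspace `π(p) (H_±)ⁿ`, where `H_±` is the eigenspace of `γ` for the eigenvalue
`c = ±1`. -/
def compressedSpace {A : StarSubalgebra ℂ B} (π : A →⋆ₐ[ℂ] (H →L[ℂ] H)) (γ : H →L[ℂ] H) (c : ℂ)
    {n : ℕ} (p : Matrix (Fin n) (Fin n) A) : Submodule ℂ (Fin n → H) :=
  (Submodule.pi Set.univ fun _ => Module.End.eigenspace (γ : H →ₗ[ℂ] H) c).map
    (matrixOp π p : (Fin n → H) →ₗ[ℂ] (Fin n → H))

/-- The index of a Fredholm operator. -/
def fredholmIndex {V W : Type*} [AddCommGroup V] [Module ℂ V] [TopologicalSpace V]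
    [AddCommGroup W] [Module ℂ W] [TopologicalSpace W] (T : V →L[ℂ] W) : ℤ :=
  (Module.finrank ℂ T.ker : ℤ) - Module.finrank ℂ (W ⧸ T.range)

/-- The index pairing of the Fredholm module `(π, F, γ)` with the class of a projection
`p ∈ Matₙ(A)` takes the value `m`: the operator
`π(p) F π(p) : π(p) (H_-)ⁿ → π(p) (H_+)ⁿ` is Fredholm with index `m`. -/
def IsIndexPairing {A : StarSubalgebra ℂ B} (π : A →⋆ₐ[ℂ] (H →L[ℂ] H)) (F γ : H →L[ℂ] H)
    {n : ℕ} (p : Matrix (Fin n) (Fin n) A) (m : ℤ) : Prop :=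
  ∃ T : compressedSpace π γ (-1) p →L[ℂ] compressedSpace π γ 1 p,
    (∀ v, (T v : Fin n → H) = matrixOp π p fun i => F ((v : Fin n → H) i)) ∧
      T.IsFredholm ∧ fredholmIndex T = m

/-- The fundamental class of `D`, i.e. the even Fredholm module given by the polar decomposition
`D = F |D|`, has a non-zero index pairing with some projection over `A`. -/
def HasNontrivialFundamentalClass {A : StarSubalgebra ℂ B} (π : A →⋆ₐ[ℂ] (H →L[ℂ] H))
    (D : H →ₗ.[ℂ] H) (γ : H →L[ℂ] H) : Prop :=
  ∃ (F : H →L[ℂ] H) (P : H →ₗ.[ℂ] H), IsPolarDecomposition D F P ∧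
    IsEvenFredholmModule π F γ ∧
      ∃ (n : ℕ) (p : Matrix (Fin n) (Fin n) A), p * p = p ∧ p.IsHermitian ∧
        ∃ m : ℤ, m ≠ 0 ∧ IsIndexPairing π F γ p m

end SpectralTriple

/-! ## Toeplitz operators and the quantum surfaces `C(ℙ_{g,q})` -/

namespace QuantumSurface

/-- The circle `ℝ / 2πℤ`; the point `e^{it}` of the unit circle is the class of `t`. -/
abbrev Circ : Type := AddCircle (2 * Real.pi)

instance factTwoPiPos : Fact (0 < 2 * Real.pi) := ⟨Real.two_pi_pos⟩

/-- The Hilbert space `ℓ₂(ℕ₀)`. -/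
abbrev Ell2 : Type := lp (fun _ : ℕ => ℂ) 2

/-- `L₂` of the circle with normalized Haar measure. -/
abbrev L2Circ : Type := MeasureTheory.Lp ℂ 2 (AddCircle.haarAddCircle (T := 2 * Real.pi))

/-- The standard orthonormal basis of `ℓ₂(ℕ₀)`. -/
def e : HilbertBasis ℕ ℂ Ell2 := HilbertBasis.ofRepr (LinearIsometryEquiv.refl ℂ Ell2)

/-- The isometry `ℓ₂(ℕ₀) → L₂(𝕊¹)` sending `eₙ` to `uⁿ`, `u(e^{it}) = e^{it}`. -/
def hardyEmbedding : Ell2 →ₗᵢ[ℂ] L2Circ :=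
  ((orthonormal_fourier (T := 2 * Real.pi)).comp
    (fun n : ℕ => (n : ℤ)) Nat.cast_injective).orthogonalFamily.linearIsometry

/-- Multiplication by a continuous function on `L₂(𝕊¹)`. -/
def mulOp (f : C(Circ, ℂ)) : L2Circ →L[ℂ] L2Circ :=
  (ContinuousLinearMap.mul ℂ ℂ).holderL AddCircle.haarAddCircle ∞ 2 2
    (ContinuousMap.toLp (E := ℂ) ∞ AddCircle.haarAddCircle ℂ f)

/-- The Toeplitz operator `T_f φ = P (f φ)`, with `ℓ₂(ℕ₀)` identified with the closed span of
`uⁿ`, `n ≥ 0`, in `L₂(𝕊¹)`. -/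
def toeplitz (f : C(Circ, ℂ)) : Ell2 →L[ℂ] Ell2 :=
  (hardyEmbedding.toContinuousLinearMap).adjoint ∘L mulOp f ∘L
    hardyEmbedding.toContinuousLinearMap

/-- The Toeplitz algebra: the C*-algebra generated by all Toeplitz operators. -/
def toeplitzAlgebra : StarSubalgebra ℂ (Ell2 →L[ℂ] Ell2) :=
  (StarAlgebra.adjoin ℂ (Set.range toeplitz)).topologicalClosure

/-- `f` is the symbol `σ(x)` of the element `x` of the Toeplitz algebra, where `σ` is the quotient
map onto the quotient by the compact operators, which is `C(𝕊¹)` with `T_f` corresponding to `f`. -/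
def IsSymbol (x : Ell2 →L[ℂ] Ell2) (f : C(Circ, ℂ)) : Prop :=
  IsCompactOperator (x - toeplitz f)

theorem e_eq_single (n : ℕ) : e n = lp.single 2 n (1:ℂ) := by
  rw [HilbertBasis.repr_symm_single e n |>.symm]; rfl

theorem hardyEmbedding_e (n : ℕ) : hardyEmbedding (e n) = fourierLp 2 (n:ℤ) := by
  rw [e_eq_single]
  simp [hardyEmbedding, OrthogonalFamily.linearIsometry_apply_single]

/-- The matrix of `T_f` has the entries `⟨e_k, T_f eₙ⟩ = f_{k-n}`. -/
theorem inner_toeplitz (f : C(Circ, ℂ)) (k n : ℕ) :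
    ⟪e k, toeplitz f (e n)⟫_ℂ = fourierCoeff f ((k:ℤ) - n) := by
  have : toeplitz f (e n) = (hardyEmbedding.toContinuousLinearMap).adjoint
    (mulOp f (hardyEmbedding (e n))) := rfl
  rw [this, ContinuousLinearMap.adjoint_inner_right]
  change ⟪hardyEmbedding (e k), _⟫_ℂ = _
  rw [hardyEmbedding_e, hardyEmbedding_e, MeasureTheory.L2.inner_def, fourierCoeff]
  apply MeasureTheory.integral_congr_ae
  have h1 := ContinuousLinearMap.coeFn_holder (r := 2) (ContinuousLinearMap.mul ℂ ℂ)
    (ContinuousMap.toLp (E := ℂ) ∞ AddCircle.haarAddCircle ℂ f) (fourierLp (T := 2*Real.pi) 2 (n:ℤ))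
  filter_upwards [h1, coeFn_fourierLp (T := 2*Real.pi) 2 (n:ℤ), coeFn_fourierLp (T := 2*Real.pi) 2 (k:ℤ),
    ContinuousMap.coeFn_toLp (p := ∞) (𝕜 := ℂ) AddCircle.haarAddCircle f] with x h1 h2 h3 h4
  have : (mulOp f (fourierLp 2 (n:ℤ)) : Circ → ℂ) x = f x * fourier (n:ℤ) x := by
    change (ContinuousLinearMap.holder 2 _ _ _ : L2Circ) x = _
    rw [h1, h2, h4]; rfl
  rw [this, h3]
  have e1 : (-((k:ℤ) - n)) = -(k:ℤ) + n := by ring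
  rw [e1, fourier_add, fourier_neg]
  simp [RCLike.inner_apply]
  ring

theorem tendsto_inner_e (y : Ell2) (φ : ℕ → ℕ) (hφ : Filter.Tendsto φ Filter.atTop Filter.atTop) :
    Filter.Tendsto (fun n => ⟪e (φ n), y⟫_ℂ) Filter.atTop (𝓝 0) := by
  have h := (e.orthonormal.inner_products_summable y).tendsto_atTop_zero
  have h2 := (h.comp hφ).sqrt
  rw [Real.sqrt_zero] at h2
  rw [tendsto_zero_iff_norm_tendsto_zero]
  convert! h2 using 2 with n
  simp

theorem compact_coeff {K : Ell2 →L[ℂ] Ell2} (hK : IsCompactOperator K) (a b : ℕ) (c : ℂ)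
    (h : ∀ n, ⟪e (n + a), K (e (n + b))⟫_ℂ = c) : c = 0 := by
  obtain ⟨C, hC, hsub⟩ :=
    IsCompactOperator.image_closedBall_subset_compact (f := (K : Ell2 →ₗ[ℂ] Ell2)) hK 1
  obtain ⟨y, -, φ, hφ, hy⟩ := hC.tendsto_subseq (x := fun n => K (e (n + b))) fun n =>
    hsub ⟨e (n + b), by simp [e.orthonormal.1], rfl⟩
  have h1 := tendsto_inner_e y (fun n => φ n + a)
    (Filter.tendsto_atTop_mono (fun n => Nat.le_add_right (φ n) a) hφ.tendsto_atTop)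
  have h2 : Filter.Tendsto (fun n => ⟪e (φ n + a), K (e (φ n + b)) - y⟫_ℂ) Filter.atTop (𝓝 0) := by
    refine squeeze_zero_norm (a := fun n => ‖K (e (φ n + b)) - y‖) (fun n => ?_) ?_
    · have := norm_inner_le_norm (𝕜 := ℂ) (e (φ n + a)) (K (e (φ n + b)) - y)
      rwa [e.orthonormal.1, one_mul] at this
    · simpa using (hy.sub_const y).norm
  have h3 := h2.add h1
  simp only [inner_sub_right, h, sub_add_cancel, add_zero] at h3
  exact tendsto_nhds_unique tendsto_const_nhds h3

/-- The symbol of an operator is unique. -/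
theorem IsSymbol.unique {x : Ell2 →L[ℂ] Ell2} {f f' : C(Circ, ℂ)} (h : IsSymbol x f)
    (h' : IsSymbol x f') : f = f' := by
  have hc : IsCompactOperator (toeplitz f - toeplitz f') := by
    have := h'.sub h
    convert! this using 1
    ext v : 1
    simp
  have key : ∀ j : ℤ, fourierCoeff f j = fourierCoeff f' j := fun j => by
    refine sub_eq_zero.1 (compact_coeff hc j.toNat (-j).toNat _ fun n => ?_)
    rw [sub_apply, inner_sub_right, inner_toeplitz, inner_toeplitz]
    have : ((n + j.toNat : ℕ) : ℤ) - (n + (-j).toNat : ℕ) = j := by push_cast; omega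
    rw [this]
  have h2 : ContinuousMap.toLp (E := ℂ) 2 AddCircle.haarAddCircle ℂ f =
      ContinuousMap.toLp (E := ℂ) 2 AddCircle.haarAddCircle ℂ f' := by
    apply (fourierBasis (T := 2 * Real.pi)).repr.injective
    ext j
    rw [fourierBasis_repr, fourierBasis_repr, fourierCoeff_toLp, fourierCoeff_toLp, key]
  exact ContinuousMap.toLp_injective AddCircle.haarAddCircle h2

/-- The continuous functions on the circle with `f(a_k(t)) = f(b_k(t))`, where
`a_k(t) = e^{πi(k-1+t)/g}` and `b_k(t) = e^{πi(-k+t)/g}` for `k = 1, …, g` and `t ∈ [0,1]`. -/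
def wedgeFunctions (g : ℕ) : Set C(Circ, ℂ) :=
  {f | ∀ k ∈ Finset.Icc 1 g, ∀ t ∈ Set.Icc (0 : ℝ) 1,
    f ((Real.pi * ((k : ℝ) - 1 + t) / g : ℝ) : Circ) =
      f ((Real.pi * (-(k : ℝ) + t) / g : ℝ) : Circ)}

/-- Smooth functions on the circle. -/
def smoothFunctions : Set C(Circ, ℂ) := {f | ContDiff ℝ ∞ fun t : ℝ => f (t : Circ)}

/-- The C*-algebra `C(ℙ_{g,q})`: the elements of the Toeplitz algebra whose symbol satisfies
`σ(x)(a_k(t)) = σ(x)(b_k(t))`. -/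
def surface (g : ℕ) : Set (Ell2 →L[ℂ] Ell2) :=
  {x | x ∈ toeplitzAlgebra ∧ ∃ f, IsSymbol x f ∧ f ∈ wedgeFunctions g}

/-- The operators on `ℓ₂(ℕ₀)` whose matrix `a_{kn} = ⟨e_k, A e_n⟩` is of rapid decay:
`k^α a_{kn} n^β → 0` as `(k, n) → ∞`, for all `α, β ∈ ℕ₀`. -/
def rapidDecay : Set (Ell2 →L[ℂ] Ell2) :=
  {A | ∀ α β : ℕ, Filter.Tendsto
    (fun p : ℕ × ℕ => ‖(p.1 : ℂ) ^ α * ⟪e p.1, A (e p.2)⟫_ℂ * (p.2 : ℂ) ^ β‖)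
    Filter.cofinite (𝓝 0)}

/-- `C^∞(ℙ_{g,q})`: the Toeplitz operators in `C(ℙ_{g,q})` with smooth symbol. -/
def smoothToeplitz (g : ℕ) : Set (Ell2 →L[ℂ] Ell2) :=
  {x | x ∈ surface g ∧ ∃ f ∈ wedgeFunctions g ∩ smoothFunctions, x = toeplitz f}

/-- The *-algebra generated by the operators of rapid decay and `C^∞(ℙ_{g,q})`. -/
def smoothAlgebra (g : ℕ) : StarSubalgebra ℂ (Ell2 →L[ℂ] Ell2) :=
  StarAlgebra.adjoin ℂ (rapidDecay ∪ smoothToeplitz g)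

/-! ## The Hilbert space, the representation, the grading and the Dirac operator -/

/-- The Hilbert space `ℓ₂(ℕ₀) ⊕ ℓ₂(ℕ₀)`. -/
abbrev Hilb : Type := WithLp 2 (Ell2 × Ell2)

/-- The operator `v₊ ⊕ v₋ ↦ a v₊ ⊕ b v₋`. -/
def diagOp (a b : Ell2 →L[ℂ] Ell2) : Hilb →L[ℂ] Hilb :=
  ((WithLp.prodContinuousLinearEquiv 2 ℂ Ell2 Ell2).symm : Ell2 × Ell2 →L[ℂ] Hilb) ∘L
    (a.prodMap b) ∘L (WithLp.prodContinuousLinearEquiv 2 ℂ Ell2 Ell2 : Hilb →L[ℂ] Ell2 × Ell2)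

/-- The *-representation `a ↦ (v₊ ⊕ v₋ ↦ a v₊ ⊕ a v₋)` of `B(ℓ₂(ℕ₀))`. -/
def doubleRep : (Ell2 →L[ℂ] Ell2) →⋆ₐ[ℂ] (Hilb →L[ℂ] Hilb) where
  toFun a := diagOp a a
  map_one' := rfl
  map_mul' _ _ := rfl
  map_zero' := rfl
  map_add' _ _ := rfl
  commutes' _ := rfl
  map_star' a := by
    refine (ContinuousLinearMap.eq_adjoint_iff _ _).2 fun x y => ?_
    simp [diagOp, WithLp.prod_inner_apply, ContinuousLinearMap.star_eq_adjoint,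
      ContinuousLinearMap.adjoint_inner_left]

/-- The representation `π(a)(v₊ ⊕ v₋) = a v₊ ⊕ a v₋` of a *-subalgebra of `B(ℓ₂(ℕ₀))`. -/
def rep (A : StarSubalgebra ℂ (Ell2 →L[ℂ] Ell2)) : A →⋆ₐ[ℂ] (Hilb →L[ℂ] Hilb) :=
  doubleRep.comp A.subtype

/-- The grading operator `γ(v₊ ⊕ v₋) = v₊ ⊕ (-v₋)`. -/
def grading : Hilb →L[ℂ] Hilb := diagOp 1 (-1)

/-- The shift operator `S e_k = e_{k+1}`. -/
def shift : Ell2 →L[ℂ] Ell2 :=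
  (e.orthonormal.comp Nat.succ Nat.succ_injective).orthogonalFamily.linearIsometry
    |>.toContinuousLinearMap

/-- The number operator `N eₙ = n eₙ` with its maximal domain. -/
def numberOp : Ell2 →ₗ.[ℂ] Ell2 where
  domain :=
    { carrier := {v | Memℓp (fun n : ℕ => (n : ℂ) * v n) 2}
      zero_mem' := by simpa using! (zero_memℓp : Memℓp (0 : ℕ → ℂ) 2)
      add_mem' := fun {v w} hv hw => by
        simpa [mul_add] using! Memℓp.add hv hw
      smul_mem' := fun c v hv => by
        simpa [mul_left_comm] using! Memℓp.const_smul hv c }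
  toFun :=
    { toFun := fun v => ⟨fun n : ℕ => (n : ℂ) * v.1 n, v.2⟩
      map_add' := fun v w => Subtype.ext (funext fun n => mul_add (n : ℂ) (v.1 n) (w.1 n))
      map_smul' := fun c v => Subtype.ext (funext fun n => mul_left_comm (n : ℂ) c (v.1 n)) }

/-- The component `v₊` of `v₊ ⊕ v₋`. -/
def plusPart : Hilb →ₗ[ℂ] Ell2 :=
  LinearMap.fst ℂ Ell2 Ell2 ∘ₗ (WithLp.linearEquiv 2 ℂ (Ell2 × Ell2)).toLinearMap

/-- The component `v₋` of `v₊ ⊕ v₋`. -/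
def minusPart : Hilb →ₗ[ℂ] Ell2 :=
  LinearMap.snd ℂ Ell2 Ell2 ∘ₗ (WithLp.linearEquiv 2 ℂ (Ell2 × Ell2)).toLinearMap

/-- The subspace `dom N ⊕ dom N`. -/
def diracDomain : Submodule ℂ Hilb :=
  numberOp.domain.comap plusPart ⊓ numberOp.domain.comap minusPart

/-- The operator `v₊ ⊕ v₋ ↦ N v₊` on `dom N ⊕ dom N`. -/
def numberPlus : diracDomain →ₗ[ℂ] Ell2 :=
  numberOp.toFun ∘ₗ (plusPart ∘ₗ diracDomain.subtype).codRestrict numberOp.domain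
    fun v => v.2.1

/-- The operator `v₊ ⊕ v₋ ↦ N v₋` on `dom N ⊕ dom N`. -/
def numberMinus : diracDomain →ₗ[ℂ] Ell2 :=
  numberOp.toFun ∘ₗ (minusPart ∘ₗ diracDomain.subtype).codRestrict numberOp.domain
    fun v => v.2.2

/-- The Dirac operator `D (v₊ ⊕ v₋) = S* N v₋ ⊕ S (N + 1) v₊` with domain `dom N ⊕ dom N`;
note that `S (N + 1) = N S`. -/
def dirac : Hilb →ₗ.[ℂ] Hilb where
  domain := diracDomain
  toFun := (WithLp.linearEquiv 2 ℂ (Ell2 × Ell2)).symm.toLinearMap ∘ₗ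
    (((star shift : Ell2 →L[ℂ] Ell2) : Ell2 →ₗ[ℂ] Ell2) ∘ₗ numberMinus).prod
      ((shift : Ell2 →ₗ[ℂ] Ell2) ∘ₗ (numberPlus + plusPart ∘ₗ diracDomain.subtype))

/-- The vectors `b_k = (e_{k-1} ⊕ e_k)/√2`, `b_{-k} = (-e_{k-1} ⊕ e_k)/√2` for `k > 0`, and
`b_0 = 0 ⊕ e_0`. -/
def eigenvector : ℤ → Hilb
  | Int.ofNat 0 => WithLp.toLp 2 (0, e 0)
  | Int.ofNat (k + 1) => (1 / Real.sqrt 2 : ℂ) • WithLp.toLp 2 (e k, e (k + 1))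
  | Int.negSucc k => (1 / Real.sqrt 2 : ℂ) • WithLp.toLp 2 (-e k, e (k + 1))

end QuantumSurface

end

/-!
Everything rests on reading operators on `ℓ₂(ℕ₀)` through their matrices.

*Smooth operators.* An operator is smooth (`Smooth`) if all its iterated commutators with the number
operator `N` are bounded; the commutator multiplies the entry `(k, n)` by `k - n`, so the entries
of a smooth operator decay rapidly away from the diagonal (`IsSmoothFam.exists_entry_le`), and the
rapidly decaying operators form a two-sided ideal among the smooth ones (`RapidFam.smooth_mul`). The
domain of `[N, ·]` is stable under inversion (`HasDelta.inverse`), which is shown by replacing `N`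
with the bounded operators `(1 + ε N)⁻¹`; therefore so is smoothness. Families that depend
continuously on a parameter in a compact space are treated at once, since the functional calculus
requires estimates that are uniform along a path.

*The smooth algebra.* Call `T_f + K`, with `f` smooth and `K` of rapid decay, an operator with smooth
symbol `f`. Such operators are precisely the smooth operators that commute with the shift `S` up to
rapid decay: given such an operator, its entries converge along each diagonal, and the limits are
the Fourier coefficients of `f` (`exists_smooth_symbol`). This criterion is purely algebraic, and
makes it evident that these operators form an algebra. Together with the uniqueness and
multiplicativity of the symbol, it shows that the smooth algebra consists of the operators with
smooth symbol in `W_g` (`mem_smoothAlgebra_iff`). It also gives stability under holomorphic functional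
calculus (`isHolomorphicallyStable_smoothAlgebra`): the resolvents `(z - a)⁻¹` form a smooth family,
and `[S, (z - a)⁻¹] = (z - a)⁻¹ [S, a] (z - a)⁻¹` is of rapid decay, uniformly for `z` on a path.

*The closure.* The states given by the normalized eigenvectors `∑ aᵏ e_k` of `S*` vanish on compact
operators in the limit `‖a‖ → 1`, while they evaluate the symbol at a boundary point. Hence the
symbol map is norm decreasing (`IsSymbol.norm_le`). Combined with the density of the smooth
functions in `W_g` (`exists_smooth_wedge`), and with the fact that the matrix units are of rapid
decay, this identifies the closure of the smooth algebra (`smoothAlgebra_topologicalClosure`).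

*The Dirac operator.* The vectors `b_k` form an orthonormal basis in which `D` is the maximal
diagonal operator with eigenvalues `k` (`isDiag_dirac`). Self-adjointness, spectrum, multiplicities
and compactness of the resolvent are general properties of diagonal operators (`IsDiag`). The polar
decomposition is explicit: `|D| = (N + 1) ⊕ N`, which is diagonal in the same basis, and `F` is
off-diagonal with the entries `S*` and `S` (`isPolarDecomposition_dirac`). The operator `(1 + |D|)⁻¹`
has the eigenvalues `(1 + |k|)⁻¹`, and summability reduces to that of `∑ (1 + |k|)⁻ˢ`, because the
trace of a positive operator can be computed in any orthonormal basis (`isTraceClass_iff`).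

*Regularity.* The commutator of `|D|` with a `2 × 2` block of smooth operators is again such a block
(`memDomDelta_blockOp`), and so is the commutator of `D` with `a ⊕ a` for `a` in the smooth algebra,
because `[S, a]` and `[S*, a]` remain bounded and smooth after multiplication by `N`
(`exists_isCommutator_dirac`).

*The index.* The commutators `[F, π(a)]` are compact since `[S, a]` and `[S*, a]` are. The
fundamental class pairs with the projection `1` to the index of `S*`, which is `1`
(`isIndexPairing_one`).
-/

noncomputable section

namespace QuantumSurface

/-! ### Matrices of bounded operators -/

/-- The matrix entry `⟨e_k, x eₙ⟩`. -/
def entry (x : Ell2 →L[ℂ] Ell2) (k n : ℕ) : ℂ := ⟪e k, x (e n)⟫_ℂ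

theorem inner_e_eq (k : ℕ) (v : Ell2) : ⟪e k, v⟫_ℂ = v k := by
  rw [← HilbertBasis.repr_apply_apply]; rfl

theorem norm_e (k : ℕ) : ‖e k‖ = 1 := e.orthonormal.1 k

theorem inner_e_e (k n : ℕ) : ⟪e k, e n⟫_ℂ = if k = n then 1 else 0 :=
  orthonormal_iff_ite.1 e.orthonormal k n

@[simp] theorem entry_add (x y : Ell2 →L[ℂ] Ell2) (k n : ℕ) :
    entry (x + y) k n = entry x k n + entry y k n := by simp [entry]

@[simp] theorem entry_sub (x y : Ell2 →L[ℂ] Ell2) (k n : ℕ) :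
    entry (x - y) k n = entry x k n - entry y k n := by simp [entry]

@[simp] theorem entry_neg (x : Ell2 →L[ℂ] Ell2) (k n : ℕ) :
    entry (-x) k n = -entry x k n := by simp [entry]

@[simp] theorem entry_smul (c : ℂ) (x : Ell2 →L[ℂ] Ell2) (k n : ℕ) :
    entry (c • x) k n = c * entry x k n := by simp [entry]

@[simp] theorem entry_zero (k n : ℕ) : entry 0 k n = 0 := by simp [entry]

theorem entry_one (k n : ℕ) : entry 1 k n = if k = n then 1 else 0 := inner_e_e k n

theorem entry_star (x : Ell2 →L[ℂ] Ell2) (k n : ℕ) :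
    entry (star x) k n = star (entry x n k) := by
  simp [entry, ContinuousLinearMap.star_eq_adjoint, ContinuousLinearMap.adjoint_inner_right]

theorem norm_entry_le (x : Ell2 →L[ℂ] Ell2) (k n : ℕ) : ‖entry x k n‖ ≤ ‖x‖ := by
  refine (norm_inner_le_norm _ _).trans ?_
  rw [norm_e, one_mul]
  simpa [norm_e] using x.le_opNorm (e n)

theorem entry_ext {x y : Ell2 →L[ℂ] Ell2} (h : ∀ k n, entry x k n = entry y k n) : x = y := by
  have h1 : ∀ n, x (e n) = y (e n) := fun n => by
    ext k
    rw [← inner_e_eq, ← inner_e_eq]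
    exact h k n
  refine ContinuousLinearMap.ext_on (s := Set.range e) ?_ ?_
  · have := e.dense_span
    rw [Submodule.dense_iff_topologicalClosure_eq_top, this]
  · rintro _ ⟨n, rfl⟩
    exact h1 n

theorem hasSum_entry_apply (x : Ell2 →L[ℂ] Ell2) (k : ℕ) (v : Ell2) :
    HasSum (fun m => entry x k m * v m) (x v k) := by
  have h := e.hasSum_inner_mul_inner (ContinuousLinearMap.adjoint x (e k)) v
  simp only [ContinuousLinearMap.adjoint_inner_left, inner_e_eq] at h
  convert! h using 2 with m
  rw [entry, inner_e_eq]

theorem hasSum_entry_mul (x y : Ell2 →L[ℂ] Ell2) (k n : ℕ) :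
    HasSum (fun m => entry x k m * entry y m n) (entry (x * y) k n) := by
  have h := hasSum_entry_apply x k (y (e n))
  simpa only [entry, inner_e_eq, mul_apply_eq_comp] using h

/-- The matrix unit `e_k ⟨e_n, ·⟩`. -/
def matUnit (k n : ℕ) : Ell2 →L[ℂ] Ell2 := InnerProductSpace.rankOne ℂ (e k) (e n)

theorem entry_matUnit (k n i j : ℕ) :
    entry (matUnit k n) i j = if i = k ∧ n = j then 1 else 0 := by
  simp only [entry, matUnit, InnerProductSpace.rankOne_apply, inner_smul_right, inner_e_e]
  split_ifs <;> simp_all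

theorem norm_matUnit (k n : ℕ) : ‖matUnit k n‖ = 1 := by
  simp [matUnit, norm_e]

/-- The operator with matrix `a`. The sum over the matrix units is taken in the operator norm, so
this is meaningful for absolutely summable matrices; otherwise the sum may be the junk value `0`. -/
def ofMatrix (a : ℕ × ℕ → ℂ) : Ell2 →L[ℂ] Ell2 := ∑' p, a p • matUnit p.1 p.2

theorem hasSum_ofMatrix {a : ℕ × ℕ → ℂ} (ha : Summable fun p => ‖a p‖) :
    HasSum (fun p => a p • matUnit p.1 p.2) (ofMatrix a) := by
  refine Summable.hasSum (Summable.of_norm ?_)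
  simpa [norm_smul, norm_matUnit] using ha

/-- The matrix entry as a bounded linear functional. -/
def entryL (k n : ℕ) : (Ell2 →L[ℂ] Ell2) →L[ℂ] ℂ :=
  innerSL ℂ (e k) ∘L ContinuousLinearMap.apply ℂ Ell2 (e n)

theorem entryL_apply (k n : ℕ) (x : Ell2 →L[ℂ] Ell2) : entryL k n x = entry x k n := rfl

theorem entry_ofMatrix {a : ℕ × ℕ → ℂ} (ha : Summable fun p => ‖a p‖) (k n : ℕ) :
    entry (ofMatrix a) k n = a (k, n) := by
  have h := (hasSum_ofMatrix ha).mapL (entryL k n)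
  refine h.unique ?_
  convert! hasSum_ite_eq (k, n) (a (k, n)) using 2 with p
  rw [entryL_apply, entry_smul, entry_matUnit]
  obtain ⟨i, j⟩ := p
  by_cases hij : i = k ∧ j = n
  · obtain ⟨rfl, rfl⟩ := hij; simp
  · have : ¬ (k = i ∧ j = n) := fun h => hij ⟨h.1.symm, h.2⟩
    have h3 : ¬ ((i, j) = (k, n)) := by simpa using hij
    simp [this, h3]

/-! ### Rapid decay -/

/-- A family of matrices of rapid decay, uniformly in the parameter. The weights `(k + 1) ^ α` and
`(n + 1) ^ β`, unlike `k ^ α` and `n ^ β`, do not vanish on the first row and column, so that they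
can be divided by. -/
def RapidMat {ι : Type*} (a : ι → ℕ → ℕ → ℂ) : Prop :=
  ∀ α β : ℕ, ∃ C : ℝ, ∀ i (k n : ℕ), ((k : ℝ) + 1) ^ α * ((n : ℝ) + 1) ^ β * ‖a i k n‖ ≤ C

/-- A family of operators whose matrices are of rapid decay, uniformly in the parameter. -/
def RapidFam {ι : Type*} (Y : ι → Ell2 →L[ℂ] Ell2) : Prop := RapidMat fun i => entry (Y i)

theorem summable_one_div_succ_sq : Summable fun n : ℕ => (((n : ℝ) + 1) ^ 2)⁻¹ := by
  have := (summable_nat_add_iff 1).2 (Real.summable_nat_pow_inv (p := 2)|>.2 one_lt_two)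
  simpa using this

theorem RapidMat.exists_le {ι : Type*} {a : ι → ℕ → ℕ → ℂ} (h : RapidMat a) (α β : ℕ) :
    ∃ C : ℝ, 0 ≤ C ∧ ∀ i (k n : ℕ),
      ‖a i k n‖ ≤ C * (((k : ℝ) + 1) ^ α)⁻¹ * (((n : ℝ) + 1) ^ β)⁻¹ := by
  obtain ⟨C, hC⟩ := h α β
  refine ⟨|C|, abs_nonneg _, fun i k n => ?_⟩
  have h1 : 0 < ((k : ℝ) + 1) ^ α := by positivity
  have h2 : 0 < ((n : ℝ) + 1) ^ β := by positivity
  rw [← div_eq_mul_inv, ← div_eq_mul_inv, le_div_iff₀ h2, le_div_iff₀ h1]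
  calc _ = ((k : ℝ) + 1) ^ α * ((n : ℝ) + 1) ^ β * ‖a i k n‖ := by ring
    _ ≤ C := hC i k n
    _ ≤ |C| := le_abs_self C

theorem RapidMat.summable {ι : Type*} {a : ι → ℕ → ℕ → ℂ} (h : RapidMat a) (i : ι) :
    Summable fun p : ℕ × ℕ => ‖a i p.1 p.2‖ := by
  obtain ⟨C, -, hC⟩ := h.exists_le 2 2
  refine Summable.of_nonneg_of_le (fun _ => norm_nonneg _) (fun p => hC i p.1 p.2) ?_
  have := (summable_one_div_succ_sq.mul_of_nonneg summable_one_div_succ_sq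
    (fun _ => by positivity) (fun _ => by positivity)).mul_left C
  simpa [mul_assoc] using this

theorem RapidMat.entry_ofMatrix {ι : Type*} {a : ι → ℕ → ℕ → ℂ} (h : RapidMat a) (i : ι)
    (k n : ℕ) : entry (ofMatrix fun p => a i p.1 p.2) k n = a i k n :=
  QuantumSurface.entry_ofMatrix (h.summable i) k n

theorem RapidFam.hasSum {ι : Type*} {Y : ι → Ell2 →L[ℂ] Ell2} (h : RapidFam Y) (i : ι) :
    HasSum (fun p : ℕ × ℕ => entry (Y i) p.1 p.2 • matUnit p.1 p.2) (Y i) := by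
  have h1 := hasSum_ofMatrix (h.summable i)
  rwa [show ofMatrix (fun p : ℕ × ℕ => entry (Y i) p.1 p.2) = Y i from
    entry_ext fun k n => RapidMat.entry_ofMatrix h i k n] at h1

theorem RapidMat.mono {ι : Type*} {a b : ι → ℕ → ℕ → ℂ} (h : RapidMat a)
    (hb : ∀ i (k n : ℕ), ‖b i k n‖ ≤ ‖a i k n‖) : RapidMat b := fun α β => by
  obtain ⟨C, hC⟩ := h α β
  exact ⟨C, fun i k n => le_trans (by gcongr; exact hb i k n) (hC i k n)⟩

theorem RapidMat.add {ι : Type*} {a b : ι → ℕ → ℕ → ℂ} (ha : RapidMat a) (hb : RapidMat b) :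
    RapidMat fun i k n => a i k n + b i k n := fun α β => by
  obtain ⟨C, hC⟩ := ha α β
  obtain ⟨C', hC'⟩ := hb α β
  refine ⟨C + C', fun i k n => le_trans ?_ (add_le_add (hC i k n) (hC' i k n))⟩
  rw [← mul_add]
  gcongr
  exact norm_add_le _ _

/-- Rapid decay is not affected by factors of polynomial growth. -/
theorem RapidMat.of_le_pow {ι : Type*} {a b : ι → ℕ → ℕ → ℂ} (h : RapidMat a) (p q : ℕ) (c : ℝ)
    (hb : ∀ i (k n : ℕ), ‖b i k n‖ ≤ c * (((k : ℝ) + 1) ^ p * ((n : ℝ) + 1) ^ q * ‖a i k n‖)) :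
    RapidMat b := fun α β => by
  obtain ⟨C, hC⟩ := h (α + p) (β + q)
  refine ⟨|c| * C, fun i k n => ?_⟩
  calc ((k : ℝ) + 1) ^ α * ((n : ℝ) + 1) ^ β * ‖b i k n‖
      ≤ ((k : ℝ) + 1) ^ α * ((n : ℝ) + 1) ^ β *
        (|c| * (((k : ℝ) + 1) ^ p * ((n : ℝ) + 1) ^ q * ‖a i k n‖)) := by
        gcongr
        refine (hb i k n).trans ?_
        gcongr
        exact le_abs_self c
    _ = |c| * (((k : ℝ) + 1) ^ (α + p) * ((n : ℝ) + 1) ^ (β + q) * ‖a i k n‖) := by ring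
    _ ≤ _ := by gcongr; exact hC i k n

theorem RapidFam.add {ι : Type*} {Y Z : ι → Ell2 →L[ℂ] Ell2} (hY : RapidFam Y)
    (hZ : RapidFam Z) : RapidFam fun i => Y i + Z i := by
  exact (RapidMat.add hY hZ).mono fun i k n => by rw [entry_add]

theorem RapidFam.neg {ι : Type*} {Y : ι → Ell2 →L[ℂ] Ell2} (hY : RapidFam Y) :
    RapidFam fun i => -Y i :=
  RapidMat.mono hY fun i k n => by simp

theorem RapidFam.sub {ι : Type*} {Y Z : ι → Ell2 →L[ℂ] Ell2} (hY : RapidFam Y)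
    (hZ : RapidFam Z) : RapidFam fun i => Y i - Z i := by
  simpa only [sub_eq_add_neg] using hY.add hZ.neg

theorem RapidFam.star {ι : Type*} {Y : ι → Ell2 →L[ℂ] Ell2} (hY : RapidFam Y) :
    RapidFam fun i => star (Y i) := fun α β => by
  obtain ⟨C, hC⟩ := hY β α
  refine ⟨C, fun i k n => ?_⟩
  change _ * ‖entry (Star.star (Y i)) k n‖ ≤ C
  rw [entry_star, norm_star, mul_comm (_ ^ α)]
  exact hC i n k

theorem RapidFam.comp {ι κ : Type*} {Y : ι → Ell2 →L[ℂ] Ell2} (hY : RapidFam Y) (φ : κ → ι) :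
    RapidFam fun i => Y (φ i) := fun α β =>
  (hY α β).imp fun _ h i => h (φ i)

/-- An operator whose matrix is of rapid decay. -/
def Rapid (x : Ell2 →L[ℂ] Ell2) : Prop := RapidFam fun _ : Unit => x

theorem succ_pow_le (d : ℝ) (hd : 0 ≤ d) (α : ℕ) : (d + 1) ^ α ≤ 2 ^ α * (d ^ α + 1) := by
  rcases le_total d 1 with h | h
  · calc (d + 1) ^ α ≤ 2 ^ α := by gcongr; linarith
      _ ≤ 2 ^ α * (d ^ α + 1) := le_mul_of_one_le_right (by positivity) (by linarith [pow_nonneg hd α])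
  · calc (d + 1) ^ α ≤ (2 * d) ^ α := by gcongr; linarith
      _ = 2 ^ α * d ^ α := mul_pow _ _ _
      _ ≤ _ := by gcongr; linarith

/-- Weighted entries that tend to zero are bounded. Conversely, if they are bounded for all weights,
they are absolutely summable, hence tend to zero. -/
theorem mem_rapidDecay_iff (x : Ell2 →L[ℂ] Ell2) : x ∈ rapidDecay ↔ Rapid x := by
  constructor
  · intro h
    have h1 : ∀ α β : ℕ, ∃ C : ℝ, ∀ k n : ℕ, (k : ℝ) ^ α * (n : ℝ) ^ β * ‖entry x k n‖ ≤ C := by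
      intro α β
      obtain ⟨C, hC⟩ := (h α β).norm.bddAbove_range_of_cofinite
      refine ⟨C, fun k n => ?_⟩
      have := hC ⟨(k, n), rfl⟩
      simp only [norm_mul, norm_pow, norm_norm, RCLike.norm_natCast] at this
      calc _ = (k : ℝ) ^ α * ‖entry x k n‖ * (n : ℝ) ^ β := by ring
        _ ≤ C := this
    intro α β
    -- expand the product of the weights `k ^ α + 1` and `n ^ β + 1`
    obtain ⟨C1, h1'⟩ := h1 α β
    obtain ⟨C2, h2'⟩ := h1 α 0
    obtain ⟨C3, h3'⟩ := h1 0 β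
    obtain ⟨C4, h4'⟩ := h1 0 0
    refine ⟨2 ^ α * 2 ^ β * (C1 + C2 + C3 + C4), fun _ k n => ?_⟩
    calc ((k : ℝ) + 1) ^ α * ((n : ℝ) + 1) ^ β * ‖entry x k n‖
        ≤ (2 ^ α * ((k : ℝ) ^ α + 1)) * (2 ^ β * ((n : ℝ) ^ β + 1)) * ‖entry x k n‖ := by
          gcongr <;> exact succ_pow_le _ (by positivity) _
      _ = 2 ^ α * 2 ^ β * ((k : ℝ) ^ α * (n : ℝ) ^ β * ‖entry x k n‖ +
          (k : ℝ) ^ α * (n : ℝ) ^ 0 * ‖entry x k n‖ + (k : ℝ) ^ 0 * (n : ℝ) ^ β * ‖entry x k n‖ +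
          (k : ℝ) ^ 0 * (n : ℝ) ^ 0 * ‖entry x k n‖) := by ring
      _ ≤ _ := by gcongr <;> apply_assumption
  · intro h α β
    have h1 : RapidMat fun (_ : Unit) k n =>
        (k : ℂ) ^ α * ⟪e k, x (e n)⟫_ℂ * (n : ℂ) ^ β := by
      refine RapidMat.of_le_pow h α β 1 fun _ k n => ?_
      simp only [norm_mul, norm_pow, Complex.norm_natCast, one_mul]
      calc (k : ℝ) ^ α * ‖⟪e k, x (e n)⟫_ℂ‖ * (n : ℝ) ^ β
          = (k : ℝ) ^ α * (n : ℝ) ^ β * ‖entry x k n‖ := by rw [entry]; ring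
        _ ≤ _ := by gcongr <;> linarith
    exact (h1.summable ()).tendsto_cofinite_zero

theorem RapidMat.exists_rapid {a : Unit → ℕ → ℕ → ℂ} (h : RapidMat a) :
    ∃ x, Rapid x ∧ ∀ k n, entry x k n = a () k n :=
  ⟨_, h.mono fun _ k n => (congrArg _ (h.entry_ofMatrix () k n)).le,
    fun k n => h.entry_ofMatrix () k n⟩

end QuantumSurface

/-! ### Diagonal operators and compactness in a Hilbert space -/

namespace Unbounded

open Filter

variable {ι H : Type*} [NormedAddCommGroup H] [InnerProductSpace ℂ H]

/-- The bounded operator `b i ↦ μ i • b i`. -/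
def diagonal (b : HilbertBasis ι ℂ H) (μ : ι → ℂ) {K : ℝ} (hK : 0 ≤ K) (h : ∀ i, ‖μ i‖ ≤ K) :
    H →L[ℂ] H :=
  (b.repr.symm.toContinuousLinearEquiv : lp (fun _ : ι => ℂ) 2 →L[ℂ] H) ∘L
    lp.mapCLM 2 (fun i => μ i • ContinuousLinearMap.id ℂ ℂ) hK
      (fun i => (norm_smul_le _ _).trans (by simpa using h i)) ∘L
    (b.repr.toContinuousLinearEquiv : H →L[ℂ] lp (fun _ : ι => ℂ) 2)

theorem inner_diagonal (b : HilbertBasis ι ℂ H) (μ : ι → ℂ) {K : ℝ} (hK : 0 ≤ K)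
    (h : ∀ i, ‖μ i‖ ≤ K) (i : ι) (v : H) :
    ⟪b i, diagonal b μ hK h v⟫_ℂ = μ i * ⟪b i, v⟫_ℂ := by
  rw [← b.repr_apply_apply, ← b.repr_apply_apply]
  simp [diagonal]

theorem norm_diagonal_le (b : HilbertBasis ι ℂ H) (μ : ι → ℂ) {K : ℝ} (hK : 0 ≤ K)
    (h : ∀ i, ‖μ i‖ ≤ K) : ‖diagonal b μ hK h‖ ≤ K := by
  refine ContinuousLinearMap.opNorm_le_bound _ hK fun v => ?_
  have h1 := (lp.mapCLM (E := fun _ : ι => ℂ) 2 (fun i => μ i • ContinuousLinearMap.id ℂ ℂ) hK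
    (fun i => (norm_smul_le _ _).trans (by simpa using h i))).le_of_opNorm_le
      (lp.norm_mapCLM_le _ _ hK _) (b.repr v)
  rw [LinearIsometryEquiv.norm_map] at h1
  simpa [diagonal] using h1

theorem ext_inner_basis (b : HilbertBasis ι ℂ H) {v w : H} (h : ∀ i, ⟪b i, v⟫_ℂ = ⟪b i, w⟫_ℂ) :
    v = w := by
  apply b.repr.injective
  ext i
  rw [b.repr_apply_apply, b.repr_apply_apply, h]

theorem diagonal_apply (b : HilbertBasis ι ℂ H) (μ : ι → ℂ) {K : ℝ} (hK : 0 ≤ K)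
    (h : ∀ i, ‖μ i‖ ≤ K) (i : ι) : diagonal b μ hK h (b i) = μ i • b i := by
  classical
  refine ext_inner_basis b fun j => ?_
  rw [inner_diagonal, inner_smul_right, orthonormal_iff_ite.1 b.orthonormal]
  split_ifs with hij <;> simp [hij]

theorem ext_basis (b : HilbertBasis ι ℂ H) {F : Type*} [NormedAddCommGroup F] [NormedSpace ℂ F]
    {S T : H →L[ℂ] F} (h : ∀ i, S (b i) = T (b i)) : S = T := by
  refine ContinuousLinearMap.ext_on (s := Set.range b) ?_ ?_
  · rw [Submodule.dense_iff_topologicalClosure_eq_top, b.dense_span]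
  · rintro _ ⟨n, rfl⟩
    exact h n

variable {F : Type*} [NormedAddCommGroup F] [NormedSpace ℂ F]

theorem equicontinuous_of_norm_le {κ E : Type*} [NormedAddCommGroup E] [NormedSpace ℂ E]
    {T : κ → E →L[ℂ] F} {C : ℝ} (hT : ∀ j, ‖T j‖ ≤ C) :
    UniformEquicontinuous fun j => (T j : E → F) :=
  LipschitzWith.uniformEquicontinuous _ C.toNNReal fun j =>
    (T j).lipschitz.weaken (by
      rw [← NNReal.coe_le_coe, coe_nnnorm]
      exact (hT j).trans (Real.le_coe_toNNReal C))

/-- The vectors on which a bounded family of operators converges to a given operator form a closed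
subspace. -/
def convergenceSubmodule {κ E : Type*} [NormedAddCommGroup E] [NormedSpace ℂ E] (l : Filter κ)
    (T : κ → E →L[ℂ] F) (T' : E →L[ℂ] F) : Submodule ℂ E where
  carrier := {v | Tendsto (fun j => T j v) l (𝓝 (T' v))}
  zero_mem' := by simp [tendsto_const_nhds]
  add_mem' hx hy := by simpa using! Tendsto.add hx hy
  smul_mem' c _ hx := by simpa using! Tendsto.const_smul hx c

theorem isClosed_convergenceSubmodule {κ E : Type*} [NormedAddCommGroup E] [NormedSpace ℂ E]
    {l : Filter κ} {T : κ → E →L[ℂ] F} (T' : E →L[ℂ] F) {C : ℝ} (hT : ∀ j, ‖T j‖ ≤ C) :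
    IsClosed (convergenceSubmodule l T T' : Set E) :=
  (equicontinuous_of_norm_le hT).equicontinuous.isClosed_setOfPred_tendsto T'.continuous

/-- A bounded family of operators converges strongly if it converges on an orthonormal basis. -/
theorem tendsto_apply_of_basis (b : HilbertBasis ι ℂ H) {κ : Type*} {l : Filter κ}
    {T : κ → H →L[ℂ] F} {T' : H →L[ℂ] F} {C : ℝ} (hT : ∀ j, ‖T j‖ ≤ C)
    (h : ∀ i, Tendsto (fun j => T j (b i)) l (𝓝 (T' (b i)))) (v : H) :
    Tendsto (fun j => T j v) l (𝓝 (T' v)) := by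
  have hs : Submodule.span ℂ (Set.range b) ≤ convergenceSubmodule l T T' :=
    Submodule.span_le.2 (Set.range_subset_iff.2 h)
  have h2 := Submodule.topologicalClosure_minimal _ hs (isClosed_convergenceSubmodule T' hT)
  rw [b.dense_span] at h2
  exact h2 trivial

/-- If `T j → T'` strongly and boundedly and `K` is compact, then `T j ∘ K → T' ∘ K` in norm. -/
theorem tendsto_comp_of_isCompactOperator {κ : Type*} {l : Filter κ} {G : Type*}
    [NormedAddCommGroup G] [NormedSpace ℂ G]
    {T : κ → H →L[ℂ] F} {T' : H →L[ℂ] F} {C : ℝ} (hT : ∀ j, ‖T j‖ ≤ C)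
    (h : ∀ v, Tendsto (fun j => T j v) l (𝓝 (T' v))) {K : G →L[ℂ] H} (hK : IsCompactOperator K) :
    Tendsto (fun j => T j ∘L K) l (𝓝 (T' ∘L K)) := by
  obtain ⟨S, hS, hsub⟩ :=
    IsCompactOperator.image_closedBall_subset_compact (f := (K : G →ₗ[ℂ] H)) hK 1
  have hu := (EquicontinuousOn.tendsto_uniformOnFun_iff_pi' (𝔖 := {S})
    (by simpa using hS) (fun _ _ => (equicontinuous_of_norm_le hT).equicontinuous.equicontinuousOn _)
    l T').2 (by rw [tendsto_pi_nhds]; exact fun v => h v)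
  rw [UniformOnFun.tendsto_iff_tendstoUniformlyOn] at hu
  have hu := hu S rfl
  rw [Metric.tendstoUniformlyOn_iff] at hu
  rw [Metric.tendsto_nhds]
  intro ε hε
  filter_upwards [hu (ε / 2) (by positivity)] with j hj
  rw [dist_eq_norm]
  refine lt_of_le_of_lt ?_ (half_lt_self hε)
  refine ContinuousLinearMap.opNorm_le_of_unit_norm (𝕜 := ℝ)
    (f := ((T j ∘L K - T' ∘L K).restrictScalars ℝ)) (by positivity) fun x hx => ?_
  have := (hj (K x) (hsub ⟨x, by simp [hx], rfl⟩)).le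
  rw [dist_comm, dist_eq_norm] at this
  exact this

theorem isCompactOperator_rankOne (x : F) (y : H) :
    IsCompactOperator (InnerProductSpace.rankOne ℂ x y : H →L[ℂ] F) := by
  rw [InnerProductSpace.rankOne_def']
  exact (isCompactOperator_of_locallyCompactSpace_dom (innerSL ℂ y)).clm_comp
    (ContinuousLinearMap.toSpanSingleton ℂ x)

theorem isCompactOperator_sum {κ : Type*} (s : Finset κ) {T : κ → H →L[ℂ] F}
    (h : ∀ i ∈ s, IsCompactOperator (T i)) : IsCompactOperator (∑ i ∈ s, T i : H →L[ℂ] F) := by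
  classical
  induction s using Finset.induction_on with
  | empty => simpa using! (isCompactOperator_zero : IsCompactOperator (0 : H → F))
  | insert a s ha ih =>
    rw [Finset.sum_insert ha]
    exact (h a (by simp)).add (ih fun i hi => h i (by simp [hi]))

/-- The orthogonal projection onto the span of finitely many basis vectors. -/
def trunc (b : HilbertBasis ι ℂ H) (s : Finset ι) : H →L[ℂ] H :=
  ∑ i ∈ s, InnerProductSpace.rankOne ℂ (b i) (b i)

theorem trunc_apply [DecidableEq ι] (b : HilbertBasis ι ℂ H) (s : Finset ι) (i : ι) :
    trunc b s (b i) = if i ∈ s then b i else 0 := by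
  simp [trunc, orthonormal_iff_ite.1 b.orthonormal]

theorem norm_trunc_le (b : HilbertBasis ι ℂ H) (s : Finset ι) : ‖trunc b s‖ ≤ 1 := by
  classical
  have h : ∀ i, ‖(if i ∈ s then 1 else 0 : ℂ)‖ ≤ 1 := fun i => by split_ifs <;> simp
  rw [show trunc b s = diagonal b _ zero_le_one h from ext_basis b fun i => by
    rw [trunc_apply, diagonal_apply]; split_ifs <;> simp]
  exact norm_diagonal_le _ _ _ _

theorem tendsto_trunc (b : HilbertBasis ι ℂ H) (v : H) :
    Tendsto (fun s => trunc b s v) atTop (𝓝 v) := by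
  classical
  refine tendsto_apply_of_basis (T' := ContinuousLinearMap.id ℂ H) b (norm_trunc_le b)
    (fun i => ?_) v
  refine tendsto_const_nhds.congr' ?_
  filter_upwards [eventually_ge_atTop {i}] with s hs
  rw [trunc_apply, if_pos (by simpa using hs)]
  rfl

/-- A closed subspace of operators that contains the matrix units of an orthonormal basis contains
all compact operators. -/
theorem mem_of_isCompactOperator [CompleteSpace H] (b : HilbertBasis ι ℂ H)
    {V : Submodule ℂ (H →L[ℂ] H)}
    (hV : IsClosed (V : Set (H →L[ℂ] H)))
    (h : ∀ i j, InnerProductSpace.rankOne ℂ (b i) (b j) ∈ V)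
    {K : H →L[ℂ] H} (hK : IsCompactOperator K) : K ∈ V := by
  -- approximate `w` by `trunc b s w`, and then `K` by `trunc b s ∘ K`
  have h1 : ∀ i (w : H), InnerProductSpace.rankOne ℂ (b i) w ∈ V := fun i w => by
    have hc : Continuous fun w : H => InnerProductSpace.rankOne ℂ (b i) w :=
      (InnerProductSpace.rankOne ℂ (b i)).continuous
    refine hV.mem_of_tendsto ((hc.tendsto w).comp (tendsto_trunc b w)) (.of_forall fun s => ?_)
    simp only [Function.comp, trunc, sum_apply,
      InnerProductSpace.rankOne_apply, map_sum, map_smulₛₗ]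
    exact V.sum_mem fun j _ => V.smul_mem _ (h i j)
  have h2 := tendsto_comp_of_isCompactOperator (T' := ContinuousLinearMap.id ℂ H) (norm_trunc_le b)
    (tendsto_trunc b) hK
  refine hV.mem_of_tendsto h2 (.of_forall fun s => ?_)
  rw [trunc, ContinuousLinearMap.finsetSum_comp]
  refine V.sum_mem fun i _ => ?_
  rw [InnerProductSpace.rankOne_comp]
  exact h1 i _

/-- A diagonal operator whose diagonal tends to zero is compact. -/
theorem isCompactOperator_of_diagonal [CompleteSpace H] (b : HilbertBasis ι ℂ H) {μ : ι → ℂ}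
    (hμ : Tendsto μ cofinite (𝓝 0)) {T : H →L[ℂ] H} (hT : ∀ i, T (b i) = μ i • b i) :
    IsCompactOperator T := by
  classical
  refine isCompactOperator_of_tendsto (l := (atTop : Filter (Finset ι)))
    (F := fun s => T ∘L trunc b s) ?_ (.of_forall fun s => ?_)
  · rw [Metric.tendsto_nhds]
    intro ε hε
    have hfin : {i | ¬ ‖μ i‖ < ε / 2}.Finite := by
      have := (tendsto_zero_iff_norm_tendsto_zero.1 hμ).eventually_lt_const (half_pos hε)
      exact this
    filter_upwards [eventually_ge_atTop hfin.toFinset] with s hs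
    have h : ∀ i, ‖(if i ∈ s then 0 else μ i : ℂ)‖ ≤ ε / 2 := fun i => by
      split_ifs with hi
      · simpa using (half_pos hε).le
      · by_contra hcon
        exact hi (hs (hfin.mem_toFinset.2 fun h => hcon h.le))
    -- beyond `s`, the operator is diagonal with entries of modulus at most `ε / 2`
    rw [dist_comm, dist_eq_norm, show T - T ∘L trunc b s = diagonal b _ (half_pos hε).le h from
      ext_basis b fun i => by
        rw [diagonal_apply, sub_apply, ContinuousLinearMap.comp_apply, trunc_apply]
        split_ifs <;> simp [hT]]
    exact (norm_diagonal_le _ _ _ _).trans_lt (half_lt_self hε)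
  · exact (isCompactOperator_sum s fun i _ => isCompactOperator_rankOne _ _).clm_comp T

end Unbounded

namespace QuantumSurface

open Filter Unbounded

/-! ### The derivation `[N, ·]` and smooth families of operators -/

/-- The bounded operator `x'` is the commutator `[N, x]`, in terms of matrix entries. -/
def HasDelta (x x' : Ell2 →L[ℂ] Ell2) : Prop :=
  ∀ k n : ℕ, ((k : ℂ) - n) * entry x k n = entry x' k n

theorem HasDelta.add {x x' y y' : Ell2 →L[ℂ] Ell2} (hx : HasDelta x x') (hy : HasDelta y y') :
    HasDelta (x + y) (x' + y') := fun k n => by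
  rw [entry_add, entry_add, mul_add, hx, hy]

theorem HasDelta.smul {x x' : Ell2 →L[ℂ] Ell2} (hx : HasDelta x x') (c : ℂ) :
    HasDelta (c • x) (c • x') := fun k n => by
  rw [entry_smul, entry_smul, mul_left_comm, hx]

theorem HasDelta.mul {x x' y y' : Ell2 →L[ℂ] Ell2} (hx : HasDelta x x') (hy : HasDelta y y') :
    HasDelta (x * y) (x' * y + x * y') := fun k n => by
  have h1 := (hasSum_entry_mul x' y k n).add (hasSum_entry_mul x y' k n)
  have h2 := (hasSum_entry_mul x y k n).mul_left ((k : ℂ) - n)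
  rw [entry_add]
  refine h2.unique ?_
  convert! h1 using 2 with m
  rw [← hx, ← hy]
  ring

theorem hasDelta_one : HasDelta 1 0 := fun k n => by
  rw [entry_one, entry_zero]
  split_ifs with h <;> simp [h]

theorem HasDelta.star {x x' : Ell2 →L[ℂ] Ell2} (hx : HasDelta x x') :
    HasDelta (star x) (-star x') := fun k n => by
  rw [entry_neg, entry_star, entry_star, ← hx]
  simp
  ring

theorem norm_regularizer_le (ε : ℝ) (hε : 0 ≤ ε) (n : ℕ) : ‖((1 + ε * n : ℝ) : ℂ)⁻¹‖ ≤ 1 := by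
  have h : (1 : ℝ) ≤ 1 + ε * n := by have := mul_nonneg hε n.cast_nonneg; linarith
  rw [norm_inv, Complex.norm_real, Real.norm_of_nonneg (by linarith)]
  exact inv_le_one_of_one_le₀ h

/-- The contraction `r_ε = (1 + ε N)⁻¹`. -/
def regularizer (ε : ℝ) (hε : 0 ≤ ε) : Ell2 →L[ℂ] Ell2 :=
  diagonal e (fun n => ((1 + ε * n : ℝ) : ℂ)⁻¹) zero_le_one (norm_regularizer_le ε hε)

theorem regularizer_apply (ε : ℝ) (hε : 0 ≤ ε) (v : Ell2) (k : ℕ) :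
    regularizer ε hε v k = ((1 + ε * k : ℝ) : ℂ)⁻¹ * v k := by
  rw [← inner_e_eq, ← inner_e_eq]
  exact inner_diagonal _ _ _ _ _ _

theorem tendsto_regularizer (v : Ell2) :
    Tendsto (fun j : ℕ => regularizer ((j : ℝ) + 1)⁻¹ (by positivity) v) atTop (𝓝 v) := by
  refine tendsto_apply_of_basis (T' := ContinuousLinearMap.id ℂ Ell2) e
    (fun j => norm_diagonal_le e _ _ _) (fun i => ?_) v
  have h1 : Tendsto (fun j : ℕ => ((j : ℝ) + 1)⁻¹) atTop (𝓝 0) := by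
    simpa using! tendsto_one_div_add_atTop_nhds_zero_nat (𝕜 := ℝ)
  have h2 : Tendsto (fun j : ℕ => ((1 + ((j : ℝ) + 1)⁻¹ * i : ℝ) : ℂ)⁻¹ • e i) atTop
      (𝓝 (((1 + 0 * i : ℝ) : ℂ)⁻¹ • e i)) := by
    refine Tendsto.smul_const (Tendsto.inv₀ ?_ (by simp)) _
    exact (Complex.continuous_ofReal.tendsto _).comp ((h1.mul_const _).const_add _)
  convert! h2 using 2 with j
  · exact diagonal_apply _ _ _ _ _
  · simp

theorem entry_regularizer_mul (ε : ℝ) (hε : 0 ≤ ε) (x : Ell2 →L[ℂ] Ell2) (k n : ℕ) :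
    entry (regularizer ε hε * x) k n = ((1 + ε * k : ℝ) : ℂ)⁻¹ * entry x k n := by
  rw [entry, entry, inner_e_eq, inner_e_eq]
  exact regularizer_apply ε hε _ _

theorem entry_mul_regularizer (ε : ℝ) (hε : 0 ≤ ε) (x : Ell2 →L[ℂ] Ell2) (k n : ℕ) :
    entry (x * regularizer ε hε) k n = ((1 + ε * n : ℝ) : ℂ)⁻¹ * entry x k n := by
  have : regularizer ε hε (e n) = ((1 + ε * n : ℝ) : ℂ)⁻¹ • e n := diagonal_apply _ _ _ _ _
  rw [entry, entry, mul_apply_eq_comp, this, map_smul, inner_smul_right]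

/-- The domain of the derivation `[N, ·]` is stable under inversion. With `r_ε = (1 + ε N)⁻¹` one
has `[r_ε, x] = -ε r_ε x' r_ε`, hence `[y, r_ε] = -ε y r_ε x' r_ε y`; divide by `ε` and use that
`r_ε → 1` strongly. -/
theorem HasDelta.inverse {x x' y : Ell2 →L[ℂ] Ell2} (hx : HasDelta x x') (hxy : x * y = 1)
    (hyx : y * x = 1) : HasDelta y (-(y * x' * y)) := fun k n => by
  have key : ∀ (ε : ℝ) (hε : 0 < ε),
      ((k : ℂ) - n) * entry (regularizer ε hε.le * (y * regularizer ε hε.le)) k n =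
      -⟪ContinuousLinearMap.adjoint y (e k),
        regularizer ε hε.le (x' (regularizer ε hε.le (y (e n))))⟫_ℂ := by
    intro ε hε
    set r := regularizer ε hε.le with hr
    have hc0 : ∀ m : ℕ, (1 + ε * m : ℂ) ≠ 0 := fun m => by
      have : (0 : ℝ) < 1 + ε * m := by have := mul_nonneg hε.le m.cast_nonneg; linarith
      exact_mod_cast this.ne'
    have hε0 : (ε : ℂ) ≠ 0 := by exact_mod_cast hε.ne'
    have h1 : r * x - x * r = -(ε : ℂ) • (r * (x' * r)) := entry_ext fun i j => by
      rw [entry_sub, entry_smul, entry_regularizer_mul, entry_mul_regularizer,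
        entry_regularizer_mul, entry_mul_regularizer, ← hx]
      have := hc0 i
      have := hc0 j
      push_cast
      field_simp
      ring
    have h2 : y * r - r * y = -(ε : ℂ) • (y * (r * (x' * (r * y)))) := by
      calc y * r - r * y = y * (r * (x * y)) - (y * x) * (r * y) := by rw [hxy, hyx]; simp
        _ = y * (r * x - x * r) * y := by noncomm_ring
        _ = _ := by rw [h1]; simp only [mul_smul_comm, smul_mul_assoc, mul_assoc]
    have h3 := congrArg (fun z => entry z k n) h2
    simp only [entry_sub, entry_smul, hr, entry_regularizer_mul, entry_mul_regularizer] at h3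
    rw [entry_regularizer_mul, entry_mul_regularizer, ContinuousLinearMap.adjoint_inner_left]
    change _ = -entry (y * (r * (x' * (r * y)))) k n
    apply mul_left_cancel₀ hε0
    rw [mul_neg, ← neg_mul, hr, ← h3]
    have := hc0 k
    have := hc0 n
    push_cast
    field_simp
    ring
  have hpos : ∀ j : ℕ, (0 : ℝ) < ((j : ℝ) + 1)⁻¹ := fun j => by positivity
  have hR : ∀ j : ℕ, ‖regularizer ((j : ℝ) + 1)⁻¹ (hpos j).le‖ ≤ 1 := fun j =>
    norm_diagonal_le _ _ _ _
  have hstrong : ∀ (w : ℕ → Ell2) (w' : Ell2), Tendsto w atTop (𝓝 w') →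
      Tendsto (fun j : ℕ => regularizer ((j : ℝ) + 1)⁻¹ (hpos j).le (w j)) atTop (𝓝 w') := by
    intro w w' hw
    have h1 : Tendsto (fun j : ℕ => regularizer ((j : ℝ) + 1)⁻¹ (hpos j).le (w j - w')) atTop
        (𝓝 0) := by
      refine squeeze_zero_norm (fun j => ContinuousLinearMap.le_of_opNorm_le _ (hR j) _) ?_
      simpa using (hw.sub_const w').norm
    simpa using! h1.add (tendsto_regularizer w')
  have hv := hstrong _ _ ((x'.continuous.tendsto _).comp
    (hstrong _ _ (tendsto_const_nhds (x := y (e n)))))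
  have hl := ((hstrong _ _ ((y.continuous.tendsto _).comp (tendsto_regularizer (e n)))))
  have hl2 := (tendsto_const_nhds (x := e k)).inner (𝕜 := ℂ) hl
  have hr2 := ((tendsto_const_nhds (x := ContinuousLinearMap.adjoint y (e k))).inner
    (𝕜 := ℂ) hv).neg
  have := tendsto_nhds_unique (hl2.const_mul ((k : ℂ) - n)) (hr2.congr fun j =>
    (key _ (hpos j)).symm)
  rw [ContinuousLinearMap.adjoint_inner_left] at this
  rw [entry_neg]
  exact this

/-- A norm continuous family of operators whose first `n` iterated commutators with `N` are bounded
and norm continuous in the parameter. -/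
def IsSmoothFam {ι : Type*} [TopologicalSpace ι] : ℕ → (ι → Ell2 →L[ℂ] Ell2) → Prop
  | 0, Y => Continuous Y
  | n + 1, Y => Continuous Y ∧
      ∃ Y' : ι → Ell2 →L[ℂ] Ell2, (∀ i, HasDelta (Y i) (Y' i)) ∧ IsSmoothFam n Y'

section Fam

variable {ι : Type*} [TopologicalSpace ι] {Y Z : ι → Ell2 →L[ℂ] Ell2} {n : ℕ}

theorem IsSmoothFam.continuous (h : IsSmoothFam n Y) : Continuous Y := by
  cases n with
  | zero => exact h
  | succ n => exact h.1

theorem IsSmoothFam.of_succ (h : IsSmoothFam (n + 1) Y) : IsSmoothFam n Y := by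
  induction n generalizing Y with
  | zero => exact h.1
  | succ n ih =>
    obtain ⟨h1, Y', h2, h3⟩ := h
    exact ⟨h1, Y', h2, ih h3⟩

theorem isSmoothFam_zero : IsSmoothFam n fun _ : ι => (0 : Ell2 →L[ℂ] Ell2) := by
  induction n with
  | zero => exact continuous_const
  | succ n ih => exact ⟨continuous_const, _, fun _ _ _ => by simp, ih⟩

theorem isSmoothFam_one : IsSmoothFam n fun _ : ι => (1 : Ell2 →L[ℂ] Ell2) := by
  cases n with
  | zero => exact continuous_const
  | succ n => exact ⟨continuous_const, _, fun _ => hasDelta_one, isSmoothFam_zero⟩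

theorem IsSmoothFam.add (hY : IsSmoothFam n Y) (hZ : IsSmoothFam n Z) :
    IsSmoothFam n fun i => Y i + Z i := by
  induction n generalizing Y Z with
  | zero => exact Continuous.add hY hZ
  | succ n ih =>
    obtain ⟨h1, Y', h2, h3⟩ := hY
    obtain ⟨h4, Z', h5, h6⟩ := hZ
    exact ⟨h1.add h4, _, fun i => (h2 i).add (h5 i), ih h3 h6⟩

theorem IsSmoothFam.smul {c : ι → ℂ} (hc : Continuous c) (hY : IsSmoothFam n Y) :
    IsSmoothFam n fun i => c i • Y i := by
  induction n generalizing Y with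
  | zero => exact Continuous.smul hc hY
  | succ n ih =>
    obtain ⟨h1, Y', h2, h3⟩ := hY
    exact ⟨hc.smul h1, _, fun i => (h2 i).smul (c i), ih h3⟩

theorem IsSmoothFam.neg (hY : IsSmoothFam n Y) : IsSmoothFam n fun i => -Y i := by
  simpa using hY.smul (continuous_const (y := (-1 : ℂ)))

theorem IsSmoothFam.sub (hY : IsSmoothFam n Y) (hZ : IsSmoothFam n Z) :
    IsSmoothFam n fun i => Y i - Z i := by
  simpa only [sub_eq_add_neg] using hY.add hZ.neg

theorem IsSmoothFam.mul (hY : IsSmoothFam n Y) (hZ : IsSmoothFam n Z) :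
    IsSmoothFam n fun i => Y i * Z i := by
  induction n generalizing Y Z with
  | zero => exact Continuous.mul hY hZ
  | succ n ih =>
    obtain ⟨h1, Y', h2, h3⟩ := id hY
    obtain ⟨h4, Z', h5, h6⟩ := id hZ
    exact ⟨h1.mul h4, _, fun i => (h2 i).mul (h5 i), (ih h3 hZ.of_succ).add (ih hY.of_succ h6)⟩

theorem IsSmoothFam.star (hY : IsSmoothFam n Y) : IsSmoothFam n fun i => star (Y i) := by
  induction n generalizing Y with
  | zero => exact Continuous.star hY
  | succ n ih =>
    obtain ⟨h1, Y', h2, h3⟩ := hY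
    exact ⟨h1.star, _, fun i => (h2 i).star, (ih h3).neg⟩

theorem IsSmoothFam.comp {κ : Type*} [TopologicalSpace κ] (hY : IsSmoothFam n Y) {φ : κ → ι}
    (hφ : Continuous φ) : IsSmoothFam n fun i => Y (φ i) := by
  induction n generalizing Y with
  | zero => exact Continuous.comp hY hφ
  | succ n ih =>
    obtain ⟨h1, Y', h2, h3⟩ := hY
    exact ⟨h1.comp hφ, _, fun i => h2 (φ i), ih h3⟩

/-- Differentiability is stable under inversion, since `δ(y) = -y δ(x) y` for `y = x⁻¹`. -/
theorem IsSmoothFam.inverse (hY : IsSmoothFam n Y) (hZ : Continuous Z) (h1 : ∀ i, Y i * Z i = 1)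
    (h2 : ∀ i, Z i * Y i = 1) : IsSmoothFam n Z := by
  induction n with
  | zero => exact hZ
  | succ n ih =>
    have hZ' := ih hY.of_succ
    obtain ⟨h3, Y', h4, h5⟩ := hY
    exact ⟨hZ, _, fun i => (h4 i).inverse (h1 i) (h2 i), ((hZ'.mul h5).mul hZ').neg⟩

variable [CompactSpace ι]

theorem IsSmoothFam.exists_norm_le (hY : IsSmoothFam n Y) : ∃ C, ∀ i, ‖Y i‖ ≤ C := by
  obtain ⟨C, hC⟩ := (isCompact_range hY.continuous).isBounded.exists_norm_le
  exact ⟨C, fun i => hC _ ⟨i, rfl⟩⟩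

/-- The matrix entries of a smooth family decay rapidly away from the diagonal. -/
theorem IsSmoothFam.exists_entry_le (hY : IsSmoothFam n Y) :
    ∃ C : ℝ, ∀ i (k m : ℕ), (|(k : ℝ) - m| + 1) ^ n * ‖entry (Y i) k m‖ ≤ C := by
  have aux : ∀ {n : ℕ} {Y : ι → Ell2 →L[ℂ] Ell2}, IsSmoothFam n Y →
      ∃ C : ℝ, ∀ i (k m : ℕ), |(k : ℝ) - m| ^ n * ‖entry (Y i) k m‖ ≤ C := by
    intro n
    induction n with
    | zero =>
      intro Y hY
      obtain ⟨C, hC⟩ := hY.exists_norm_le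
      exact ⟨C, fun i k m => by simpa using (norm_entry_le _ _ _).trans (hC i)⟩
    | succ n ih =>
      rintro Y ⟨h1, Y', h2, h3⟩
      obtain ⟨C, hC⟩ := ih h3
      refine ⟨C, fun i k m => (hC i k m).trans' (le_of_eq ?_)⟩
      rw [← h2 i k m, norm_mul, pow_succ, mul_assoc]
      congr 2
      rw [← Real.norm_eq_abs, ← Complex.norm_real]
      push_cast
      rfl
  obtain ⟨C, hC⟩ := aux hY
  obtain ⟨C', hC'⟩ := hY.exists_norm_le
  refine ⟨2 ^ n * (C + C'), fun i k m => ?_⟩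
  calc (|(k : ℝ) - m| + 1) ^ n * ‖entry (Y i) k m‖
      ≤ 2 ^ n * (|(k : ℝ) - m| ^ n + 1) * ‖entry (Y i) k m‖ := by
        gcongr; exact succ_pow_le _ (abs_nonneg _) _
    _ = 2 ^ n * (|(k : ℝ) - m| ^ n * ‖entry (Y i) k m‖ + ‖entry (Y i) k m‖) := by ring
    _ ≤ _ := by gcongr; exacts [hC i k m, (norm_entry_le _ _ _).trans (hC' i)]

/-- A smooth family times a rapidly decaying family is rapidly decaying. -/
theorem RapidFam.smooth_mul (hY : ∀ n, IsSmoothFam n Y) (hZ : RapidFam Z) :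
    RapidFam fun i => Y i * Z i := fun α β => by
  obtain ⟨C, hC⟩ := (hY α).exists_entry_le
  obtain ⟨C', hC'0, hC'⟩ := RapidMat.exists_le hZ (α + 2) β
  refine ⟨∑' m : ℕ, C * C' * (((m : ℝ) + 1) ^ 2)⁻¹, fun i k n => ?_⟩
  have hs := hasSum_entry_mul (Y i) (Z i) k n
  have hs2 := summable_one_div_succ_sq.mul_left (C * C')
  have h1 : ∀ m : ℕ, ‖((((k : ℝ) + 1) ^ α * ((n : ℝ) + 1) ^ β : ℝ) : ℂ) *
      (entry (Y i) k m * entry (Z i) m n)‖ ≤ C * C' * (((m : ℝ) + 1) ^ 2)⁻¹ := fun m => by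
    -- the weight in `k` is shared between the decay of `Y` off the diagonal and that of `Z` in `m`
    have hkm : (k : ℝ) + 1 ≤ (|(k : ℝ) - m| + 1) * ((m : ℝ) + 1) := by
      have h2 := le_abs_self ((k : ℝ) - m)
      have h3 := mul_nonneg (abs_nonneg ((k : ℝ) - m)) (Nat.cast_nonneg (α := ℝ) m)
      nlinarith
    have hC0 := hC i k m
    rw [norm_mul, norm_mul, Complex.norm_real, Real.norm_of_nonneg (by positivity)]
    calc ((k : ℝ) + 1) ^ α * ((n : ℝ) + 1) ^ β * (‖entry (Y i) k m‖ * ‖entry (Z i) m n‖)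
        ≤ ((|(k : ℝ) - m| + 1) * ((m : ℝ) + 1)) ^ α * ((n : ℝ) + 1) ^ β *
          (‖entry (Y i) k m‖ * (C' * (((m : ℝ) + 1) ^ (α + 2))⁻¹ * (((n : ℝ) + 1) ^ β)⁻¹)) := by
          gcongr
          exact hC' i m n
      _ = ((|(k : ℝ) - m| + 1) ^ α * ‖entry (Y i) k m‖) * C' * (((m : ℝ) + 1) ^ 2)⁻¹ := by
          rw [mul_pow, pow_add]
          field_simp
      _ ≤ _ := by gcongr
  have h4 := tsum_of_norm_bounded hs2.hasSum h1
  rwa [tsum_mul_left, hs.tsum_eq, norm_mul, Complex.norm_real,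
    Real.norm_of_nonneg (by positivity)] at h4

theorem RapidFam.mul_smooth (hZ : RapidFam Z) (hY : ∀ n, IsSmoothFam n Y) :
    RapidFam fun i => Z i * Y i := by
  have := (RapidFam.smooth_mul (fun n => (hY n).star) hZ.star).star
  simpa using! this

end Fam

/-- A smooth operator: all iterated commutators with `N` are bounded. -/
def Smooth (x : Ell2 →L[ℂ] Ell2) : Prop := ∀ n, IsSmoothFam n fun _ : Unit => x

theorem Smooth.fam {ι : Type*} [TopologicalSpace ι] {x : Ell2 →L[ℂ] Ell2} (h : Smooth x) (n : ℕ) :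
    IsSmoothFam n fun _ : ι => x := (h n).comp (φ := fun _ => ()) continuous_const

theorem Smooth.exists_hasDelta {x : Ell2 →L[ℂ] Ell2} (h : Smooth x) :
    ∃ x', HasDelta x x' ∧ Smooth x' := by
  obtain ⟨-, Y, h2, -⟩ := h 1
  refine ⟨Y (), h2 (), fun n => ?_⟩
  obtain ⟨-, Z, h3, h4⟩ := h (n + 1)
  have : Z = fun _ => Y () := funext fun i => entry_ext fun k m => by
    rw [← h3 i k m, ← h2 () k m]
  rwa [this] at h4

/-- A coinductive criterion for smoothness: the operator lies in a class in which every element has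
a commutator with `N` that is again in the class. -/
theorem smooth_of_forall {p : (Ell2 →L[ℂ] Ell2) → Prop}
    (hp : ∀ x, p x → ∃ x', HasDelta x x' ∧ p x') {x : Ell2 →L[ℂ] Ell2} (hx : p x) : Smooth x := by
  intro n
  induction n generalizing x with
  | zero => exact continuous_const
  | succ n ih =>
    obtain ⟨x', h1, h2⟩ := hp x hx
    exact ⟨continuous_const, _, fun _ => h1, ih h2⟩

theorem Rapid.exists_hasDelta {x : Ell2 →L[ℂ] Ell2} (h : Rapid x) :
    ∃ x', HasDelta x x' ∧ Rapid x' := by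
  have h1 : RapidMat fun (_ : Unit) k n => ((k : ℂ) - n) * entry x k n := by
    refine RapidMat.of_le_pow h 1 1 1 fun _ k n => ?_
    rw [norm_mul, one_mul]
    gcongr
    refine (norm_sub_le _ _).trans ?_
    simp only [Complex.norm_natCast, pow_one]
    nlinarith [Nat.cast_nonneg (α := ℝ) k, Nat.cast_nonneg (α := ℝ) n,
      mul_nonneg (Nat.cast_nonneg (α := ℝ) k) (Nat.cast_nonneg (α := ℝ) n)]
  obtain ⟨x', hx', h2⟩ := h1.exists_rapid
  exact ⟨x', fun k n => (h2 k n).symm, hx'⟩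

theorem Rapid.smooth {x : Ell2 →L[ℂ] Ell2} (h : Rapid x) : Smooth x :=
  smooth_of_forall (fun _ => Rapid.exists_hasDelta) h

theorem Rapid.isCompactOperator {x : Ell2 →L[ℂ] Ell2} (h : Rapid x) : IsCompactOperator x := by
  -- the expansion in matrix units converges in norm
  refine isCompactOperator_of_tendsto (RapidFam.hasSum h ()) (.of_forall fun s => ?_)
  exact isCompactOperator_sum s fun p _ => (isCompactOperator_rankOne (e p.1) (e p.2)).smul (entry x p.1 p.2)

theorem Smooth.add {x y : Ell2 →L[ℂ] Ell2} (hx : Smooth x) (hy : Smooth y) : Smooth (x + y) :=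
  fun n => (hx n).add (hy n)

theorem Smooth.mul {x y : Ell2 →L[ℂ] Ell2} (hx : Smooth x) (hy : Smooth y) : Smooth (x * y) :=
  fun n => (hx n).mul (hy n)

theorem Smooth.star {x : Ell2 →L[ℂ] Ell2} (hx : Smooth x) : Smooth (star x) := fun n => (hx n).star

theorem Smooth.sub {x y : Ell2 →L[ℂ] Ell2} (hx : Smooth x) (hy : Smooth y) : Smooth (x - y) :=
  fun n => (hx n).sub (hy n)

end QuantumSurface

namespace QuantumSurface

open Filter Unbounded

/-! ### Toeplitz operators -/

theorem entry_toeplitz (f : C(Circ, ℂ)) (k n : ℕ) :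
    entry (toeplitz f) k n = fourierCoeff f ((k : ℤ) - n) := inner_toeplitz f k n

/-- Multiplication by a continuous function does not increase the norm. -/
theorem norm_mulOp_le (f : C(Circ, ℂ)) : ‖mulOp f‖ ≤ ‖f‖ := by
  refine ContinuousLinearMap.opNorm_le_bound _ (norm_nonneg _) fun φ => ?_
  have h1 : ‖mulOp f φ‖ ≤ ‖ContinuousLinearMap.mul ℂ ℂ‖ *
      ‖ContinuousMap.toLp (E := ℂ) ∞ AddCircle.haarAddCircle ℂ f‖ * ‖φ‖ :=
    ContinuousLinearMap.norm_holder_apply_apply_le _ _ _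
  refine h1.trans ?_
  gcongr
  rw [ContinuousLinearMap.opNorm_mul, one_mul]
  refine (ContinuousLinearMap.le_opNorm _ f).trans ?_
  refine mul_le_of_le_one_left (norm_nonneg f) ((ContinuousMap.toLp_norm_le _).trans ?_)
  simp

theorem toeplitz_add (f g : C(Circ, ℂ)) : toeplitz (f + g) = toeplitz f + toeplitz g := by
  simp [toeplitz, mulOp]

theorem toeplitz_smul (c : ℂ) (f : C(Circ, ℂ)) : toeplitz (c • f) = c • toeplitz f := by
  simp [toeplitz, mulOp]

theorem norm_toeplitz_le (f : C(Circ, ℂ)) : ‖toeplitz f‖ ≤ ‖f‖ := by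
  have h1 : ‖hardyEmbedding.toContinuousLinearMap‖ ≤ 1 :=
    hardyEmbedding.norm_toContinuousLinearMap_le
  have h2 : ‖(hardyEmbedding.toContinuousLinearMap).adjoint‖ ≤ 1 := by
    rwa [LinearIsometryEquiv.norm_map]
  calc ‖toeplitz f‖ ≤ ‖(hardyEmbedding.toContinuousLinearMap).adjoint‖ *
        (‖mulOp f‖ * ‖hardyEmbedding.toContinuousLinearMap‖) :=
        (ContinuousLinearMap.opNorm_comp_le _ _).trans (by
          gcongr; exact ContinuousLinearMap.opNorm_comp_le _ _)
    _ ≤ 1 * (‖f‖ * 1) := by gcongr; exact norm_mulOp_le f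
    _ = ‖f‖ := by ring

/-- The map `f ↦ T_f` as a bounded linear map. -/
def toeplitzL : C(Circ, ℂ) →L[ℂ] (Ell2 →L[ℂ] Ell2) :=
  LinearMap.mkContinuous ⟨⟨toeplitz, toeplitz_add⟩, toeplitz_smul⟩ 1 fun f => by
    simpa using! norm_toeplitz_le f

theorem toeplitzL_apply (f : C(Circ, ℂ)) : toeplitzL f = toeplitz f := rfl

theorem norm_toeplitzL_le : ‖toeplitzL‖ ≤ 1 := LinearMap.mkContinuous_norm_le _ zero_le_one _

theorem toeplitz_sub (f g : C(Circ, ℂ)) : toeplitz (f - g) = toeplitz f - toeplitz g :=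
  map_sub toeplitzL f g

theorem toeplitz_star (f : C(Circ, ℂ)) : star (toeplitz f) = toeplitz (star f) := by
  refine entry_ext fun k n => ?_
  rw [entry_star, entry_toeplitz, entry_toeplitz, fourierCoeff, fourierCoeff]
  change (starRingEnd ℂ) _ = _
  rw [← integral_conj]
  refine MeasureTheory.integral_congr_ae (.of_forall fun x => ?_)
  simp only [smul_eq_mul, map_mul, ContinuousMap.star_apply, RCLike.star_def]
  rw [← fourier_neg]
  congr 3
  ring

theorem entry_toeplitz_fourier (j : ℤ) (k n : ℕ) :
    entry (toeplitz (fourier j)) k n = if (k : ℤ) - n = j then 1 else 0 := by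
  rw [entry_toeplitz, fourierCoeff_fourier]
  simp [Pi.single_apply]

theorem toeplitz_one : toeplitz 1 = 1 := by
  have : (1 : C(Circ, ℂ)) = fourier 0 := by ext x; simp
  rw [this]
  refine entry_ext fun k n => ?_
  rw [entry_toeplitz_fourier, entry_one]
  simp [sub_eq_zero]

theorem toeplitz_fourier_apply_e (j : ℤ) (n m : ℕ) (h : (m : ℤ) = n + j) :
    toeplitz (fourier j) (e n) = e m := by
  refine ext_inner_basis e fun k => ?_
  change entry _ _ _ = _
  rw [entry_toeplitz_fourier, inner_e_e]
  congr 1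
  simp only [eq_iff_iff]
  omega

theorem fourierCoeff_mul_fourier (f : C(Circ, ℂ)) (i j : ℤ) :
    fourierCoeff (f * fourier j : C(Circ, ℂ)) i = fourierCoeff f (i - j) := by
  rw [fourierCoeff, fourierCoeff]
  congr 1
  ext x
  rw [neg_sub, sub_eq_add_neg, add_comm, fourier_add]
  simp only [ContinuousMap.mul_apply, smul_eq_mul]
  ring

/-- Fourier induction: a closed subspace of `C(𝕊¹)` that contains the characters is everything. -/
theorem induction_fourier {V : Submodule ℂ C(Circ, ℂ)} (hV : IsClosed (V : Set C(Circ, ℂ)))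
    (h : ∀ j, fourier j ∈ V) (f : C(Circ, ℂ)) : f ∈ V := by
  have h1 : Submodule.span ℂ (Set.range (fourier (T := 2 * Real.pi))) ≤ V :=
    Submodule.span_le.2 (Set.range_subset_iff.2 h)
  have h2 := Submodule.topologicalClosure_minimal _ h1 hV
  rw [span_fourier_closure_eq_top] at h2
  exact h2 trivial

/-- The compact operators as a closed subspace. -/
def compacts : Submodule ℂ (Ell2 →L[ℂ] Ell2) where
  carrier := {x | IsCompactOperator x}
  zero_mem' := (isCompactOperator_zero : IsCompactOperator (0 : Ell2 → Ell2))
  add_mem' hx hy := hx.add hy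
  smul_mem' c _ hx := hx.smul c

theorem isClosed_compacts : IsClosed (compacts : Set (Ell2 →L[ℂ] Ell2)) :=
  isClosed_setOfPred_isCompactOperator

/-- An operator that annihilates all but finitely many basis vectors is compact. -/
theorem isCompactOperator_of_apply_e_eq_zero {x : Ell2 →L[ℂ] Ell2} (m : ℕ)
    (h : ∀ n, m ≤ n → x (e n) = 0) : IsCompactOperator x := by
  have : x = x ∘L trunc e (Finset.range m) := ext_basis e fun n => by
    rw [ContinuousLinearMap.comp_apply, trunc_apply]
    split_ifs with hn
    · rfl
    · rw [map_zero, h n (by simpa using hn)]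
  rw [this]
  exact (isCompactOperator_sum _ fun i _ => isCompactOperator_rankOne (e i) (e i)).clm_comp x

/-- `T_f T_g - T_{fg}` is compact: for `g = uʲ` it annihilates `eₙ` as soon as `n + j ≥ 0`, and the
functions `g` with this property form a closed subspace. -/
theorem toeplitz_mul_sub_mem (f g : C(Circ, ℂ)) :
    toeplitz f * toeplitz g - toeplitz (f * g) ∈ compacts := by
  let X : C(Circ, ℂ) →L[ℂ] (Ell2 →L[ℂ] Ell2) :=
    ContinuousLinearMap.mul ℂ _ (toeplitz f) ∘L toeplitzL -
      toeplitzL ∘L ContinuousLinearMap.mul ℂ _ f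
  have hX : ∀ g, X g = toeplitz f * toeplitz g - toeplitz (f * g) := fun g => rfl
  rw [← hX]
  refine induction_fourier (V := compacts.comap (X : C(Circ, ℂ) →ₗ[ℂ] (Ell2 →L[ℂ] Ell2)))
    (isClosed_compacts.preimage X.continuous) (fun j => ?_) g
  change IsCompactOperator (X (fourier j))
  refine isCompactOperator_of_apply_e_eq_zero (-j).toNat fun n hn => ?_
  obtain ⟨m, hm⟩ := Int.eq_ofNat_of_zero_le (a := n + j) (by omega)
  refine ext_inner_basis e fun k => ?_
  rw [hX, sub_apply, mul_apply_eq_comp, toeplitz_fourier_apply_e j n m hm.symm, inner_sub_right,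
    inner_toeplitz, inner_toeplitz, fourierCoeff_mul_fourier, inner_zero_right, ← Int.ofNat_eq_natCast, ← hm,
    sub_eq_zero]
  congr 1
  ring

theorem IsSymbol.mul {x y : Ell2 →L[ℂ] Ell2} {f g : C(Circ, ℂ)} (hx : IsSymbol x f)
    (hy : IsSymbol y g) : IsSymbol (x * y) (f * g) := by
  have h1 : (x - toeplitz f) * y ∈ compacts := IsCompactOperator.comp_clm hx y
  have h2 : toeplitz f * (y - toeplitz g) ∈ compacts := IsCompactOperator.clm_comp hy (toeplitz f)
  have h3 := compacts.add_mem (compacts.add_mem h1 h2) (toeplitz_mul_sub_mem f g)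
  have : (x - toeplitz f) * y + toeplitz f * (y - toeplitz g) +
      (toeplitz f * toeplitz g - toeplitz (f * g)) = x * y - toeplitz (f * g) := by noncomm_ring
  rwa [this] at h3

/-! ### The norm of the symbol -/

/-- The vector `∑ aᵏ e_k`, an eigenvector of the backward shift, and so of all `T_f` with
`f = u⁻ʲ`. -/
def coherent (a : ℂ) (ha : ‖a‖ < 1) : Ell2 :=
  ⟨fun k => a ^ k, by
    refine memℓp_gen ?_
    convert! summable_geometric_of_lt_one (sq_nonneg ‖a‖)
      (pow_lt_one₀ (norm_nonneg a) ha two_ne_zero) using 2 with k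
    simp [← pow_mul, mul_comm]⟩

theorem coherent_apply (a : ℂ) (ha : ‖a‖ < 1) (k : ℕ) : coherent a ha k = a ^ k := rfl

theorem norm_coherent_sq (a : ℂ) (ha : ‖a‖ < 1) : ‖coherent a ha‖ ^ 2 = (1 - ‖a‖ ^ 2)⁻¹ := by
  have h := lp.norm_rpow_eq_tsum (p := 2) (by simp) (coherent a ha)
  simp only [ENNReal.toReal_ofNat, Real.rpow_ofNat, coherent_apply, norm_pow] at h
  rw [h, ← tsum_geometric_of_lt_one (sq_nonneg ‖a‖) (pow_lt_one₀ (norm_nonneg a) ha two_ne_zero)]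
  simp only [← pow_mul, mul_comm]

theorem toeplitz_fourier_neg_coherent (a : ℂ) (ha : ‖a‖ < 1) (j : ℕ) :
    toeplitz (fourier (-(j : ℤ))) (coherent a ha) = a ^ j • coherent a ha := by
  ext k
  have h := hasSum_entry_apply (toeplitz (fourier (-(j : ℤ)))) k (coherent a ha)
  have h2 := hasSum_ite_eq (k + j) (a ^ (k + j))
  have h3 : (a ^ j • coherent a ha) k = a ^ (k + j) := by
    rw [pow_add, mul_comm]; rfl
  rw [h3]
  refine h.unique (h2.congr_fun fun m => ?_)
  rw [entry_toeplitz_fourier, coherent_apply]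
  by_cases hm : m = k + j
  · rw [if_pos (by omega), if_pos hm, hm, one_mul]
  · rw [if_neg (by omega), if_neg hm, zero_mul]

/-- The state of the normalized vector `∑ aᵏ e_k`. -/
def coherentState (a : ℂ) (ha : ‖a‖ < 1) : (Ell2 →L[ℂ] Ell2) →L[ℂ] ℂ :=
  ((1 - ‖a‖ ^ 2 : ℝ) : ℂ) • innerSL ℂ (coherent a ha) ∘L
    ContinuousLinearMap.apply ℂ Ell2 (coherent a ha)

theorem coherentState_apply (a : ℂ) (ha : ‖a‖ < 1) (x : Ell2 →L[ℂ] Ell2) :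
    coherentState a ha x =
      ((1 - ‖a‖ ^ 2 : ℝ) : ℂ) * ⟪coherent a ha, x (coherent a ha)⟫_ℂ := rfl

theorem one_sub_norm_sq_pos {a : ℂ} (ha : ‖a‖ < 1) : 0 < 1 - ‖a‖ ^ 2 := by
  have := pow_lt_one₀ (norm_nonneg a) ha two_ne_zero
  linarith

theorem norm_coherentState_le (a : ℂ) (ha : ‖a‖ < 1) : ‖coherentState a ha‖ ≤ 1 := by
  have h0 := one_sub_norm_sq_pos ha
  refine ContinuousLinearMap.opNorm_le_bound _ zero_le_one fun x => ?_
  rw [coherentState_apply, norm_mul, Complex.norm_real, Real.norm_of_nonneg h0.le]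
  calc (1 - ‖a‖ ^ 2) * ‖⟪coherent a ha, x (coherent a ha)⟫_ℂ‖
      ≤ (1 - ‖a‖ ^ 2) * (‖coherent a ha‖ * (‖x‖ * ‖coherent a ha‖)) := by
        gcongr
        exact (norm_inner_le_norm _ _).trans (by gcongr; exact x.le_opNorm _)
    _ = (1 - ‖a‖ ^ 2) * ‖coherent a ha‖ ^ 2 * ‖x‖ := by ring
    _ = 1 * ‖x‖ := by rw [norm_coherent_sq, mul_inv_cancel₀ h0.ne']

theorem coherentState_toeplitz_neg (a : ℂ) (ha : ‖a‖ < 1) (j : ℕ) :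
    coherentState a ha (toeplitz (fourier (-(j : ℤ)))) = a ^ j := by
  have h0 := one_sub_norm_sq_pos ha
  rw [coherentState_apply, toeplitz_fourier_neg_coherent, inner_smul_right,
    inner_self_eq_norm_sq_to_K, mul_left_comm]
  have h1 : ((1 - ‖a‖ ^ 2 : ℝ) : ℂ) * ((‖coherent a ha‖ ^ 2 : ℝ) : ℂ) = 1 := by
    rw [← Complex.ofReal_mul, norm_coherent_sq, mul_inv_cancel₀ h0.ne', Complex.ofReal_one]
  push_cast at h1 ⊢
  exact (congrArg (fun z => a ^ j * z) h1).trans (mul_one _)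

theorem coherentState_toeplitz_pos (a : ℂ) (ha : ‖a‖ < 1) (j : ℕ) :
    coherentState a ha (toeplitz (fourier (j : ℤ))) = (star a) ^ j := by
  have h1 : toeplitz (fourier (j : ℤ)) = star (toeplitz (fourier (-(j : ℤ)))) := by
    rw [toeplitz_star]
    congr 1
    ext x
    rw [ContinuousMap.star_apply, fourier_neg]
    simp
  have h2 := coherentState_toeplitz_neg a ha j
  rw [coherentState_apply] at h2
  rw [coherentState_apply, h1, ContinuousLinearMap.star_eq_adjoint,
    ContinuousLinearMap.adjoint_inner_right, ← inner_conj_symm]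
  have h3 := congrArg (starRingEnd ℂ) h2
  rw [map_mul, Complex.conj_ofReal] at h3
  rw [h3]
  simp

theorem norm_coherentState_matUnit_le (a : ℂ) (ha : ‖a‖ < 1) (i j : ℕ) :
    ‖coherentState a ha (matUnit i j)‖ ≤ 1 - ‖a‖ ^ 2 := by
  rw [coherentState_apply, matUnit, InnerProductSpace.rankOne_apply, inner_smul_right,
    ← inner_conj_symm (coherent a ha), inner_e_eq, inner_e_eq, coherent_apply, coherent_apply,
    norm_mul, norm_mul, Complex.norm_real, Real.norm_of_nonneg (one_sub_norm_sq_pos ha).le]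
  refine mul_le_of_le_one_right (one_sub_norm_sq_pos ha).le ?_
  rw [RCLike.norm_conj, norm_pow, norm_pow]
  exact mul_le_one₀ (pow_le_one₀ (norm_nonneg _) ha.le) (by positivity)
    (pow_le_one₀ (norm_nonneg _) ha.le)

/-- The radii `r_N = 1 - 1 / (N + 1)`. -/
def radius (N : ℕ) : ℝ := 1 - 1 / ((N : ℝ) + 1)

theorem tendsto_radius : Tendsto (fun N : ℕ => (radius N : ℂ)) atTop (𝓝 1) := by
  have h1 : Tendsto radius atTop (𝓝 1) := by
    have h2 := (tendsto_one_div_add_atTop_nhds_zero_nat (𝕜 := ℝ)).const_sub 1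
    rwa [sub_zero] at h2
  simpa using! (Complex.continuous_ofReal.tendsto 1).comp h1

theorem radius_nonneg (N : ℕ) : 0 ≤ radius N := by
  have h1 : 1 / ((N : ℝ) + 1) ≤ 1 := by
    rw [div_le_one (by positivity)]; linarith [Nat.cast_nonneg (α := ℝ) N]
  unfold radius
  linarith

theorem norm_radius_mul (z : ℂ) (hz : ‖z‖ = 1) (N : ℕ) : ‖(radius N : ℂ) * z‖ = radius N := by
  rw [norm_mul, hz, mul_one, Complex.norm_real, Real.norm_of_nonneg (radius_nonneg N)]

theorem norm_radius_lt (z : ℂ) (hz : ‖z‖ = 1) (N : ℕ) : ‖(radius N : ℂ) * z‖ < 1 := by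
  have h2 : 0 < 1 / ((N : ℝ) + 1) := by positivity
  rw [norm_radius_mul z hz, radius]
  linarith

theorem norm_fourier_apply (j : ℤ) (t : Circ) : ‖fourier j t‖ = 1 := by
  rw [fourier_apply]
  exact Circle.norm_coe _

theorem fourier_natCast_apply (j : ℕ) (t : Circ) : fourier (j : ℤ) t = fourier 1 t ^ j := by
  induction j with
  | zero => simp
  | succ j ih => rw [Nat.cast_succ, fourier_add, ih, pow_succ]

/-- The states of coherent vectors tending to a boundary point converge to an evaluation of the
symbol. -/
theorem tendsto_coherentState {x : Ell2 →L[ℂ] Ell2} {f : C(Circ, ℂ)} (hx : IsSymbol x f)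
    (t : Circ) : Tendsto (fun N : ℕ => coherentState _
      (norm_radius_lt (fourier (-1) t) (norm_fourier_apply _ _) N) x) atTop (𝓝 (f t)) := by
  set φ : ℕ → (Ell2 →L[ℂ] Ell2) →L[ℂ] ℂ := fun N => coherentState _
      (norm_radius_lt (fourier (-1) t) (norm_fourier_apply _ _) N) with hφ
  have hφ1 : ∀ N, ‖φ N‖ ≤ 1 := fun N => norm_coherentState_le _ _
  have hK : ∀ K ∈ compacts, Tendsto (fun N => φ N K) atTop (𝓝 0) := by
    intro K hK
    refine mem_of_isCompactOperator (V := convergenceSubmodule atTop φ 0) e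
      (isClosed_convergenceSubmodule 0 hφ1) (fun i j => ?_) hK
    change Tendsto (fun N => φ N (InnerProductSpace.rankOne ℂ (e i) (e j))) atTop (𝓝 0)
    have h1 : Tendsto (fun N : ℕ => 1 - radius N ^ 2) atTop (𝓝 0) := by
      have := Complex.continuous_re.tendsto _ |>.comp
        ((tendsto_radius.pow 2).const_sub 1)
      simpa [Function.comp_def, ← Complex.ofReal_pow] using this
    refine squeeze_zero_norm (fun N => ?_) h1
    refine (norm_coherentState_matUnit_le _ _ i j).trans_eq ?_
    rw [norm_radius_mul _ (norm_fourier_apply _ _)]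
  have hT : ∀ f, Tendsto (fun N => φ N (toeplitz f)) atTop (𝓝 (f t)) := by
    intro f
    refine induction_fourier (V := convergenceSubmodule atTop (fun N => φ N ∘L toeplitzL)
      (ContinuousMap.evalCLM ℂ t)) (isClosed_convergenceSubmodule _ (C := 1) fun N => ?_)
      (fun j => ?_) f
    · exact (ContinuousLinearMap.opNorm_comp_le _ _).trans
        (mul_le_one₀ (hφ1 N) (norm_nonneg _) norm_toeplitzL_le)
    · change Tendsto (fun N => φ N (toeplitz (fourier j))) atTop (𝓝 (fourier j t))
      obtain ⟨j, rfl | rfl⟩ := j.eq_nat_or_neg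
      · simp only [hφ, coherentState_toeplitz_pos]
        have h := ((tendsto_radius.mul_const (fourier 1 t)).pow j)
        rw [one_mul, ← fourier_natCast_apply] at h
        refine h.congr fun N => ?_
        congr 1
        rw [fourier_neg, RCLike.star_def, map_mul, Complex.conj_conj, Complex.conj_ofReal]
      · simp only [hφ, coherentState_toeplitz_neg]
        have h := ((tendsto_radius.mul_const (fourier (-1) t)).pow j)
        rwa [one_mul, fourier_neg, ← map_pow, ← fourier_natCast_apply, ← fourier_neg,
          ← fourier_neg] at h
  have := (hT f).add (hK _ hx)
  simpa only [← map_add, add_sub_cancel, add_zero] using this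

/-- The symbol map is norm decreasing. -/
theorem IsSymbol.norm_le {x : Ell2 →L[ℂ] Ell2} {f : C(Circ, ℂ)} (hx : IsSymbol x f) :
    ‖f‖ ≤ ‖x‖ := by
  rw [ContinuousMap.norm_le _ (norm_nonneg x)]
  intro t
  refine le_of_tendsto (tendsto_coherentState hx t).norm (.of_forall fun N => ?_)
  exact ContinuousLinearMap.le_of_opNorm_le _ (norm_coherentState_le _ _) x |>.trans
    (one_mul _).le

theorem isSymbol_toeplitz (f : C(Circ, ℂ)) : IsSymbol (toeplitz f) f := by
  simpa [IsSymbol] using! (isCompactOperator_zero : IsCompactOperator (0 : Ell2 → Ell2))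

theorem IsSymbol.sub {x y : Ell2 →L[ℂ] Ell2} {f g : C(Circ, ℂ)} (hx : IsSymbol x f)
    (hy : IsSymbol y g) : IsSymbol (x - y) (f - g) := by
  have h : (x - toeplitz f) - (y - toeplitz g) ∈ compacts := IsCompactOperator.sub hx hy
  rwa [show (x - toeplitz f) - (y - toeplitz g) = x - y - toeplitz (f - g) by
    rw [toeplitz_sub]; abel] at h

/-! ### The shift and the Toeplitz algebra -/

theorem shift_apply_e (n : ℕ) : shift (e n) = e (n + 1) := by
  rw [e_eq_single n]
  simp [shift, OrthogonalFamily.linearIsometry_apply_single]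

theorem shift_eq_toeplitz : shift = toeplitz (fourier 1) := ext_basis e fun n => by
  rw [shift_apply_e, toeplitz_fourier_apply_e 1 n (n + 1) (by push_cast; ring)]

theorem entry_mul_shift (x : Ell2 →L[ℂ] Ell2) (k n : ℕ) :
    entry (x * shift) k n = entry x k (n + 1) := by
  rw [entry, mul_apply_eq_comp, shift_apply_e, entry]

theorem inner_star_shift (k : ℕ) (v : Ell2) : ⟪e k, star shift v⟫_ℂ = ⟪e (k + 1), v⟫_ℂ := by
  rw [ContinuousLinearMap.star_eq_adjoint, ContinuousLinearMap.adjoint_inner_right, shift_apply_e]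

theorem star_shift_apply (k : ℕ) (v : Ell2) : star shift v k = v (k + 1) := by
  rw [← inner_e_eq, ← inner_e_eq, inner_star_shift]

theorem star_shift_apply_e_succ (n : ℕ) : star shift (e (n + 1)) = e n :=
  ext_inner_basis e fun k => by rw [inner_star_shift, inner_e_e, inner_e_e]; simp

theorem star_shift_apply_e_zero : star shift (e 0) = 0 :=
  ext_inner_basis e fun k => by rw [inner_star_shift, inner_e_e, inner_zero_right]; simp

theorem star_shift_mul_shift : star shift * shift = 1 := ext_basis e fun n => by
  rw [mul_apply_eq_comp, shift_apply_e, star_shift_apply_e_succ]; rfl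

theorem shift_apply_succ (k : ℕ) (v : Ell2) : shift v (k + 1) = v k := by
  have := DFunLike.congr_fun star_shift_mul_shift v
  rw [← star_shift_apply]
  exact congrArg (fun w : Ell2 => w k) this

theorem shift_apply_zero (v : Ell2) : shift v 0 = 0 := by
  rw [← inner_e_eq, ← ContinuousLinearMap.adjoint_inner_left, ← ContinuousLinearMap.star_eq_adjoint,
    star_shift_apply_e_zero, inner_zero_left]

theorem entry_shift_mul_succ (x : Ell2 →L[ℂ] Ell2) (k n : ℕ) :
    entry (shift * x) (k + 1) n = entry x k n := by
  rw [entry, entry, inner_e_eq, inner_e_eq]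
  exact shift_apply_succ k _

theorem entry_shift_mul_zero (x : Ell2 →L[ℂ] Ell2) (n : ℕ) : entry (shift * x) 0 n = 0 := by
  rw [entry, inner_e_eq]
  exact shift_apply_zero _

theorem one_sub_shift_mul_star_shift : 1 - shift * star shift = matUnit 0 0 := by
  refine ext_basis e fun n => ?_
  rw [sub_apply, mul_apply_eq_comp, matUnit, InnerProductSpace.rankOne_apply, inner_e_e]
  cases n with
  | zero => simp [star_shift_apply_e_zero]
  | succ n => simp [star_shift_apply_e_succ, shift_apply_e]

theorem toeplitz_mem (f : C(Circ, ℂ)) : toeplitz f ∈ toeplitzAlgebra :=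
  StarSubalgebra.le_topologicalClosure _ (StarAlgebra.subset_adjoin ℂ _ ⟨f, rfl⟩)

theorem isClosed_toeplitzAlgebra : IsClosed (toeplitzAlgebra : Set (Ell2 →L[ℂ] Ell2)) :=
  StarSubalgebra.isClosed_topologicalClosure _

theorem shift_pow_apply_e_zero (k : ℕ) : (shift ^ k) (e 0) = e k := by
  induction k with
  | zero => rfl
  | succ k ih => rw [pow_succ', mul_apply_eq_comp, ih, shift_apply_e]

/-- Every matrix unit is a polynomial in `S` and `S*`, by `1 - S S* = e₀ ⟨e₀, ·⟩`. -/
theorem matUnit_eq (k n : ℕ) : matUnit k n = shift ^ k * matUnit 0 0 * star (shift ^ n) := by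
  ext1 v
  rw [mul_apply_eq_comp, mul_apply_eq_comp, matUnit, matUnit, InnerProductSpace.rankOne_apply,
    InnerProductSpace.rankOne_apply, map_smul, shift_pow_apply_e_zero,
    ContinuousLinearMap.star_eq_adjoint, ContinuousLinearMap.adjoint_inner_right,
    shift_pow_apply_e_zero]

theorem matUnit_mem (k n : ℕ) : matUnit k n ∈ toeplitzAlgebra := by
  have hS : shift ∈ toeplitzAlgebra := shift_eq_toeplitz ▸ toeplitz_mem _
  rw [matUnit_eq, ← one_sub_shift_mul_star_shift]
  exact mul_mem (mul_mem (pow_mem hS k) (sub_mem (one_mem _) (mul_mem hS (star_mem hS))))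
    (star_mem (pow_mem hS n))

theorem mem_toeplitzAlgebra_of_isCompactOperator {x : Ell2 →L[ℂ] Ell2} (hx : IsCompactOperator x) :
    x ∈ toeplitzAlgebra :=
  mem_of_isCompactOperator (V := Subalgebra.toSubmodule toeplitzAlgebra.toSubalgebra) e
    isClosed_toeplitzAlgebra matUnit_mem hx

end QuantumSurface

namespace QuantumSurface

open Filter Unbounded

/-! ### Smooth symbols -/

/-- The derivative `-i d/dt` of a smooth function on the circle. -/
theorem exists_deriv_of_smooth {f : C(Circ, ℂ)} (hf : f ∈ smoothFunctions) :
    ∃ f' ∈ smoothFunctions, ∀ j : ℤ, (j : ℂ) * fourierCoeff f j = fourierCoeff f' j := by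
  set g : ℝ → ℂ := fun t => f (t : Circ) with hg
  have hg1 : ContDiff ℝ ∞ g := hf
  have hper : Function.Periodic g (2 * Real.pi) := fun t => by simp [hg]
  have hd : ∀ t, HasDerivAt g (deriv g t) t := fun t =>
    ((hg1.differentiable (by simp)) t).hasDerivAt
  have hdg : ContDiff ℝ ∞ (deriv g) := (contDiff_infty_iff_deriv.1 hg1).2
  set h : ℝ → ℂ := fun t => -Complex.I * deriv g t with hh
  have hh1 : ContDiff ℝ ∞ h := contDiff_const.mul hdg
  have hhper : Function.Periodic h (2 * Real.pi) := fun t => by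
    simp only [hh]
    congr 1
    rw [← deriv_comp_add_const]
    congr 1
    ext s
    exact hper s
  have hc : Continuous hhper.lift := by
    rw [(QuotientAddGroup.isQuotientMap_mk _).continuous_iff]
    exact hh1.continuous
  refine ⟨⟨hhper.lift, hc⟩, hh1, fun j => ?_⟩
  rw [fourierCoeff_eq_intervalIntegral _ _ 0, fourierCoeff_eq_intervalIntegral _ _ 0]
  have h1 : ∀ t : ℝ, HasDerivAt (fun t : ℝ => fourier (-j) (t : Circ) * g t)
      (-Complex.I * j * (fourier (-j) (t : Circ) * g t) +
        Complex.I * (fourier (-j) (t : Circ) * h t)) t := fun t => by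
    convert! (hasDerivAt_fourier_neg (2 * Real.pi) j t).mul (hd t) using 1
    have : (Real.pi : ℂ) ≠ 0 := by exact_mod_cast Real.pi_ne_zero
    have h2 : -2 * Real.pi * Complex.I * j / ((2 * Real.pi : ℝ) : ℂ) = -Complex.I * j := by
      push_cast
      field_simp
    rw [h2]
    simp only [hh]
    linear_combination (-(fourier (-j) (t : Circ) * deriv g t)) * Complex.I_sq
  have hcf : Continuous fun t : ℝ => fourier (-j) (t : Circ) :=
    (fourier (-j)).continuous.comp (AddCircle.continuous_mk' _)
  have hI1 : ∀ a b, IntervalIntegrable (fun t : ℝ => fourier (-j) (t : Circ) * g t)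
      MeasureTheory.volume a b := fun a b => (hcf.mul hg1.continuous).intervalIntegrable a b
  have hI2 : ∀ a b, IntervalIntegrable (fun t : ℝ => fourier (-j) (t : Circ) * h t)
      MeasureTheory.volume a b := fun a b => (hcf.mul hh1.continuous).intervalIntegrable a b
  have h2 := intervalIntegral.integral_eq_sub_of_hasDerivAt (a := 0) (b := 0 + 2 * Real.pi)
    (fun t _ => h1 t) (((hI1 _ _).const_mul _).add ((hI2 _ _).const_mul _))
  rw [intervalIntegral.integral_add ((hI1 _ _).const_mul _) ((hI2 _ _).const_mul _),
    intervalIntegral.integral_const_mul, intervalIntegral.integral_const_mul] at h2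
  have h3 : fourier (-j) ((0 + 2 * Real.pi : ℝ) : Circ) * g (0 + 2 * Real.pi) -
      fourier (-j) ((0 : ℝ) : Circ) * g 0 = 0 := by
    rw [hper 0, zero_add, AddCircle.coe_period, AddCircle.coe_zero, sub_self]
  rw [h3] at h2
  have h4 : (j : ℂ) * ∫ t in (0 : ℝ)..(0 + 2 * Real.pi), fourier (-j) (t : Circ) * g t =
      ∫ t in (0 : ℝ)..(0 + 2 * Real.pi), fourier (-j) (t : Circ) * h t := by
    apply mul_left_cancel₀ Complex.I_ne_zero
    linear_combination -h2
  change (j : ℂ) * ((1 / (2 * Real.pi)) •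
    ∫ t in (0 : ℝ)..(0 + 2 * Real.pi), fourier (-j) (t : Circ) * g t) =
    (1 / (2 * Real.pi)) • ∫ t in (0 : ℝ)..(0 + 2 * Real.pi), fourier (-j) (t : Circ) * h t
  rw [← h4, mul_smul_comm]

/-- `[N, T_f] = T_{f'}` with `f' = -i df/dt`. -/
theorem smooth_toeplitz {f : C(Circ, ℂ)} (hf : f ∈ smoothFunctions) : Smooth (toeplitz f) := by
  refine smooth_of_forall (p := fun x => ∃ f ∈ smoothFunctions, x = toeplitz f) ?_ ⟨f, hf, rfl⟩
  rintro _ ⟨f, hf, rfl⟩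
  obtain ⟨f', hf', h⟩ := exists_deriv_of_smooth hf
  refine ⟨toeplitz f', fun k n => ?_, f', hf', rfl⟩
  rw [entry_toeplitz, entry_toeplitz, ← h]
  push_cast
  rfl

/-- The commutator of a Toeplitz operator with the shift vanishes outside the row `k = 0`, where its
entries are Fourier coefficients of the symbol. -/
theorem rapid_toeplitz_commutator {f : C(Circ, ℂ)} (hf : f ∈ smoothFunctions) :
    Rapid (toeplitz f * shift - shift * toeplitz f) := fun α β => by
  obtain ⟨C, hC⟩ := (smooth_toeplitz hf β).exists_entry_le
  have hC0 : 0 ≤ C := (hC () 0 0).trans' (by positivity)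
  refine ⟨C, fun _ k n => ?_⟩
  change _ * ‖entry (toeplitz f * shift - shift * toeplitz f) k n‖ ≤ C
  cases k with
  | zero =>
    rw [entry_sub, entry_mul_shift, entry_shift_mul_zero, sub_zero]
    refine (hC () 0 (n + 1)).trans' ?_
    simp only [Nat.cast_zero, zero_add, one_pow, one_mul, zero_sub, abs_neg, Nat.cast_add,
      Nat.cast_one]
    gcongr
    rw [abs_of_nonneg (by positivity)]
    linarith
  | succ k =>
    rw [entry_sub, entry_mul_shift, entry_shift_mul_succ, entry_toeplitz, entry_toeplitz]
    have : ((k + 1 : ℕ) : ℤ) - (n + 1 : ℕ) = k - n := by push_cast; ring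
    rw [this, sub_self, norm_zero, mul_zero]
    exact hC0

/-- A sequence of rapid decay indexed by the integers. -/
def RapidSeq (c : ℤ → ℂ) : Prop := ∀ α : ℕ, ∃ C : ℝ, ∀ j : ℤ, (|(j : ℝ)| + 1) ^ α * ‖c j‖ ≤ C

theorem RapidSeq.mul_int {c : ℤ → ℂ} (h : RapidSeq c) : RapidSeq fun j => Complex.I * j * c j :=
  fun α => by
    obtain ⟨C, hC⟩ := h (α + 1)
    refine ⟨C, fun j => (hC j).trans' ?_⟩
    rw [norm_mul, norm_mul, Complex.norm_I, one_mul, pow_succ, mul_assoc]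
    gcongr
    rw [Complex.norm_intCast]
    linarith

theorem RapidSeq.summable {c : ℤ → ℂ} (h : RapidSeq c) : Summable fun j => ‖c j‖ := by
  obtain ⟨C, hC⟩ := h 2
  have hs : Summable fun j : ℤ => C * ((|(j : ℝ)| + 1) ^ 2)⁻¹ := by
    refine Summable.mul_left C ?_
    refine Summable.of_nat_of_neg ?_ ?_
    · simpa using summable_one_div_succ_sq
    · simpa using summable_one_div_succ_sq
  refine Summable.of_nonneg_of_le (fun _ => norm_nonneg _) (fun j => ?_) hs
  rw [← div_eq_mul_inv, le_div_iff₀ (by positivity), mul_comm]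
  exact hC j

theorem hasDerivAt_fourier_two_pi (j : ℤ) (t : ℝ) :
    HasDerivAt (fun t : ℝ => fourier j (t : Circ)) (Complex.I * j * fourier j (t : Circ)) t := by
  convert! hasDerivAt_fourier (2 * Real.pi) j t using 1
  have : (Real.pi : ℂ) ≠ 0 := by exact_mod_cast Real.pi_ne_zero
  push_cast
  field_simp

theorem RapidSeq.hasDerivAt {c : ℤ → ℂ} (h : RapidSeq c) (t : ℝ) :
    HasDerivAt (fun t : ℝ => ∑' j, c j * fourier j (t : Circ))
      (∑' j, (Complex.I * j * c j) * fourier j (t : Circ)) t := by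
  refine hasDerivAt_tsum (𝕜 := ℝ) (g := fun (j : ℤ) (t : ℝ) => c j * fourier j (t : Circ))
    (g' := fun (j : ℤ) (t : ℝ) => (Complex.I * j * c j) * fourier j (t : Circ)) (y₀ := 0)
    h.mul_int.summable (fun j s => ?_) (fun j s => ?_) ?_ t
  · convert! (hasDerivAt_fourier_two_pi j s).const_mul (c j) using 1
    ring
  · rw [norm_mul, norm_fourier_apply, mul_one]
  · refine Summable.of_norm ?_
    simpa only [norm_mul, norm_fourier_apply, mul_one] using h.summable

theorem RapidSeq.contDiff {c : ℤ → ℂ} (h : RapidSeq c) :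
    ContDiff ℝ ∞ (fun t : ℝ => ∑' j, c j * fourier j (t : Circ)) := by
  rw [contDiff_infty]
  intro n
  induction n generalizing c with
  | zero =>
    rw [Nat.cast_zero, contDiff_zero]
    exact continuous_iff_continuousAt.2 fun t => (h.hasDerivAt t).continuousAt
  | succ n ih =>
    rw [Nat.cast_succ, contDiff_succ_iff_deriv]
    refine ⟨fun t => (h.hasDerivAt t).differentiableAt, by simp, ?_⟩
    rw [show deriv (fun t : ℝ => ∑' j, c j * fourier j (t : Circ)) =
      fun t : ℝ => ∑' j, (Complex.I * j * c j) * fourier j (t : Circ) from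
      funext fun t => (h.hasDerivAt t).deriv]
    exact ih h.mul_int

/-- A sequence of rapid decay is the sequence of Fourier coefficients of a smooth function. -/
theorem exists_smooth_of_rapidSeq {c : ℤ → ℂ} (h : RapidSeq c) :
    ∃ f ∈ smoothFunctions, ∀ j, fourierCoeff f j = c j := by
  have hs : Summable fun j : ℤ => c j • (fourier j : C(Circ, ℂ)) := by
    refine Summable.of_norm ?_
    simpa only [norm_smul, fourier_norm, mul_one] using h.summable
  refine ⟨∑' j, c j • fourier j, ?_, fun j => ?_⟩
  · change ContDiff ℝ ∞ fun t : ℝ => (∑' j, c j • fourier j : C(Circ, ℂ)) (t : Circ)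
    convert! h.contDiff using 2 with t
    exact ((hs.hasSum.mapL (ContinuousMap.evalCLM ℂ (t : Circ))).tsum_eq).symm
  · have h1 := hs.hasSum.mapL (entryL j.toNat (-j).toNat ∘L toeplitzL)
    rw [ContinuousLinearMap.comp_apply, entryL_apply, toeplitzL_apply, entry_toeplitz,
      show (j.toNat : ℤ) - (-j).toNat = j by omega] at h1
    refine h1.unique ((hasSum_ite_eq j (c j)).congr_fun fun i => ?_)
    rw [map_smul, ContinuousLinearMap.comp_apply, entryL_apply, toeplitzL_apply,
      entry_toeplitz_fourier, show (j.toNat : ℤ) - (-j).toNat = j by omega]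
    by_cases hij : i = j
    · simp [hij]
    · rw [if_neg hij, if_neg (Ne.symm hij), smul_zero]

/-- A smooth operator that commutes with the shift up to a rapidly decaying operator is a Toeplitz
operator with smooth symbol up to a rapidly decaying operator. The Fourier coefficients of the
symbol are the limits along the diagonals of the matrix. -/
theorem exists_smooth_symbol {x : Ell2 →L[ℂ] Ell2} (hx : Smooth x)
    (hS : Rapid (x * shift - shift * x)) :
    ∃ f ∈ smoothFunctions, Rapid (x - toeplitz f) := by
  have hc : ∀ k n, entry (x * shift - shift * x) (k + 1) n =
      entry x (k + 1) (n + 1) - entry x k n := fun k n => by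
    rw [entry_sub, entry_mul_shift, entry_shift_mul_succ]
  set c := entry (x * shift - shift * x) with hcdef
  have hbound : ∀ α β : ℕ, ∃ C : ℝ, 0 ≤ C ∧ ∀ k n m : ℕ, ‖c (k + m + 1) (n + m)‖ ≤
      C * (((k : ℝ) + 1) ^ α)⁻¹ * (((n : ℝ) + 1) ^ β)⁻¹ * (((m : ℝ) + 1) ^ 2)⁻¹ := by
    intro α β
    obtain ⟨C, hC0, hC⟩ := RapidMat.exists_le hS (α + 2) β
    refine ⟨C, hC0, fun k n m => (hC () _ _).trans ?_⟩
    have hk := Nat.cast_nonneg (α := ℝ) k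
    have hm := Nat.cast_nonneg (α := ℝ) m
    calc C * (((k + m + 1 : ℕ) + 1 : ℝ) ^ (α + 2))⁻¹ * (((n + m : ℕ) + 1 : ℝ) ^ β)⁻¹
        ≤ C * (((k : ℝ) + 1) ^ α * ((m : ℝ) + 1) ^ 2)⁻¹ * (((n : ℝ) + 1) ^ β)⁻¹ := by
          push_cast
          gcongr
          · rw [pow_add]
            gcongr <;> linarith
          · linarith
      _ = _ := by rw [mul_inv]; ring
  -- the sums of the increments along the diagonals
  set d : ℕ → ℕ → ℂ := fun k n => ∑' m : ℕ, c (k + m + 1) (n + m) with hd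
  have hsum : ∀ k n, Summable fun m : ℕ => c (k + m + 1) (n + m) := fun k n => by
    obtain ⟨C, hC0, hC⟩ := hbound 0 0
    exact Summable.of_norm_bounded (summable_one_div_succ_sq.mul_left _) (hC k n)
  have hdR : RapidMat fun (_ : Unit) k n => d k n := fun α β => by
    obtain ⟨C, hC0, hC⟩ := hbound α β
    refine ⟨C * ∑' m : ℕ, (((m : ℝ) + 1) ^ 2)⁻¹, fun _ k n => ?_⟩
    have h1 := tsum_of_norm_bounded (summable_one_div_succ_sq.mul_left _).hasSum (hC k n)
    rw [tsum_mul_left] at h1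
    calc ((k : ℝ) + 1) ^ α * ((n : ℝ) + 1) ^ β * ‖d k n‖ ≤ ((k : ℝ) + 1) ^ α * ((n : ℝ) + 1) ^ β *
        (C * (((k : ℝ) + 1) ^ α)⁻¹ * (((n : ℝ) + 1) ^ β)⁻¹ * ∑' m : ℕ, (((m : ℝ) + 1) ^ 2)⁻¹) := by
          gcongr
      _ = _ := by field_simp
  have hdiag : ∀ k n, entry x (k + 1) (n + 1) + d (k + 1) (n + 1) = entry x k n + d k n := by
    intro k n
    have h1 := (hsum k n).tsum_eq_zero_add
    have h2 : ∀ m : ℕ, c (k + (m + 1) + 1) (n + (m + 1)) = c (k + 1 + m + 1) (n + 1 + m) :=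
      fun m => by congr 1 <;> ring
    simp only [h2] at h1
    change d k n = c (k + 0 + 1) (n + 0) + d (k + 1) (n + 1) at h1
    rw [h1, add_zero, add_zero, hc]
    ring
  -- `entry x k n + d k n` is constant along the diagonals; `φ j` is its value on the diagonal
  -- `k - n = j`, read off in the first row or column
  set φ : ℤ → ℂ := fun j => entry x j.toNat (-j).toNat + d j.toNat (-j).toNat with hφ
  have hφ1 : ∀ m k n : ℕ, entry x (k + m) (n + m) + d (k + m) (n + m) = entry x k n + d k n := by
    intro m k n
    induction m with
    | zero => rfl
    | succ m ih => rw [← ih]; exact hdiag _ _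
  have hφ2 : ∀ k n : ℕ, entry x k n + d k n = φ ((k : ℤ) - n) := fun k n => by
    have := hφ1 (min k n) ((k : ℤ) - n).toNat (-((k : ℤ) - n)).toNat
    rw [show ((k : ℤ) - n).toNat + min k n = k by omega,
      show (-((k : ℤ) - n)).toNat + min k n = n by omega] at this
    exact this
  have hφR : RapidSeq φ := fun α => by
    obtain ⟨C, hC⟩ := (hx α).exists_entry_le
    obtain ⟨C', hC'⟩ := hdR α α
    refine ⟨C + C', fun j => ?_⟩
    have h1 := hC () j.toNat (-j).toNat
    have h2 := hC' () j.toNat (-j).toNat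
    have h3 : (j.toNat : ℝ) - (-j).toNat = j := by
      have : (j.toNat : ℤ) - (-j).toNat = j := by omega
      exact_mod_cast this
    rw [h3] at h1
    have h4 : |(j : ℝ)| + 1 ≤ ((j.toNat : ℝ) + 1) * (((-j).toNat : ℝ) + 1) := by
      rw [← h3]
      have h5 := Nat.cast_nonneg (α := ℝ) j.toNat
      have h6 := Nat.cast_nonneg (α := ℝ) (-j).toNat
      have : |(j.toNat : ℝ) - (-j).toNat| ≤ j.toNat + (-j).toNat :=
        abs_le.2 ⟨by linarith, by linarith⟩
      nlinarith [mul_nonneg (Nat.cast_nonneg (α := ℝ) j.toNat)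
        (Nat.cast_nonneg (α := ℝ) (-j).toNat)]
    calc (|(j : ℝ)| + 1) ^ α * ‖φ j‖
        ≤ (|(j : ℝ)| + 1) ^ α * (‖entry x j.toNat (-j).toNat‖ + ‖d j.toNat (-j).toNat‖) := by
          gcongr; exact norm_add_le _ _
      _ = (|(j : ℝ)| + 1) ^ α * ‖entry x j.toNat (-j).toNat‖ +
          (|(j : ℝ)| + 1) ^ α * ‖d j.toNat (-j).toNat‖ := mul_add _ _ _
      _ ≤ C + (((j.toNat : ℝ) + 1) * (((-j).toNat : ℝ) + 1)) ^ α * ‖d j.toNat (-j).toNat‖ := by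
          gcongr
      _ ≤ C + C' := by
          rw [mul_pow]
          gcongr
  obtain ⟨f, hf, hfφ⟩ := exists_smooth_of_rapidSeq hφR
  refine ⟨f, hf, hdR.mono fun _ k n => ?_⟩
  change ‖entry (x - toeplitz f) k n‖ ≤ ‖d k n‖
  rw [entry_sub, entry_toeplitz, hfφ, ← hφ2, sub_add_cancel_left, norm_neg]

end QuantumSurface

namespace QuantumSurface

open Filter Unbounded

/-! ### The smooth algebra -/

theorem Rapid.zero : Rapid 0 := fun _ _ => ⟨0, fun _ k n => by simp⟩

theorem rapid_matUnit (i j : ℕ) : Rapid (matUnit i j) := fun α β => by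
  refine ⟨((i : ℝ) + 1) ^ α * ((j : ℝ) + 1) ^ β, fun _ k n => ?_⟩
  change _ * ‖entry (matUnit i j) k n‖ ≤ _
  rw [entry_matUnit]
  split_ifs with h
  · rw [h.1, h.2, norm_one, mul_one]
  · rw [norm_zero, mul_zero]
    positivity

theorem smooth_shift : Smooth shift := by
  refine smooth_of_forall (p := fun x => x = shift) ?_ rfl
  rintro _ rfl
  refine ⟨shift, fun k n => ?_, rfl⟩
  rw [shift_eq_toeplitz, entry_toeplitz_fourier]
  split_ifs with h
  · rw [mul_one]
    exact_mod_cast h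
  · rw [mul_zero]

theorem Rapid.add {x y : Ell2 →L[ℂ] Ell2} (hx : Rapid x) (hy : Rapid y) : Rapid (x + y) :=
  RapidFam.add hx hy

theorem Rapid.sub {x y : Ell2 →L[ℂ] Ell2} (hx : Rapid x) (hy : Rapid y) : Rapid (x - y) :=
  RapidFam.sub hx hy

theorem Rapid.mul_smooth {x y : Ell2 →L[ℂ] Ell2} (hx : Rapid x) (hy : Smooth y) : Rapid (x * y) :=
  RapidFam.mul_smooth hx hy

theorem Smooth.mul_rapid {x y : Ell2 →L[ℂ] Ell2} (hx : Smooth x) (hy : Rapid y) : Rapid (x * y) :=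
  RapidFam.smooth_mul hx hy

theorem smooth_of_rapid_sub {x : Ell2 →L[ℂ] Ell2} {f : C(Circ, ℂ)} (hf : f ∈ smoothFunctions)
    (h : Rapid (x - toeplitz f)) : Smooth x := by
  simpa using h.smooth.add (smooth_toeplitz hf)

theorem rapid_commutator_of_rapid_sub {x : Ell2 →L[ℂ] Ell2} {f : C(Circ, ℂ)}
    (hf : f ∈ smoothFunctions) (h : Rapid (x - toeplitz f)) : Rapid (x * shift - shift * x) := by
  have h1 := ((h.mul_smooth smooth_shift).sub (smooth_shift.mul_rapid h)).add
    (rapid_toeplitz_commutator hf)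
  convert! h1 using 1
  noncomm_ring

theorem wedge_add {g : ℕ} {f f' : C(Circ, ℂ)} (hf : f ∈ wedgeFunctions g)
    (hf' : f' ∈ wedgeFunctions g) : f + f' ∈ wedgeFunctions g := fun k hk t ht => by
  rw [ContinuousMap.add_apply, ContinuousMap.add_apply, hf k hk t ht, hf' k hk t ht]

theorem wedge_mul {g : ℕ} {f f' : C(Circ, ℂ)} (hf : f ∈ wedgeFunctions g)
    (hf' : f' ∈ wedgeFunctions g) : f * f' ∈ wedgeFunctions g := fun k hk t ht => by
  rw [ContinuousMap.mul_apply, ContinuousMap.mul_apply, hf k hk t ht, hf' k hk t ht]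

theorem wedge_star {g : ℕ} {f : C(Circ, ℂ)} (hf : f ∈ wedgeFunctions g) :
    star f ∈ wedgeFunctions g := fun k hk t ht => by
  rw [ContinuousMap.star_apply, ContinuousMap.star_apply, hf k hk t ht]

theorem wedge_const (g : ℕ) (c : ℂ) : c • (1 : C(Circ, ℂ)) ∈ wedgeFunctions g :=
  fun _ _ _ _ => rfl

theorem smoothFunctions_const (c : ℂ) : c • (1 : C(Circ, ℂ)) ∈ smoothFunctions := by
  change ContDiff ℝ ∞ fun t : ℝ => c • (1 : ℂ)
  exact contDiff_const

theorem smoothFunctions_add {f f' : C(Circ, ℂ)} (hf : f ∈ smoothFunctions)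
    (hf' : f' ∈ smoothFunctions) : f + f' ∈ smoothFunctions :=
  (show ContDiff ℝ ∞ fun t : ℝ => f (t : Circ) from hf).add hf'

theorem smoothFunctions_star {f : C(Circ, ℂ)} (hf : f ∈ smoothFunctions) :
    star f ∈ smoothFunctions :=
  Complex.conjCLE.contDiff.comp (show ContDiff ℝ ∞ fun t : ℝ => f (t : Circ) from hf)

theorem isClosed_wedgeFunctions (g : ℕ) : IsClosed (wedgeFunctions g) := by
  have : wedgeFunctions g = ⋂ k ∈ Finset.Icc 1 g, ⋂ t ∈ Set.Icc (0 : ℝ) 1,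
      {f : C(Circ, ℂ) | f ((Real.pi * ((k : ℝ) - 1 + t) / g : ℝ) : Circ) =
      f ((Real.pi * (-(k : ℝ) + t) / g : ℝ) : Circ)} := by
    ext f; simp only [Set.mem_iInter]; rfl
  rw [this]
  exact isClosed_biInter fun k _ => isClosed_biInter fun t _ =>
    isClosed_eq (continuous_eval_const _) (continuous_eval_const _)

theorem isSymbol_of_rapid {x : Ell2 →L[ℂ] Ell2} {f : C(Circ, ℂ)} (h : Rapid (x - toeplitz f)) :
    IsSymbol x f := h.isCompactOperator

theorem mem_smoothAlgebra_of_rapid {g : ℕ} {x : Ell2 →L[ℂ] Ell2} {f : C(Circ, ℂ)}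
    (hf : f ∈ wedgeFunctions g) (hf' : f ∈ smoothFunctions) (h : Rapid (x - toeplitz f)) :
    x ∈ smoothAlgebra g := by
  have h1 : x - toeplitz f ∈ smoothAlgebra g :=
    StarAlgebra.subset_adjoin ℂ _ (Or.inl ((mem_rapidDecay_iff _).2 h))
  have h2 : toeplitz f ∈ smoothAlgebra g :=
    StarAlgebra.subset_adjoin ℂ _
      (Or.inr ⟨⟨toeplitz_mem f, f, isSymbol_toeplitz f, hf⟩, f, ⟨hf, hf'⟩, rfl⟩)
  simpa using add_mem h1 h2

/-- The product of two operators `T_f + K` and `T_{f'} + K'` is again of this form. It is smooth and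
commutes with `S` up to rapid decay, so it has some smooth symbol, which by uniqueness of the symbol
is `f f'`. -/
theorem exists_symbol_mul {x y : Ell2 →L[ℂ] Ell2} {f f' : C(Circ, ℂ)}
    (hf : f ∈ smoothFunctions) (hf' : f' ∈ smoothFunctions) (hx : Rapid (x - toeplitz f))
    (hy : Rapid (y - toeplitz f')) :
    f * f' ∈ smoothFunctions ∧ Rapid (x * y - toeplitz (f * f')) := by
  have sx := smooth_of_rapid_sub hf hx
  have sy := smooth_of_rapid_sub hf' hy
  have h1 : Rapid (x * y * shift - shift * (x * y)) := by
    convert! (sx.mul_rapid (rapid_commutator_of_rapid_sub hf' hy)).add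
      ((rapid_commutator_of_rapid_sub hf hx).mul_smooth sy) using 1
    noncomm_ring
  obtain ⟨h, hh, hxy⟩ := exists_smooth_symbol (sx.mul sy) h1
  have := (isSymbol_of_rapid hxy).unique ((isSymbol_of_rapid hx).mul (isSymbol_of_rapid hy))
  rw [← this]
  exact ⟨hh, hxy⟩

/-- The elements of the smooth algebra are the operators `T_f + K` with `K` of rapid decay and `f`
a smooth function in `W_g`. -/
theorem mem_smoothAlgebra_iff {g : ℕ} {x : Ell2 →L[ℂ] Ell2} :
    x ∈ smoothAlgebra g ↔
      ∃ f, f ∈ wedgeFunctions g ∧ f ∈ smoothFunctions ∧ Rapid (x - toeplitz f) := by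
  refine ⟨fun hx => ?_, fun ⟨f, hf, hf', h⟩ => mem_smoothAlgebra_of_rapid hf hf' h⟩
  induction hx using StarAlgebra.adjoin_induction with
  | mem x hx =>
    rcases hx with hx | ⟨-, f, hf, rfl⟩
    · refine ⟨(0 : ℂ) • 1, wedge_const g 0, smoothFunctions_const 0, ?_⟩
      rw [toeplitz_smul, zero_smul, sub_zero]
      exact (mem_rapidDecay_iff _).1 hx
    · exact ⟨f, hf.1, hf.2, by simpa using Rapid.zero⟩
  | algebraMap r =>
    refine ⟨r • 1, wedge_const g r, smoothFunctions_const r, ?_⟩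
    rw [toeplitz_smul, toeplitz_one, Algebra.algebraMap_eq_smul_one, sub_self]
    exact Rapid.zero
  | add x y _ _ hx hy =>
    obtain ⟨f, hf, hfs, hx⟩ := hx
    obtain ⟨f', hf', hfs', hy⟩ := hy
    refine ⟨f + f', wedge_add hf hf', smoothFunctions_add hfs hfs', ?_⟩
    rw [toeplitz_add, add_sub_add_comm]
    exact hx.add hy
  | mul x y _ _ hx hy =>
    obtain ⟨f, hf, hfs, hx⟩ := hx
    obtain ⟨f', hf', hfs', hy⟩ := hy
    exact ⟨f * f', wedge_mul hf hf', exists_symbol_mul hfs hfs' hx hy⟩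
  | star x _ hx =>
    obtain ⟨f, hf, hfs, hx⟩ := hx
    refine ⟨star f, wedge_star hf, smoothFunctions_star hfs, ?_⟩
    rw [← toeplitz_star, ← star_sub]
    exact RapidFam.star hx

/-! ### Smooth functions in `W_g` are dense -/

/-- On the `k`-th arc of the upper half circle, a function in `W_g` agrees with its translate on the
`k`-th arc of the lower half circle. -/
theorem wedge_arc {g : ℕ} (hg : 1 ≤ g) {f : C(Circ, ℂ)} (hf : f ∈ wedgeFunctions g) {k : ℕ}
    (hk : k ∈ Finset.Icc 1 g) {θ : ℝ} (h1 : Real.pi * (k - 1) / g ≤ θ)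
    (h2 : θ ≤ Real.pi * k / g) :
    f (θ : Circ) = f ((θ - Real.pi * (2 * k - 1) / g : ℝ) : Circ) := by
  have hg0 : (0 : ℝ) < g := by exact_mod_cast hg
  have hpi := Real.pi_pos
  rw [div_le_iff₀ hg0] at h1
  rw [le_div_iff₀ hg0] at h2
  have := hf k hk (g * θ / Real.pi - (k - 1)) ⟨?_, ?_⟩
  · convert! this using 3
    · field_simp; ring
    · field_simp; ring
  · rw [sub_nonneg, le_div_iff₀ hpi]; linarith
  · rw [sub_le_iff_le_add, div_le_iff₀ hpi]; linarith

/-- The `2 g` vertices are identified with one another: the initial point of `a_k` with that of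
`b_k`, and likewise for the end points, which gives a path through all vertices. -/
theorem wedge_vertex {g : ℕ} {f : C(Circ, ℂ)} (hf : f ∈ wedgeFunctions g)
    {j : ℕ} (hj : j ≤ g) : f ((Real.pi * j / g : ℝ) : Circ) = f 0 ∧
      f ((Real.pi * (-j) / g : ℝ) : Circ) = f 0 := by
  induction j with
  | zero => simp
  | succ j ih =>
    obtain ⟨h1, h2⟩ := ih (by omega)
    have hk : j + 1 ∈ Finset.Icc 1 g := Finset.mem_Icc.2 ⟨by omega, hj⟩
    have h3 := hf (j + 1) hk 0 (by simp)
    have h4 := hf (j + 1) hk 1 (by simp)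
    push_cast at h3 h4 ⊢
    simp only [add_sub_cancel_right, add_zero, neg_add_rev] at h3 h4
    constructor
    · rw [h4, ← h2]; congr 3; ring
    · rw [← h1, h3]; congr 3; ring

/-- A continuous map `ℂ → ℂ` that is close to the identity and vanishes near `0`. -/
def cutoff (ε : ℝ) (z : ℂ) : ℂ := ((min 1 (max 0 (‖z‖ / ε - 1)) : ℝ) : ℂ) * z

theorem continuous_cutoff (ε : ℝ) : Continuous (cutoff ε) := by
  unfold cutoff
  fun_prop

theorem cutoff_eq_zero {ε : ℝ} (hε : 0 < ε) {z : ℂ} (hz : ‖z‖ ≤ ε) : cutoff ε z = 0 := by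
  have : ‖z‖ / ε - 1 ≤ 0 := by rw [sub_nonpos, div_le_one hε]; exact hz
  rw [cutoff, max_eq_left this]
  simp

theorem norm_cutoff_sub_le {ε : ℝ} (hε : 0 < ε) (z : ℂ) : ‖cutoff ε z - z‖ ≤ 2 * ε := by
  rcases le_total (2 * ε) ‖z‖ with h | h
  · have : 1 ≤ max 0 (‖z‖ / ε - 1) := le_max_of_le_right (by
      rw [le_sub_iff_add_le, le_div_iff₀ hε]; linarith)
    rw [cutoff, min_eq_left this]
    simpa using hε.le
  · have h1 : cutoff ε z - z = ((min 1 (max 0 (‖z‖ / ε - 1)) - 1 : ℝ) : ℂ) * z := by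
      rw [cutoff]; push_cast; ring
    rw [h1, norm_mul, Complex.norm_real, Real.norm_eq_abs]
    refine (mul_le_of_le_one_left (norm_nonneg z) ?_).trans h
    rw [abs_le]
    constructor
    · linarith [le_min zero_le_one (le_max_left 0 (‖z‖ / ε - 1))]
    · linarith [min_le_left 1 (max 0 (‖z‖ / ε - 1))]

theorem exists_uniform_modulus (f : C(Circ, ℂ)) {ε : ℝ} (hε : 0 < ε) :
    ∃ δ > 0, ∀ s t : ℝ, |s - t| < δ → dist (f (s : Circ)) (f (t : Circ)) < ε := by
  have h1 : UniformContinuous fun t : ℝ => f (t : Circ) :=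
    (CompactSpace.uniformContinuous_of_continuous f.continuous).comp
      (uniformContinuous_addMonoidHom_of_continuous
        (f := QuotientAddGroup.mk' (AddSubgroup.zmultiples (2 * Real.pi)))
        (AddCircle.continuous_mk' _))
  obtain ⟨δ, hδ, h⟩ := Metric.uniformContinuous_iff.1 h1 ε hε
  exact ⟨δ, hδ, fun s t hst => h (by rwa [Real.dist_eq])⟩

open scoped Convolution in
/-- A function in `W_g` is made to vanish near the vertices, after subtraction of its common value
there, and is then mollified; near each point, the mollified function depends either on the values
on a single arc or on values that vanish. -/
theorem exists_smooth_wedge {g : ℕ} (hg : 1 ≤ g) {f : C(Circ, ℂ)} (hf : f ∈ wedgeFunctions g)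
    {ε : ℝ} (hε : 0 < ε) :
    ∃ F, F ∈ wedgeFunctions g ∧ F ∈ smoothFunctions ∧ ‖f - F‖ ≤ 3 * ε := by
  set c := f 0 with hc
  let G : C(Circ, ℂ) := ⟨fun t => cutoff ε (f t - c),
    (continuous_cutoff ε).comp (f.continuous.sub continuous_const)⟩
  have hG : ∀ t, G t = cutoff ε (f t - c) := fun t => rfl
  obtain ⟨δ₁, hδ₁, h₁⟩ := exists_uniform_modulus f hε
  obtain ⟨δ₂, hδ₂, h₂⟩ := exists_uniform_modulus G hε
  set δ := min δ₁ δ₂ with hδdef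
  have hδ : 0 < δ := lt_min hδ₁ hδ₂
  let φ : ContDiffBump (0 : ℝ) := ⟨δ / 2, δ, by positivity, by linarith⟩
  set L : ℝ → ℂ := fun t => G (t : Circ) with hL
  have hLc : Continuous L := G.continuous.comp (AddCircle.continuous_mk' _)
  set F₀ : ℝ → ℂ := φ.normed MeasureTheory.volume ⋆[ContinuousLinearMap.lsmul ℝ ℝ] L with hF₀
  have hF₀a : ∀ θ, F₀ θ = ∫ t, φ.normed MeasureTheory.volume t • L (θ - t) := fun θ => rfl
  have hF₀s : ContDiff ℝ ∞ F₀ :=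
    φ.hasCompactSupport_normed.contDiff_convolution_left _ φ.contDiff_normed
      hLc.locallyIntegrable
  have hper : Function.Periodic (fun t => F₀ t + c) (2 * Real.pi) := fun θ => by
    simp only [hF₀a]
    congr 3
    ext t
    congr 1
    rw [hL]
    simp only
    rw [add_sub_right_comm, AddCircle.coe_add_period]
  have hFs : ContDiff ℝ ∞ fun t => F₀ t + c := hF₀s.add contDiff_const
  have hFc : Continuous hper.lift := by
    rw [(QuotientAddGroup.isQuotientMap_mk _).continuous_iff]
    exact hFs.continuous
  have hball : ∀ t, φ.normed MeasureTheory.volume t ≠ 0 → |t| < δ := fun t ht => by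
    have : t ∈ Function.support (φ.normed MeasureTheory.volume) := ht
    rw [φ.support_normed_eq] at this
    simpa [φ] using this
  have hvan : ∀ (s v : ℝ), f (v : Circ) = c → |s - v| < δ → L s = 0 := fun s v hv hs => by
    have := (h₁ s v (hs.trans_le (min_le_left _ _))).le
    rw [hv, dist_eq_norm] at this
    exact cutoff_eq_zero hε this
  refine ⟨⟨hper.lift, hFc⟩, fun k hk t ht => ?_, hFs, ?_⟩
  · obtain ⟨hk1, hk2⟩ := Finset.mem_Icc.1 hk
    have hg0 : (0 : ℝ) < g := by exact_mod_cast hg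
    have hpi := Real.pi_pos
    have hcast : ((k - 1 : ℕ) : ℝ) = (k : ℝ) - 1 := by push_cast [hk1]; ring
    obtain ⟨v1, v2⟩ := wedge_vertex hf hk2
    obtain ⟨v3, v4⟩ := wedge_vertex hf (show k - 1 ≤ g by omega)
    rw [hcast] at v3 v4
    set θ := Real.pi * ((k : ℝ) - 1 + t) / g with hθ
    have hθ' : Real.pi * (-(k : ℝ) + t) / g = θ - Real.pi * (2 * k - 1) / g := by
      rw [hθ]; ring
    have hl : Real.pi * (k - 1) / g ≤ θ := by rw [hθ]; gcongr; linarith [ht.1]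
    have hr : θ ≤ Real.pi * k / g := by rw [hθ]; gcongr; linarith [ht.2]
    rw [hθ']
    change F₀ θ + c = F₀ (θ - Real.pi * (2 * k - 1) / g) + c
    rw [hF₀a, hF₀a]
    congr 2
    ext s
    by_cases hs : φ.normed MeasureTheory.volume s = 0
    · rw [hs, zero_smul, zero_smul]
    congr 1
    have hs := abs_lt.1 (hball s hs)
    -- `θ` is on the arc; `θ - s` lies before the first vertex, beyond the second, or on the arc
    rcases lt_or_ge (θ - s) (Real.pi * (k - 1) / g) with h3 | h3
    · rw [hvan (θ - s) _ v3 (abs_lt.2 ⟨by linarith, by linarith⟩),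
        hvan (θ - Real.pi * (2 * k - 1) / g - s) _ v2]
      rw [show θ - Real.pi * (2 * k - 1) / g - s - Real.pi * -k / g =
        θ - s - Real.pi * (k - 1) / g by ring]
      exact abs_lt.2 ⟨by linarith, by linarith⟩
    rcases lt_or_ge (Real.pi * k / g) (θ - s) with h4 | h4
    · rw [hvan (θ - s) _ v1 (abs_lt.2 ⟨by linarith, by linarith⟩),
        hvan (θ - Real.pi * (2 * k - 1) / g - s) _ v4]
      rw [show θ - Real.pi * (2 * k - 1) / g - s - Real.pi * -(k - 1) / g =
        θ - s - Real.pi * k / g by ring]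
      exact abs_lt.2 ⟨by linarith, by linarith⟩
    · simp only [hL, hG]
      rw [wedge_arc hg hf hk h3 h4, sub_right_comm]
  · rw [ContinuousMap.norm_le _ (by positivity)]
    intro x
    obtain ⟨θ, rfl⟩ := QuotientAddGroup.mk_surjective x
    have h3 : dist (F₀ θ) (L θ) ≤ ε := by
      refine φ.dist_normed_convolution_le hLc.aestronglyMeasurable fun y hy => (h₂ y θ ?_).le
      rw [Metric.mem_ball, Real.dist_eq] at hy
      exact hy.trans_le (min_le_right _ _)
    have h4 := norm_cutoff_sub_le hε (f (θ : Circ) - c)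
    rw [dist_eq_norm] at h3
    change ‖f (θ : Circ) - (F₀ θ + c)‖ ≤ 3 * ε
    calc ‖f (θ : Circ) - (F₀ θ + c)‖
        = ‖-((F₀ θ - L θ) + (cutoff ε (f (θ : Circ) - c) - (f (θ : Circ) - c)))‖ := by
          congr 1
          simp only [hL, hG]
          ring
      _ ≤ ε + 2 * ε := by
          rw [norm_neg]
          exact (norm_add_le _ _).trans (add_le_add h3 h4)
      _ = 3 * ε := by ring

/-! ### The norm closure of the smooth algebra -/

/-- If `x` is a norm limit of elements of the smooth algebra, their symbols converge, because the
symbol map is norm decreasing. Conversely, the smooth algebra contains the matrix units, hence its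
closure contains the compact operators, and smooth functions are dense in `W_g`. -/
theorem smoothAlgebra_topologicalClosure {g : ℕ} (hg : 1 ≤ g) :
    ((smoothAlgebra g).topologicalClosure : Set (Ell2 →L[ℂ] Ell2)) = surface g := by
  rw [StarSubalgebra.topologicalClosure_coe]
  refine Set.Subset.antisymm (fun x hx => ?_) ?_
  · obtain ⟨u, hu, hux⟩ := mem_closure_iff_seq_limit.1 hx
    choose f hf hfs hR using fun n => mem_smoothAlgebra_iff.1 (hu n)
    have hsym : ∀ n, IsSymbol (u n) (f n) := fun n => isSymbol_of_rapid (hR n)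
    have hcau : CauchySeq f := by
      rw [Metric.cauchySeq_iff]
      intro ε hε
      obtain ⟨N, hN⟩ := Metric.cauchySeq_iff.1 hux.cauchySeq ε hε
      refine ⟨N, fun m hm n hn => lt_of_le_of_lt ?_ (hN m hm n hn)⟩
      rw [dist_eq_norm, dist_eq_norm]
      exact ((hsym m).sub (hsym n)).norm_le
    obtain ⟨F, hF⟩ := cauchySeq_tendsto_of_complete hcau
    refine ⟨?_, F, ?_, (isClosed_wedgeFunctions g).mem_of_tendsto hF (.of_forall hf)⟩
    · refine isClosed_toeplitzAlgebra.mem_of_tendsto hux (.of_forall fun n => ?_)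
      simpa using add_mem (mem_toeplitzAlgebra_of_isCompactOperator (hsym n)) (toeplitz_mem (f n))
    · have h1 : Tendsto (fun n => u n - toeplitzL (f n)) atTop (𝓝 (x - toeplitzL F)) :=
        hux.sub ((toeplitzL.continuous.tendsto F).comp hF)
      exact isClosed_compacts.mem_of_tendsto h1 (.of_forall hsym)
  · rintro x ⟨-, f, hx, hf⟩
    have h1 : x - toeplitz f ∈ (smoothAlgebra g).topologicalClosure :=
      mem_of_isCompactOperator
        (V := Subalgebra.toSubmodule (smoothAlgebra g).topologicalClosure.toSubalgebra) e
        (StarSubalgebra.isClosed_topologicalClosure _)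
        (fun i j => StarSubalgebra.le_topologicalClosure _ (StarAlgebra.subset_adjoin ℂ _
          (Or.inl ((mem_rapidDecay_iff _).2 (rapid_matUnit i j))))) hx
    have h2 : toeplitz f ∈ (smoothAlgebra g).topologicalClosure := by
      change toeplitz f ∈ closure (smoothAlgebra g : Set (Ell2 →L[ℂ] Ell2))
      rw [Metric.mem_closure_iff]
      intro ε hε
      obtain ⟨F, hF, hFs, hd⟩ := exists_smooth_wedge hg hf (show 0 < ε / 4 by positivity)
      refine ⟨toeplitz F, mem_smoothAlgebra_iff.2 ⟨F, hF, hFs, by simpa using Rapid.zero⟩, ?_⟩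
      rw [dist_eq_norm, ← toeplitz_sub]
      refine (norm_toeplitz_le _).trans_lt (hd.trans_lt ?_)
      linarith
    have := add_mem h1 h2
    rwa [sub_add_cancel] at this

end QuantumSurface

namespace QuantumSurface

open Filter Unbounded

/-! ### Stability under holomorphic functional calculus -/

/-- The integral over the unit interval of a family of operators. The parameter is taken in the
compact space `[0, 1]`, on which continuous families are bounded. -/
def pathIntegral (Y : Set.Icc (0 : ℝ) 1 → Ell2 →L[ℂ] Ell2) : Ell2 →L[ℂ] Ell2 :=
  ∫ t in (0 : ℝ)..1, Y (Set.projIcc 0 1 zero_le_one t)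

theorem intervalIntegrable_path {Y : Set.Icc (0 : ℝ) 1 → Ell2 →L[ℂ] Ell2} (hY : Continuous Y) :
    IntervalIntegrable (fun t => Y (Set.projIcc 0 1 zero_le_one t)) MeasureTheory.volume 0 1 :=
  (hY.comp continuous_projIcc).intervalIntegrable _ _

theorem entry_pathIntegral {Y : Set.Icc (0 : ℝ) 1 → Ell2 →L[ℂ] Ell2} (hY : Continuous Y)
    (k n : ℕ) : entry (pathIntegral Y) k n =
      ∫ t in (0 : ℝ)..1, entry (Y (Set.projIcc 0 1 zero_le_one t)) k n :=
  ((entryL k n).intervalIntegral_comp_comm (intervalIntegrable_path hY)).symm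

theorem smooth_pathIntegral {Y : Set.Icc (0 : ℝ) 1 → Ell2 →L[ℂ] Ell2}
    (hY : ∀ n, IsSmoothFam n Y) : Smooth (pathIntegral Y) := fun n => by
  replace hY := hY n
  induction n generalizing Y with
  | zero => exact continuous_const
  | succ n ih =>
    obtain ⟨h1, Y', h2, h3⟩ := hY
    refine ⟨continuous_const, fun _ => pathIntegral Y', fun _ k m => ?_, ih h3⟩
    rw [entry_pathIntegral h1, entry_pathIntegral h3.continuous,
      ← intervalIntegral.integral_const_mul]
    simp only [h2 _ k m]

theorem rapid_pathIntegral {Y : Set.Icc (0 : ℝ) 1 → Ell2 →L[ℂ] Ell2} (hY : Continuous Y)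
    (hR : RapidFam Y) : Rapid (pathIntegral Y) := fun α β => by
  obtain ⟨C, hC0, hC⟩ := hR.exists_le α β
  refine ⟨C, fun _ k n => ?_⟩
  change _ * ‖entry (pathIntegral Y) k n‖ ≤ C
  have := intervalIntegral.norm_integral_le_of_norm_le_const (a := 0) (b := 1)
    (f := fun t => entry (Y (Set.projIcc 0 1 zero_le_one t)) k n) fun t _ => hC _ k n
  rw [← entry_pathIntegral hY, sub_zero, abs_one, mul_one] at this
  calc _ ≤ ((k : ℝ) + 1) ^ α * ((n : ℝ) + 1) ^ β *
        (C * (((k : ℝ) + 1) ^ α)⁻¹ * (((n : ℝ) + 1) ^ β)⁻¹) := by gcongr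
    _ = C := by field_simp

theorem pathIntegral_mem {V : Submodule ℂ (Ell2 →L[ℂ] Ell2)}
    (hV : IsClosed (V : Set (Ell2 →L[ℂ] Ell2))) {Y : Set.Icc (0 : ℝ) 1 → Ell2 →L[ℂ] Ell2}
    (hY : Continuous Y) (h : ∀ i, Y i ∈ V) : pathIntegral Y ∈ V := by
  have hp : MeasureTheory.IsProbabilityMeasure
      (MeasureTheory.volume.restrict (Set.Ioc (0 : ℝ) 1)) := ⟨by simp⟩
  rw [pathIntegral, intervalIntegral.integral_of_le zero_le_one]
  exact (V.restrictScalars ℝ).convex.integral_mem hV (.of_forall fun t => h _)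
    (intervalIntegrable_path hY).1

/-- The weighted integral of the resolvents of an element of the smooth algebra along a path. The
resolvents form a smooth family, and `[S, (z - a)⁻¹] = (z - a)⁻¹ [S, a] (z - a)⁻¹` is of rapid
decay uniformly along the path; the symbol of the integral is in `W_g` because the closure of the
smooth algebra is a C*-algebra. -/
theorem pathIntegral_resolvent_mem {g : ℕ} (hg : 1 ≤ g) {a : Ell2 →L[ℂ] Ell2}
    (ha : a ∈ smoothAlgebra g) {φ z : Set.Icc (0 : ℝ) 1 → ℂ} (hφ : Continuous φ)
    (hz : Continuous z) (hza : ∀ i, z i ∉ spectrum ℂ a) :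
    pathIntegral (fun i => φ i • resolvent a (z i)) ∈ smoothAlgebra g := by
  obtain ⟨f, hf, hfs, haf⟩ := mem_smoothAlgebra_iff.1 ha
  have hsa := smooth_of_rapid_sub hfs haf
  have hra := rapid_commutator_of_rapid_sub hfs haf
  set R : Set.Icc (0 : ℝ) 1 → Ell2 →L[ℂ] Ell2 := fun i => resolvent a (z i) with hR
  have hu : ∀ i, IsUnit (algebraMap ℂ (Ell2 →L[ℂ] Ell2) (z i) - a) := fun i =>
    spectrum.notMem_iff.1 (hza i)
  have hRc : Continuous R := by
    rw [continuous_iff_continuousAt]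
    intro i
    exact ((spectrum.hasDerivAt_resolvent_const_left (hu i)).continuousAt).comp hz.continuousAt
  have h1 : ∀ i, (z i • (1 : Ell2 →L[ℂ] Ell2) - a) * R i = 1 := fun i => by
    rw [← Algebra.algebraMap_eq_smul_one]
    exact Ring.mul_inverse_cancel _ (hu i)
  have h2 : ∀ i, R i * (z i • (1 : Ell2 →L[ℂ] Ell2) - a) = 1 := fun i => by
    rw [← Algebra.algebraMap_eq_smul_one]
    exact Ring.inverse_mul_cancel _ (hu i)
  have hRs : ∀ n, IsSmoothFam n R := fun n =>
    ((isSmoothFam_one.smul hz).sub (hsa.fam n)).inverse hRc h1 h2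
  have hW : ∀ n, IsSmoothFam n fun i => φ i • R i := fun n => (hRs n).smul hφ
  have hcomm : pathIntegral (fun i => φ i • R i) * shift - shift *
      pathIntegral (fun i => φ i • R i) =
      pathIntegral fun i => φ i • R i * (a * shift - shift * a) * R i := by
    have h3 := (((ContinuousLinearMap.mul ℂ (Ell2 →L[ℂ] Ell2)).flip shift -
      ContinuousLinearMap.mul ℂ (Ell2 →L[ℂ] Ell2) shift).intervalIntegral_comp_comm
        (intervalIntegrable_path (hW 0).continuous)).symm
    refine h3.trans ?_
    refine intervalIntegral.integral_congr fun t _ => ?_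
    set i := Set.projIcc (0 : ℝ) 1 zero_le_one t
    change φ i • R i * shift - shift * (φ i • R i) = φ i • R i * (a * shift - shift * a) * R i
    have h4 : R i * shift - shift * R i = R i * (a * shift - shift * a) * R i := by
      calc R i * shift - shift * R i = R i * shift * ((z i • 1 - a) * R i) -
            (R i * (z i • 1 - a)) * shift * R i := by rw [h1, h2, mul_one, one_mul]
        _ = R i * (a * shift - shift * a) * R i := by
          simp only [mul_sub, sub_mul, mul_assoc, smul_mul_assoc, mul_smul_comm, one_mul]
          abel
    rw [smul_mul_assoc, mul_smul_comm, ← smul_sub, h4, smul_mul_assoc, smul_mul_assoc]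
  have hrapid : Rapid (pathIntegral (fun i => φ i • R i) * shift - shift *
      pathIntegral (fun i => φ i • R i)) := by
    rw [hcomm]
    refine rapid_pathIntegral (((hW 0).continuous.mul continuous_const).mul hRc) ?_
    exact (RapidFam.smooth_mul hW (hra.comp fun _ => ())).mul_smooth hRs
  obtain ⟨F, hF, hJ⟩ := exists_smooth_symbol (smooth_pathIntegral hW) hrapid
  -- a closed *-subalgebra contains the inverses of its invertible elements
  have hmem : pathIntegral (fun i => φ i • R i) ∈ surface g := by
    rw [← smoothAlgebra_topologicalClosure hg]
    have hcl : IsClosed ((smoothAlgebra g).topologicalClosure : Set (Ell2 →L[ℂ] Ell2)) :=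
      StarSubalgebra.isClosed_topologicalClosure _
    refine pathIntegral_mem
      (V := Subalgebra.toSubmodule (smoothAlgebra g).topologicalClosure.toSubalgebra) hcl
      (hW 0).continuous fun i => ?_
    refine Submodule.smul_mem _ _ ?_
    have ha' : a ∈ (smoothAlgebra g).topologicalClosure :=
      StarSubalgebra.le_topologicalClosure _ ha
    have hzi : algebraMap ℂ (Ell2 →L[ℂ] Ell2) (z i) - a ∈ (smoothAlgebra g).topologicalClosure :=
      sub_mem (algebraMap_mem _ _) ha'
    obtain ⟨v, hv⟩ := (StarSubalgebra.coe_isUnit (hS := hcl) _ (a := ⟨_, hzi⟩)).1 (hu i)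
    have h5 : (z i • (1 : Ell2 →L[ℂ] Ell2) - a) *
        ((v⁻¹ : _) : (smoothAlgebra g).topologicalClosure) = 1 := by
      rw [← Algebra.algebraMap_eq_smul_one]
      have := congrArg (fun w : (smoothAlgebra g).topologicalClosure => (w : Ell2 →L[ℂ] Ell2))
        v.mul_inv
      rw [hv] at this
      exact this
    rw [left_inv_eq_right_inv (h2 i) h5]
    exact Subtype.mem _
  obtain ⟨-, F', hF', hFW⟩ := hmem
  rw [hF'.unique (isSymbol_of_rapid hJ)] at hFW
  exact mem_smoothAlgebra_iff.2 ⟨F, hFW, hF, hJ⟩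

/-- The functional calculus is a finite sum of Cauchy integrals of the resolvent along paths. -/
theorem isHolomorphicallyStable_smoothAlgebra {g : ℕ} (hg : 1 ≤ g) :
    SpectralTriple.IsHolomorphicallyStable (smoothAlgebra g) := by
  rintro a ha f b ⟨U, hU, -, hf, m, γ, hγ, -, hγU, -, -, rfl⟩
  refine SMulMemClass.smul_mem _ (sum_mem fun i _ => ?_)
  have hproj : ∀ t ∈ Set.Icc (0 : ℝ) 1, (Set.projIcc (0 : ℝ) 1 zero_le_one t : ℝ) = t :=
    fun t ht => by rw [Set.projIcc_of_mem _ ht]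
  have hγc : Continuous fun t : Set.Icc (0 : ℝ) 1 => γ i t :=
    (hγ i).continuous.comp continuous_subtype_val
  have := pathIntegral_resolvent_mem hg ha
    (φ := fun t => f (γ i t) * deriv (γ i) t) (z := fun t => γ i t) ?_ hγc
    (fun t => (hγU i t t.2).2)
  · convert! this using 1
    refine intervalIntegral.integral_congr fun t ht => ?_
    rw [Set.uIcc_of_le zero_le_one] at ht
    simp only [hproj t ht]
  · refine Continuous.mul ?_ ?_
    · exact hf.continuousOn.comp_continuous hγc fun t => (hγU i t t.2).1
    · exact ((hγ i).continuous_deriv le_rfl).comp continuous_subtype_val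

end QuantumSurface

/-! ### Unbounded operators that are diagonal in an orthonormal basis -/

namespace Unbounded

open Filter
open scoped LinearPMap

variable {ι H : Type*} [NormedAddCommGroup H] [InnerProductSpace ℂ H]

/-- The operator `T` is the maximal diagonal operator `b i ↦ lam i • b i` with real eigenvalues:
`v ∈ dom T` if and only if there is a vector `w` with coordinates `lam i * ⟪b i, v⟫`, and then
`T v = w`. -/
structure IsDiag (T : H →ₗ.[ℂ] H) (b : HilbertBasis ι ℂ H) (lam : ι → ℝ) : Prop where
  mem_domain : ∀ v w : H, (∀ i, ⟪b i, w⟫_ℂ = lam i * ⟪b i, v⟫_ℂ) → v ∈ T.domain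
  inner_apply : ∀ (v : T.domain) (i : ι), ⟪b i, T v⟫_ℂ = lam i * ⟪b i, (v : H)⟫_ℂ

variable {T : H →ₗ.[ℂ] H} {b : HilbertBasis ι ℂ H} {lam : ι → ℝ}

theorem inner_basis [DecidableEq ι] (b : HilbertBasis ι ℂ H) (i j : ι) :
    ⟪b i, b j⟫_ℂ = if i = j then 1 else 0 := orthonormal_iff_ite.1 b.orthonormal i j

theorem IsDiag.apply_eq (hT : IsDiag T b lam) (v w : H)
    (h : ∀ i, ⟪b i, w⟫_ℂ = lam i * ⟪b i, v⟫_ℂ) : T ⟨v, hT.mem_domain v w h⟩ = w :=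
  ext_inner_basis b fun i => by rw [hT.inner_apply, h]

theorem IsDiag.inner_smul_basis (i j : ι) :
    ⟪b j, (lam i : ℂ) • b i⟫_ℂ = lam j * ⟪b j, b i⟫_ℂ := by
  classical
  rw [inner_smul_right, inner_basis]
  split_ifs with h <;> simp [h]

theorem IsDiag.basis_mem (hT : IsDiag T b lam) (i : ι) : b i ∈ T.domain :=
  hT.mem_domain _ ((lam i : ℂ) • b i) (IsDiag.inner_smul_basis i)

theorem IsDiag.apply_basis (hT : IsDiag T b lam) (i : ι) :
    T ⟨b i, hT.basis_mem i⟩ = (lam i : ℂ) • b i :=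
  hT.apply_eq _ _ (IsDiag.inner_smul_basis i)

theorem IsDiag.dense_domain (hT : IsDiag T b lam) : Dense (T.domain : Set H) := by
  have h : Submodule.span ℂ (Set.range b) ≤ T.domain :=
    Submodule.span_le.2 (Set.range_subset_iff.2 hT.basis_mem)
  have hd : Dense ((Submodule.span ℂ (Set.range b) : Submodule ℂ H) : Set H) := by
    rw [Submodule.dense_iff_topologicalClosure_eq_top, b.dense_span]
  exact hd.mono h

theorem IsDiag.isFormalAdjoint (hT : IsDiag T b lam) : T.IsFormalAdjoint T := fun v w => by
  have h1 := b.hasSum_inner_mul_inner (T v) (w : H)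
  have h2 := b.hasSum_inner_mul_inner (v : H) (T w)
  refine h1.unique (h2.congr_fun fun i => ?_)
  rw [hT.inner_apply, ← inner_conj_symm, hT.inner_apply, map_mul, Complex.conj_ofReal,
    inner_conj_symm]
  ring

theorem IsDiag.isSelfAdjoint [CompleteSpace H] (hT : IsDiag T b lam) : IsSelfAdjoint T := by
  have hd := hT.dense_domain
  have hle : T ≤ T† := hT.isFormalAdjoint.le_adjoint hd
  rw [LinearPMap.isSelfAdjoint_def]
  refine (LinearPMap.eq_of_le_of_domain_eq hle (le_antisymm hle.1 fun y hy => ?_)).symm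
  refine hT.mem_domain y (T† ⟨y, hy⟩) fun i => ?_
  have h := LinearPMap.adjoint_isFormalAdjoint hd ⟨y, hy⟩ ⟨b i, hT.basis_mem i⟩
  rw [hT.apply_basis] at h
  change ⟪T† ⟨y, hy⟩, b i⟫_ℂ = ⟪y, (lam i : ℂ) • b i⟫_ℂ at h
  rw [← inner_conj_symm, h, inner_smul_right, map_mul, Complex.conj_ofReal, inner_conj_symm]

theorem IsDiag.nonneg (hT : IsDiag T b lam) (h : ∀ i, 0 ≤ lam i) (v : T.domain) :
    0 ≤ (⟪(v : H), T v⟫_ℂ).re := by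
  have h1 := (b.hasSum_inner_mul_inner (v : H) (T v)).mapL Complex.reCLM
  refine h1.nonneg fun i => ?_
  rw [hT.inner_apply, mul_left_comm, ← inner_conj_symm, Complex.conj_mul', ← Complex.ofReal_pow,
    ← Complex.ofReal_mul]
  exact mul_nonneg (h i) (sq_nonneg _)

theorem IsDiag.isResolvent (hT : IsDiag T b lam) {z : ℂ} (hz : ∀ i, (lam i : ℂ) ≠ z) {K : ℝ}
    (hK : 0 ≤ K) (h : ∀ i, ‖((lam i : ℂ) - z)⁻¹‖ ≤ K) :
    IsResolvent T z (diagonal b (fun i => ((lam i : ℂ) - z)⁻¹) hK h) := by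
  have hz' : ∀ i, (lam i : ℂ) - z ≠ 0 := fun i => sub_ne_zero.2 (hz i)
  set R := diagonal b (fun i => ((lam i : ℂ) - z)⁻¹) hK h with hR
  have key : ∀ (w : H) i, ⟪b i, z • R w + w⟫_ℂ = lam i * ⟪b i, R w⟫_ℂ := fun w i => by
    rw [inner_add_right, inner_smul_right, hR, inner_diagonal]
    have := hz' i
    field_simp
    ring
  refine ⟨fun w => ⟨hT.mem_domain _ _ (key w), ?_⟩, fun v => ext_inner_basis b fun i => ?_⟩
  · rw [hT.apply_eq _ _ (key w), add_sub_cancel_left]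
  · rw [hR, inner_diagonal, inner_sub_right, inner_smul_right, hT.inner_apply, ← sub_mul,
      inv_mul_cancel_left₀ (hz' i)]

theorem IsDiag.ne_of_isResolvent (hT : IsDiag T b lam) {z : ℂ} {R : H →L[ℂ] H}
    (hR : IsResolvent T z R) (i : ι) : (lam i : ℂ) ≠ z := by
  rintro rfl
  have h := hR.2 ⟨b i, hT.basis_mem i⟩
  rw [hT.apply_basis, sub_self, map_zero] at h
  exact b.orthonormal.ne_zero i h.symm

theorem IsDiag.resolvent_apply (hT : IsDiag T b lam) {z : ℂ} {R : H →L[ℂ] H}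
    (hR : IsResolvent T z R) (i : ι) : R (b i) = ((lam i : ℂ) - z)⁻¹ • b i := by
  have hne := sub_ne_zero.2 (hT.ne_of_isResolvent hR i)
  have h := hR.2 ⟨b i, hT.basis_mem i⟩
  rw [hT.apply_basis, ← sub_smul, map_smul] at h
  rw [eq_inv_smul_iff₀ hne]
  exact h

theorem tendsto_inv_sub {lam : ι → ℝ} (hlam : Tendsto (fun i => |lam i|) cofinite atTop) (z : ℂ) :
    Tendsto (fun i => ((lam i : ℂ) - z)⁻¹) cofinite (𝓝 0) := by
  refine tendsto_inv₀_cobounded.comp ?_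
  rw [← tendsto_norm_atTop_iff_cobounded]
  refine tendsto_atTop_mono (fun i => ?_) (tendsto_atTop_add_const_right _ (-‖z‖) hlam)
  have := norm_sub_norm_le (lam i : ℂ) z
  rwa [Complex.norm_real, Real.norm_eq_abs] at this

theorem IsDiag.exists_isResolvent (hT : IsDiag T b lam)
    (hlam : Tendsto (fun i => |lam i|) cofinite atTop) {z : ℂ} (hz : ∀ i, (lam i : ℂ) ≠ z) :
    ∃ R, IsResolvent T z R := by
  obtain ⟨K, hK⟩ := (tendsto_inv_sub hlam z).norm.bddAbove_range_of_cofinite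
  exact ⟨_, hT.isResolvent hz (abs_nonneg K) fun i => (hK ⟨i, rfl⟩).trans (le_abs_self K)⟩

theorem IsDiag.spec_eq (hT : IsDiag T b lam)
    (hlam : Tendsto (fun i => |lam i|) cofinite atTop) :
    spec T = Set.range fun i => (lam i : ℂ) := by
  ext z
  constructor
  · intro hz
    by_contra hcon
    exact hz (hT.exists_isResolvent hlam fun i hi => hcon ⟨i, hi⟩)
  · rintro ⟨i, rfl⟩ ⟨R, hR⟩
    exact hT.ne_of_isResolvent hR i rfl

theorem IsDiag.hasCompactResolvent [CompleteSpace H] (hT : IsDiag T b lam)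
    (hlam : Tendsto (fun i => |lam i|) cofinite atTop) : HasCompactResolvent T := by
  constructor
  · refine ⟨Complex.I, hT.exists_isResolvent hlam fun i hi => ?_⟩
    simpa using congrArg Complex.im hi
  · intro z R hR
    exact isCompactOperator_of_diagonal b (tendsto_inv_sub hlam z) (hT.resolvent_apply hR)

theorem mem_eigenspace_iff {z : ℂ} {v : H} :
    v ∈ eigenspace T z ↔ ∃ h : v ∈ T.domain, T ⟨v, h⟩ = z • v := by
  simp only [eigenspace, Submodule.mem_map, LinearMap.mem_ker, LinearMap.sub_apply,
    LinearMap.smul_apply, sub_eq_zero]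
  constructor
  · rintro ⟨w, hw, rfl⟩
    exact ⟨w.2, hw⟩
  · rintro ⟨h, hv⟩
    exact ⟨⟨v, h⟩, hv, rfl⟩

theorem IsDiag.eigenspace_eq (hT : IsDiag T b lam) (hinj : Function.Injective lam) (i : ι) :
    eigenspace T (lam i) = ℂ ∙ b i := by
  classical
  ext v
  rw [mem_eigenspace_iff, Submodule.mem_span_singleton]
  constructor
  · rintro ⟨h, hv⟩
    refine ⟨⟪b i, v⟫_ℂ, ext_inner_basis b fun j => ?_⟩
    have h1 := hT.inner_apply ⟨v, h⟩ j
    rw [hv, inner_smul_right] at h1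
    rw [inner_smul_right, inner_basis]
    split_ifs with hij
    · rw [hij, mul_one]
    · rw [mul_zero]
      by_contra hcon
      have := mul_right_cancel₀ (Ne.symm hcon) h1
      exact hij (hinj (by exact_mod_cast this.symm))
  · rintro ⟨c, rfl⟩
    refine ⟨T.domain.smul_mem c (hT.basis_mem i), ?_⟩
    have : (⟨c • b i, T.domain.smul_mem c (hT.basis_mem i)⟩ : T.domain) =
      c • ⟨b i, hT.basis_mem i⟩ := rfl
    rw [this, T.map_smul, hT.apply_basis, smul_comm]

theorem IsDiag.finrank_eigenspace (hT : IsDiag T b lam) (hinj : Function.Injective lam) (i : ι) :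
    Module.finrank ℂ (eigenspace T (lam i)) = 1 := by
  rw [hT.eigenspace_eq hinj]
  exact finrank_span_singleton (b.orthonormal.ne_zero i)

end Unbounded

/-! ### The Dirac operator and its polar decomposition -/

namespace QuantumSurface

open Filter Unbounded

/-- The operator on `ℓ₂(ℕ₀) ⊕ ℓ₂(ℕ₀)` with the `2 × 2` matrix of entries `a`, `b`, `c`, `d`. -/
def blockOp (a b c d : Ell2 →L[ℂ] Ell2) : Hilb →L[ℂ] Hilb :=
  ((WithLp.prodContinuousLinearEquiv 2 ℂ Ell2 Ell2).symm : Ell2 × Ell2 →L[ℂ] Hilb) ∘L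
    (a.coprod b).prod (c.coprod d) ∘L
    (WithLp.prodContinuousLinearEquiv 2 ℂ Ell2 Ell2 : Hilb →L[ℂ] Ell2 × Ell2)

section Block

variable (a b c d a' b' c' d' : Ell2 →L[ℂ] Ell2) (v : Hilb)

@[simp] theorem blockOp_fst : (blockOp a b c d v).fst = a v.fst + b v.snd := rfl

@[simp] theorem blockOp_snd : (blockOp a b c d v).snd = c v.fst + d v.snd := rfl

theorem hilb_ext {v w : Hilb} (h1 : v.fst = w.fst) (h2 : v.snd = w.snd) : v = w :=
  WithLp.ofLp_injective 2 (Prod.ext h1 h2)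

theorem diagOp_eq : diagOp a d = blockOp a 0 0 d := by
  ext1 v
  refine hilb_ext ?_ ?_
  · change a v.fst = a v.fst + 0
    rw [add_zero]
  · change d v.snd = 0 + d v.snd
    rw [zero_add]

theorem blockOp_mul : blockOp a b c d * blockOp a' b' c' d' =
    blockOp (a * a' + b * c') (a * b' + b * d') (c * a' + d * c') (c * b' + d * d') := by
  ext1 v
  refine hilb_ext ?_ ?_ <;>
  · simp only [mul_apply_eq_comp, blockOp_fst, blockOp_snd, map_add,
      add_apply]
    abel

theorem blockOp_sub : blockOp a b c d - blockOp a' b' c' d' =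
    blockOp (a - a') (b - b') (c - c') (d - d') := by
  ext1 v
  refine hilb_ext ?_ ?_
  · change (a v.fst + b v.snd) - (a' v.fst + b' v.snd) = (a - a') v.fst + (b - b') v.snd
    simp only [sub_apply]
    abel
  · change (c v.fst + d v.snd) - (c' v.fst + d' v.snd) = (c - c') v.fst + (d - d') v.snd
    simp only [sub_apply]
    abel

theorem blockOp_neg : -blockOp a b c d = blockOp (-a) (-b) (-c) (-d) := by
  ext1 v
  refine hilb_ext ?_ ?_
  · change -(a v.fst + b v.snd) = -a v.fst + -b v.snd
    abel
  · change -(c v.fst + d v.snd) = -c v.fst + -d v.snd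
    abel

theorem blockOp_one : blockOp 1 0 0 1 = 1 := by
  rw [← diagOp_eq]
  rfl

theorem star_blockOp : star (blockOp a b c d) = blockOp (star a) (star c) (star b) (star d) := by
  refine ((ContinuousLinearMap.eq_adjoint_iff _ _).2 fun x y => ?_).symm
  simp only [WithLp.prod_inner_apply, ContinuousLinearMap.star_eq_adjoint]
  change ⟪(blockOp _ _ _ _ x).fst, y.fst⟫_ℂ + ⟪(blockOp _ _ _ _ x).snd, y.snd⟫_ℂ =
    ⟪x.fst, (blockOp _ _ _ _ y).fst⟫_ℂ + ⟪x.snd, (blockOp _ _ _ _ y).snd⟫_ℂ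
  simp only [blockOp_fst, blockOp_snd, inner_add_left, inner_add_right,
    ContinuousLinearMap.adjoint_inner_left]
  ring

end Block

theorem inner_eigenvector_zero (v : Hilb) : ⟪eigenvector 0, v⟫_ℂ = v.snd 0 := by
  change ⟪WithLp.toLp 2 ((0 : Ell2), e 0), v⟫_ℂ = _
  rw [WithLp.prod_inner_apply]
  change ⟪(0 : Ell2), v.fst⟫_ℂ + ⟪e 0, v.snd⟫_ℂ = _
  rw [inner_zero_left, zero_add, inner_e_eq]

theorem conj_sqrt_two : (starRingEnd ℂ) (1 / Real.sqrt 2 : ℂ) = 1 / Real.sqrt 2 := by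
  rw [map_div₀, map_one, Complex.conj_ofReal]

theorem sqrt_two_ne : (1 / Real.sqrt 2 : ℂ) ≠ 0 := by
  simp

theorem sqrt_two_sq : (1 / Real.sqrt 2 : ℂ) * (1 / Real.sqrt 2) = 1 / 2 := by
  rw [div_mul_div_comm, ← Complex.ofReal_mul, Real.mul_self_sqrt zero_le_two]
  norm_num

theorem inner_eigenvector_succ (v : Hilb) (k : ℕ) :
    ⟪eigenvector (Int.ofNat (k + 1)), v⟫_ℂ =
      (1 / Real.sqrt 2 : ℂ) * (v.fst k + v.snd (k + 1)) := by
  change ⟪(1 / Real.sqrt 2 : ℂ) • WithLp.toLp 2 (e k, e (k + 1)), v⟫_ℂ = _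
  rw [inner_smul_left, conj_sqrt_two, WithLp.prod_inner_apply]
  change _ * (⟪e k, v.fst⟫_ℂ + ⟪e (k + 1), v.snd⟫_ℂ) = _
  rw [inner_e_eq, inner_e_eq]

theorem inner_eigenvector_negSucc (v : Hilb) (k : ℕ) :
    ⟪eigenvector (Int.negSucc k), v⟫_ℂ =
      (1 / Real.sqrt 2 : ℂ) * (-v.fst k + v.snd (k + 1)) := by
  change ⟪(1 / Real.sqrt 2 : ℂ) • WithLp.toLp 2 (-e k, e (k + 1)), v⟫_ℂ = _
  rw [inner_smul_left, conj_sqrt_two, WithLp.prod_inner_apply]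
  change _ * (⟪-e k, v.fst⟫_ℂ + ⟪e (k + 1), v.snd⟫_ℂ) = _
  rw [inner_neg_left, inner_e_eq, inner_e_eq]

theorem e_apply (n k : ℕ) : (e n : Ell2) k = if k = n then 1 else 0 := by
  rw [← inner_e_eq, inner_e_e]

theorem orthonormal_eigenvector : Orthonormal ℂ eigenvector := by
  rw [orthonormal_iff_ite]
  have hf : ∀ k j : ℕ, (eigenvector (Int.ofNat (k + 1))).fst j =
      (1 / Real.sqrt 2 : ℂ) * if j = k then 1 else 0 :=
    fun k j => congrArg (fun z => (1 / Real.sqrt 2 : ℂ) * z) (e_apply k j)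
  have hs : ∀ k j : ℕ, (eigenvector (Int.ofNat (k + 1))).snd j =
      (1 / Real.sqrt 2 : ℂ) * if j = k + 1 then 1 else 0 :=
    fun k j => congrArg (fun z => (1 / Real.sqrt 2 : ℂ) * z) (e_apply (k + 1) j)
  have hf' : ∀ k j : ℕ, (eigenvector (Int.negSucc k)).fst j =
      (1 / Real.sqrt 2 : ℂ) * -if j = k then 1 else 0 :=
    fun k j => congrArg (fun z => (1 / Real.sqrt 2 : ℂ) * -z) (e_apply k j)
  have hs' : ∀ k j : ℕ, (eigenvector (Int.negSucc k)).snd j =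
      (1 / Real.sqrt 2 : ℂ) * if j = k + 1 then 1 else 0 :=
    fun k j => congrArg (fun z => (1 / Real.sqrt 2 : ℂ) * z) (e_apply (k + 1) j)
  have h0 : ∀ j : ℕ, (eigenvector (Int.ofNat 0)).fst j = 0 := fun j => rfl
  have h0' : ∀ j : ℕ, (eigenvector (Int.ofNat 0)).snd j = if j = 0 then 1 else 0 :=
    fun j => e_apply 0 j
  have hz : ∀ v : Hilb, ⟪eigenvector (Int.ofNat 0), v⟫_ℂ = v.snd 0 := inner_eigenvector_zero
  have h2 := sqrt_two_sq
  have hp := inner_eigenvector_succ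
  have hn := inner_eigenvector_negSucc
  generalize (1 / Real.sqrt 2 : ℂ) = c at *
  rintro ((_ | i) | i) ((_ | j) | j)
  · rw [hz, h0']; rfl
  · rw [hz, hs, if_neg (by omega), mul_zero, if_neg (by simp; omega)]
  · rw [hz, hs', if_neg (by omega), mul_zero, if_neg (by simp)]
  · rw [hp, h0, h0', if_neg (by omega), if_neg (by simp; omega)]
    simp
  · rw [hp, hf, hs]
    by_cases h : i = j
    · subst h
      simp only [if_true]
      linear_combination 2 * h2
    · rw [if_neg h, if_neg (by omega), if_neg (by simpa using h)]
      simp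
  · rw [hp, hf', hs', if_neg (by nofun : ¬ Int.ofNat (i + 1) = Int.negSucc j)]
    by_cases h : i = j <;> simp [h]
  · rw [hn, h0, h0', if_neg (by omega), if_neg (by simp)]
    simp
  · rw [hn, hf, hs, if_neg (by nofun : ¬ Int.negSucc i = Int.ofNat (j + 1))]
    by_cases h : i = j <;> simp [h]
  · rw [hn, hf', hs']
    by_cases h : i = j
    · subst h
      simp only [if_true]
      linear_combination 2 * h2
    · rw [if_neg h, if_neg (by omega), if_neg (by simpa using h)]
      simp

theorem ell2_ext {v w : Ell2} (h : ∀ k, v k = w k) : v = w := by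
  ext k
  exact h k

/-- The coordinates with respect to `b_{k+1}` and `b_{-(k+1)}` determine those with respect to
`e_k ⊕ 0` and `0 ⊕ e_{k+1}`. -/
theorem eq_and_eq_of_mul_eq {p q x y : ℂ} (h1 : (1 / Real.sqrt 2 : ℂ) * (p + q) =
    (1 / Real.sqrt 2 : ℂ) * (x + y)) (h2 : (1 / Real.sqrt 2 : ℂ) * (-p + q) =
    (1 / Real.sqrt 2 : ℂ) * (-x + y)) : p = x ∧ q = y := by
  have h3 := mul_left_cancel₀ sqrt_two_ne h1
  have h4 := mul_left_cancel₀ sqrt_two_ne h2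
  exact ⟨by linear_combination (h3 - h4) / 2, by linear_combination (h3 + h4) / 2⟩

theorem eq_zero_of_inner_eigenvector {v : Hilb} (h : ∀ k, ⟪eigenvector k, v⟫_ℂ = 0) : v = 0 := by
  have h1 : ∀ k : ℕ, v.fst k = 0 ∧ v.snd (k + 1) = 0 := fun k => by
    apply eq_and_eq_of_mul_eq
    · rw [← inner_eigenvector_succ, h, add_zero, mul_zero]
    · rw [← inner_eigenvector_negSucc, h, neg_zero, add_zero, mul_zero]
  refine hilb_ext (ell2_ext fun k => (h1 k).1) (ell2_ext fun k => ?_)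
  cases k with
  | zero => exact (inner_eigenvector_zero v).symm.trans (h 0)
  | succ k => exact (h1 k).2

/-- The vectors `b_k` form a complete orthonormal basis. -/
def diracBasis : HilbertBasis ℤ ℂ Hilb :=
  HilbertBasis.mkOfOrthogonalEqBot orthonormal_eigenvector <| by
    rw [Submodule.eq_bot_iff]
    intro v hv
    refine eq_zero_of_inner_eigenvector fun k => ?_
    exact (Submodule.mem_orthogonal _ _).1 hv _ (Submodule.subset_span ⟨k, rfl⟩)

@[simp] theorem coe_diracBasis : ⇑diracBasis = eigenvector :=
  HilbertBasis.coe_mkOfOrthogonalEqBot _ _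

theorem mem_numberOp_domain {v w : Ell2} (h : ∀ n : ℕ, w n = n * v n) : v ∈ numberOp.domain := by
  have : (fun n : ℕ => (n : ℂ) * v n) = w := funext fun n => (h n).symm
  change Memℓp (fun n : ℕ => (n : ℂ) * v n) 2
  rw [this]
  exact w.2

theorem numberOp_apply (v : numberOp.domain) (n : ℕ) : numberOp v n = n * (v : Ell2) n := rfl

theorem dirac_fst_apply (v : dirac.domain) (k : ℕ) :
    (dirac v).fst k = (k + 1) * (v : Hilb).snd (k + 1) := by
  refine (star_shift_apply k (numberOp ⟨(v : Hilb).snd, v.2.2⟩)).trans ?_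
  rw [numberOp_apply]
  push_cast
  rfl

theorem dirac_snd_zero (v : dirac.domain) : (dirac v).snd 0 = 0 := shift_apply_zero _

theorem dirac_snd_succ (v : dirac.domain) (k : ℕ) :
    (dirac v).snd (k + 1) = (k + 1) * (v : Hilb).fst k := by
  refine (shift_apply_succ k (numberOp ⟨(v : Hilb).fst, v.2.1⟩ + (v : Hilb).fst)).trans ?_
  change (k : ℂ) * (v : Hilb).fst k + (v : Hilb).fst k = _
  ring

/-- The absolute value `|D| (v₊ ⊕ v₋) = (N + 1) v₊ ⊕ N v₋` of the Dirac operator. -/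
def absDirac : Hilb →ₗ.[ℂ] Hilb where
  domain := diracDomain
  toFun := (WithLp.linearEquiv 2 ℂ (Ell2 × Ell2)).symm.toLinearMap ∘ₗ
    (numberPlus + plusPart ∘ₗ diracDomain.subtype).prod numberMinus

theorem absDirac_fst_apply (v : absDirac.domain) (k : ℕ) :
    (absDirac v).fst k = (k + 1) * (v : Hilb).fst k := by
  change (k : ℂ) * (v : Hilb).fst k + (v : Hilb).fst k = _
  ring

theorem absDirac_snd_apply (v : absDirac.domain) (k : ℕ) :
    (absDirac v).snd k = k * (v : Hilb).snd k := rfl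

theorem cast_ofNat_succ (k : ℕ) : ((Int.ofNat (k + 1) : ℤ) : ℝ) = (k : ℝ) + 1 :=
  (Int.cast_natCast (k + 1)).trans (Nat.cast_succ k)

theorem cast_negSucc (k : ℕ) : ((Int.negSucc k : ℤ) : ℝ) = -((k : ℝ) + 1) := by
  rw [Int.cast_negSucc, Nat.cast_succ]

theorem add_apply_coord (v w : Ell2) (k : ℕ) : (v + w) k = v k + w k := rfl

theorem sub_apply_coord (v w : Ell2) (k : ℕ) : (v - w) k = v k - w k := rfl

theorem isDiag_dirac : IsDiag dirac diracBasis (fun k : ℤ => (k : ℝ)) := by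
  constructor
  · intro v w h
    simp only [coe_diracBasis] at h
    have h1 : ∀ k : ℕ, w.fst k = (k + 1) * v.snd (k + 1) ∧ w.snd (k + 1) = (k + 1) * v.fst k :=
      fun k => by
        apply eq_and_eq_of_mul_eq
        · rw [← inner_eigenvector_succ, h, inner_eigenvector_succ, cast_ofNat_succ]
          push_cast
          ring
        · rw [← inner_eigenvector_negSucc, h, inner_eigenvector_negSucc, cast_negSucc]
          push_cast
          ring
    refine ⟨mem_numberOp_domain (w := star shift w.snd - v.fst) fun n => ?_,
      mem_numberOp_domain (w := shift w.fst) fun n => ?_⟩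
    · rw [sub_apply_coord, star_shift_apply, (h1 n).2]
      change _ = (n : ℂ) * v.fst n
      ring
    · cases n with
      | zero => rw [shift_apply_zero, Nat.cast_zero, zero_mul]
      | succ n =>
        rw [shift_apply_succ, (h1 n).1]
        push_cast
        rfl
  · rintro v ((_ | k) | k) <;> rw [coe_diracBasis]
    · change ⟪eigenvector 0, _⟫_ℂ = _
      rw [inner_eigenvector_zero, dirac_snd_zero]
      simp
    · rw [inner_eigenvector_succ, inner_eigenvector_succ, dirac_fst_apply, dirac_snd_succ,
        cast_ofNat_succ]
      push_cast
      ring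
    · rw [inner_eigenvector_negSucc, inner_eigenvector_negSucc, dirac_fst_apply, dirac_snd_succ,
        cast_negSucc]
      push_cast
      ring

theorem isDiag_absDirac : IsDiag absDirac diracBasis (fun k : ℤ => |(k : ℝ)|) := by
  have e1 : ∀ k : ℕ, ((|((Int.ofNat (k + 1) : ℤ) : ℝ)| : ℝ) : ℂ) = (k : ℂ) + 1 := fun k => by
    rw [cast_ofNat_succ, abs_of_nonneg (by positivity)]
    push_cast
    rfl
  have e2 : ∀ k : ℕ, ((|((Int.negSucc k : ℤ) : ℝ)| : ℝ) : ℂ) = (k : ℂ) + 1 := fun k => by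
    rw [cast_negSucc, abs_neg, abs_of_nonneg (by positivity)]
    push_cast
    rfl
  constructor
  · intro v w h
    simp only [coe_diracBasis] at h
    have h1 : ∀ k : ℕ, w.fst k = (k + 1) * v.fst k ∧ w.snd (k + 1) = (k + 1) * v.snd (k + 1) :=
      fun k => by
        apply eq_and_eq_of_mul_eq
        · rw [← inner_eigenvector_succ, h, inner_eigenvector_succ, e1]
          ring
        · rw [← inner_eigenvector_negSucc, h, inner_eigenvector_negSucc, e2]
          ring
    refine ⟨mem_numberOp_domain (w := w.fst - v.fst) fun n => ?_,
      mem_numberOp_domain (w := w.snd) fun n => ?_⟩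
    · rw [sub_apply_coord, (h1 n).1]
      change _ = (n : ℂ) * v.fst n
      ring
    · cases n with
      | zero =>
        rw [Nat.cast_zero, zero_mul, ← inner_eigenvector_zero, h]
        simp
      | succ n =>
        rw [(h1 n).2]
        push_cast
        rfl
  · rintro v ((_ | k) | k) <;> rw [coe_diracBasis]
    · change ⟪eigenvector 0, _⟫_ℂ = _
      rw [inner_eigenvector_zero, absDirac_snd_apply]
      simp
    · rw [inner_eigenvector_succ, inner_eigenvector_succ, absDirac_fst_apply, absDirac_snd_apply,
        e1]
      push_cast
      ring
    · rw [inner_eigenvector_negSucc, inner_eigenvector_negSucc, absDirac_fst_apply,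
        absDirac_snd_apply, e2]
      push_cast
      ring

/-- The phase `F (v₊ ⊕ v₋) = S* v₋ ⊕ S v₊` of the Dirac operator. -/
def phase : Hilb →L[ℂ] Hilb := blockOp 0 (star shift) shift 0

theorem star_phase : star phase = phase := by
  rw [phase, star_blockOp, star_zero, star_star]

theorem phase_mul_phase : phase * phase = blockOp 1 0 0 (shift * star shift) := by
  rw [phase, blockOp_mul, star_shift_mul_shift]
  simp

theorem isPolarDecomposition_dirac : IsPolarDecomposition dirac phase absDirac where
  dense_domain := isDiag_absDirac.dense_domain
  selfAdjoint := isDiag_absDirac.isSelfAdjoint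
  nonneg := isDiag_absDirac.nonneg fun _ => abs_nonneg _
  domain_eq := rfl
  apply_eq v hP hD := by
    refine hilb_ext ?_ ?_
    · rw [phase, blockOp_fst, zero_apply, zero_add]
      rfl
    · rw [phase, blockOp_snd, zero_apply, add_zero]
      rfl
  partialIsometry := by
    rw [star_phase, phase_mul_phase, phase, blockOp_mul, mul_assoc, star_shift_mul_shift]
    simp
  ker_eq v := by
    have hfst : (phase v).fst = star shift v.snd := by
      rw [phase, blockOp_fst, zero_apply, zero_add]
    have hsnd : (phase v).snd = shift v.fst := by
      rw [phase, blockOp_snd, zero_apply, add_zero]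
    constructor
    · intro h
      rw [h] at hfst hsnd
      have h1 : ∀ k, v.fst k = 0 := fun k => by
        rw [← shift_apply_succ, ← hsnd]
        rfl
      have h2 : ∀ k, v.snd (k + 1) = 0 := fun k => by
        rw [← star_shift_apply, ← hfst]
        rfl
      have h3 : ∀ k : ℤ, ⟪diracBasis k, (0 : Hilb)⟫_ℂ = (|(k : ℝ)| : ℝ) * ⟪diracBasis k, v⟫_ℂ := by
        rintro ((_ | k) | k) <;> rw [coe_diracBasis, inner_zero_right]
        · simp
        · rw [inner_eigenvector_succ, h1, h2]
          simp
        · rw [inner_eigenvector_negSucc, h1, h2]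
          simp
      exact ⟨_, isDiag_absDirac.apply_eq v 0 h3⟩
    · rintro ⟨hv, h⟩
      have hk : ∀ k : ℕ, (k : ℂ) + 1 ≠ 0 := Nat.cast_add_one_ne_zero
      have h1 := absDirac_fst_apply ⟨v, hv⟩
      have h2 := absDirac_snd_apply ⟨v, hv⟩
      rw [h] at h1 h2
      refine hilb_ext ?_ ?_
      · rw [hfst]
        refine ell2_ext fun k => ?_
        have h3 := h2 (k + 1)
        push_cast at h3
        rw [star_shift_apply]
        exact (mul_eq_zero.1 h3.symm).resolve_left (hk k)
      · rw [hsnd, ell2_ext (v := v.fst) (w := 0) fun k =>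
          (mul_eq_zero.1 (h1 k).symm).resolve_left (hk k), map_zero]
        rfl

theorem tendsto_abs_int_cast : Tendsto (fun k : ℤ => |(k : ℝ)|) cofinite atTop :=
  tendsto_norm_cocompact_atTop.comp Int.tendsto_coe_cofinite

end QuantumSurface

/-! ### Commutators with the Dirac operator and its absolute value -/

namespace QuantumSurface

open Filter Unbounded

theorem numberOp_eq {v w : Ell2} (h : ∀ n : ℕ, w n = n * v n) (hv : v ∈ numberOp.domain) :
    numberOp ⟨v, hv⟩ = w :=
  ell2_ext fun n => (numberOp_apply _ n).trans (h n).symm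

/-- If `x' = [N, x]`, then `N x v = x N v + x' v` for `v ∈ dom N`. -/
theorem HasDelta.apply {x x' : Ell2 →L[ℂ] Ell2} (hx : HasDelta x x') {v w : Ell2}
    (h : ∀ n : ℕ, w n = n * v n) (k : ℕ) : (x w + x' v) k = k * x v k := by
  have h1 := (hasSum_entry_apply x k w).add (hasSum_entry_apply x' k v)
  have h2 := (hasSum_entry_apply x k v).mul_left (k : ℂ)
  rw [add_apply_coord]
  refine h1.unique ?_
  convert! h2 using 2 with n
  rw [h, ← hx]
  ring

/-- If `r` is of rapid decay, then `r N` extends to an operator of rapid decay. -/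
theorem Rapid.exists_mul_number {r : Ell2 →L[ℂ] Ell2} (hr : Rapid r) :
    ∃ y, Rapid y ∧ ∀ v w : Ell2, (∀ n : ℕ, w n = n * v n) → y v = r w := by
  have h : RapidMat fun (_ : Unit) k n => entry r k n * n :=
    RapidMat.of_le_pow hr 0 1 1 fun _ k n => by
      rw [norm_mul, Complex.norm_natCast, pow_zero, one_mul, one_mul, pow_one, mul_comm]
      gcongr
      linarith
  obtain ⟨y, hy, hy'⟩ := h.exists_rapid
  refine ⟨y, hy, fun v w hw => ell2_ext fun k => ?_⟩
  refine (hasSum_entry_apply y k v).unique ?_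
  convert! hasSum_entry_apply r k w using 2 with n
  rw [hy', hw]
  ring

/-- With `|D| = (N + 1) ⊕ N`, the commutator of `|D|` with a block operator is computed entrywise;
the off-diagonal entries pick up the terms `b` and `-c` from the summand `1`. -/
theorem isCommutator_absDirac {a b c d a' b' c' d' : Ell2 →L[ℂ] Ell2} (ha : HasDelta a a')
    (hb : HasDelta b b') (hc : HasDelta c c') (hd : HasDelta d d') :
    IsCommutator absDirac (blockOp a b c d) (blockOp a' (b' + b) (c' - c) d') := by
  rintro ⟨v, hv⟩
  set w1 := numberOp ⟨v.fst, hv.1⟩ with hw1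
  set w2 := numberOp ⟨v.snd, hv.2⟩ with hw2
  have h1 : ∀ n : ℕ, w1 n = n * v.fst n := fun n => rfl
  have h2 : ∀ n : ℕ, w2 n = n * v.snd n := fun n => rfl
  have k1 : ∀ n : ℕ, (a w1 + a' v.fst + (b w2 + b' v.snd)) n =
      n * (blockOp a b c d v).fst n := fun n => by
    rw [blockOp_fst, add_apply_coord (a w1 + _), ha.apply h1, hb.apply h2, add_apply_coord, mul_add]
  have k2 : ∀ n : ℕ, (c w1 + c' v.fst + (d w2 + d' v.snd)) n =
      n * (blockOp a b c d v).snd n := fun n => by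
    rw [blockOp_snd, add_apply_coord (c w1 + _), hc.apply h1, hd.apply h2, add_apply_coord, mul_add]
  refine ⟨⟨mem_numberOp_domain k1, mem_numberOp_domain k2⟩, hilb_ext ?_ ?_⟩
  · change numberOp ⟨(blockOp a b c d v).fst, mem_numberOp_domain k1⟩ + (blockOp a b c d v).fst -
      (blockOp a b c d (absDirac ⟨v, hv⟩)).fst = _
    rw [numberOp_eq k1, blockOp_fst, blockOp_fst, blockOp_fst]
    change _ - (a (w1 + v.fst) + b w2) = _
    rw [map_add, add_apply]
    abel
  · change numberOp ⟨(blockOp a b c d v).snd, mem_numberOp_domain k2⟩ -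
      (blockOp a b c d (absDirac ⟨v, hv⟩)).snd = _
    rw [numberOp_eq k2, blockOp_snd, blockOp_snd]
    change _ - (c (w1 + v.fst) + d w2) = _
    rw [map_add, sub_apply]
    abel

/-- Block operators with smooth entries are smooth for the derivation `[|D|, ·]`. -/
theorem memDomDelta_blockOp (n : ℕ) {a b c d : Ell2 →L[ℂ] Ell2} (ha : Smooth a) (hb : Smooth b)
    (hc : Smooth c) (hd : Smooth d) : MemDomDelta absDirac n (blockOp a b c d) := by
  induction n generalizing a b c d with
  | zero => trivial
  | succ n ih =>
    obtain ⟨a', ha1, ha2⟩ := ha.exists_hasDelta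
    obtain ⟨b', hb1, hb2⟩ := hb.exists_hasDelta
    obtain ⟨c', hc1, hc2⟩ := hc.exists_hasDelta
    obtain ⟨d', hd1, hd2⟩ := hd.exists_hasDelta
    exact ⟨_, isCommutator_absDirac ha1 hb1 hc1 hd1, ih ha2 (hb2.add hb) (hc2.sub hc) hd2⟩

theorem smooth_zero : Smooth 0 := Rapid.zero.smooth

/-- The commutator of `D` with `a ⊕ a` is bounded with smooth entries: it is off-diagonal with the
entries `S* [N, a] + [S*, a] N` and `S [N, a] + [S, a] (N + 1)`. -/
theorem exists_isCommutator_dirac {a : Ell2 →L[ℂ] Ell2} (ha : Smooth a)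
    (h1 : Rapid (shift * a - a * shift)) (h2 : Rapid (star shift * a - a * star shift)) :
    ∃ b c, Smooth b ∧ Smooth c ∧ IsCommutator dirac (diagOp a a) (blockOp 0 b c 0) := by
  obtain ⟨a', ha1, ha2⟩ := ha.exists_hasDelta
  obtain ⟨y1, hy1, hy1'⟩ := h1.exists_mul_number
  obtain ⟨y2, hy2, hy2'⟩ := h2.exists_mul_number
  refine ⟨star shift * a' + y2, shift * a' + (y1 + (shift * a - a * shift)),
    (smooth_shift.star.mul ha2).add hy2.smooth,
    (smooth_shift.mul ha2).add (hy1.smooth.add h1.smooth), ?_⟩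
  rintro ⟨v, hv⟩
  set w1 := numberOp ⟨v.fst, hv.1⟩ with hw1
  set w2 := numberOp ⟨v.snd, hv.2⟩ with hw2
  have k1 := ha1.apply (v := v.fst) (w := w1) fun n => rfl
  have k2 := ha1.apply (v := v.snd) (w := w2) fun n => rfl
  refine ⟨⟨mem_numberOp_domain k1, mem_numberOp_domain k2⟩, hilb_ext ?_ ?_⟩
  · change star shift (numberOp ⟨a v.snd, mem_numberOp_domain k2⟩) - a (star shift w2) = _
    rw [numberOp_eq k2, blockOp_fst, zero_apply, zero_add, add_apply, hy2' v.snd w2 fun n => rfl,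
      map_add, sub_apply, mul_apply_eq_comp, mul_apply_eq_comp, mul_apply_eq_comp]
    abel
  · change shift (numberOp ⟨a v.fst, mem_numberOp_domain k1⟩ + a v.fst) - a (shift (w1 + v.fst)) = _
    rw [numberOp_eq k1, blockOp_snd, zero_apply, add_zero, add_apply, add_apply,
      hy1' v.fst w1 fun n => rfl, sub_apply, sub_apply]
    simp only [mul_apply_eq_comp, map_add]
    abel

theorem smooth_of_mem_smoothAlgebra {g : ℕ} {a : Ell2 →L[ℂ] Ell2} (h : a ∈ smoothAlgebra g) :
    Smooth a := by
  obtain ⟨f, -, hf, hr⟩ := mem_smoothAlgebra_iff.1 h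
  exact smooth_of_rapid_sub hf hr

theorem rapid_shift_commutator {g : ℕ} {a : Ell2 →L[ℂ] Ell2} (h : a ∈ smoothAlgebra g) :
    Rapid (shift * a - a * shift) := by
  obtain ⟨f, -, hf, hr⟩ := mem_smoothAlgebra_iff.1 h
  have := Rapid.zero.sub (rapid_commutator_of_rapid_sub hf hr)
  rwa [zero_sub, neg_sub] at this

/-- `[S*, a] = [a*, S]*`. -/
theorem rapid_star_shift_commutator {g : ℕ} {a : Ell2 →L[ℂ] Ell2} (h : a ∈ smoothAlgebra g) :
    Rapid (star shift * a - a * star shift) := by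
  obtain ⟨f, -, hf, hr⟩ := mem_smoothAlgebra_iff.1 (star_mem h)
  have : Rapid (star (star a * shift - shift * star a)) :=
    RapidFam.star (rapid_commutator_of_rapid_sub hf hr)
  rwa [star_sub, star_mul, star_mul, star_star] at this

theorem exists_isCommutator_rep {g : ℕ} (a : smoothAlgebra g) :
    ∃ b c, Smooth b ∧ Smooth c ∧
      IsCommutator dirac (rep (smoothAlgebra g) a) (blockOp 0 b c 0) :=
  exists_isCommutator_dirac (smooth_of_mem_smoothAlgebra a.2) (rapid_shift_commutator a.2)
    (rapid_star_shift_commutator a.2)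

theorem rep_apply {g : ℕ} (a : smoothAlgebra g) :
    rep (smoothAlgebra g) a = blockOp a 0 0 a := diagOp_eq _ _

theorem isRegular_dirac (g : ℕ) : SpectralTriple.IsRegular (rep (smoothAlgebra g)) dirac := by
  refine ⟨phase, absDirac, isPolarDecomposition_dirac, fun a => ⟨fun n => ?_, ?_⟩⟩
  · have ha := smooth_of_mem_smoothAlgebra a.2
    rw [rep_apply]
    exact memDomDelta_blockOp n ha smooth_zero smooth_zero ha
  · obtain ⟨b, c, hb, hc, h⟩ := exists_isCommutator_rep a
    exact ⟨_, h, fun n => memDomDelta_blockOp n smooth_zero hb hc smooth_zero⟩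

theorem isEven_dirac {g : ℕ} (hg : 1 ≤ g) :
    SpectralTriple.IsEven (surface g) (smoothAlgebra g) (rep (smoothAlgebra g)) dirac grading where
  closure_eq := smoothAlgebra_topologicalClosure hg
  holomorphicallyStable := isHolomorphicallyStable_smoothAlgebra hg
  faithful a a' h := by
    refine Subtype.ext (ContinuousLinearMap.ext fun v => ?_)
    exact congrArg (fun x : Hilb →L[ℂ] Hilb => (x (WithLp.toLp 2 (v, 0))).fst) h
  dense_domain := isDiag_dirac.dense_domain
  selfAdjoint := isDiag_dirac.isSelfAdjoint
  compactResolvent := isDiag_dirac.hasCompactResolvent tendsto_abs_int_cast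
  grading_selfAdjoint := by
    rw [isSelfAdjoint_iff, grading, diagOp_eq, star_blockOp]
    simp
  grading_sq := by
    rw [grading, diagOp_eq, blockOp_mul, ← blockOp_one]
    simp
  grading_anticomm v := by
    have h2 : (grading (v : Hilb)).snd = -(v : Hilb).snd := rfl
    have h : grading (v : Hilb) ∈ dirac.domain := by
      refine ⟨v.2.1, ?_⟩
      exact numberOp.domain.neg_mem v.2.2
    refine ⟨h, hilb_ext (ell2_ext fun k => ?_) (ell2_ext fun k => ?_)⟩
    · rw [dirac_fst_apply]
      change ((k : ℂ) + 1) * -(v : Hilb).snd (k + 1) = -(dirac v).fst k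
      rw [dirac_fst_apply, mul_neg]
    · change _ = - -(dirac v).snd k
      cases k with
      | zero => rw [dirac_snd_zero, dirac_snd_zero, neg_zero, neg_zero]
      | succ k =>
        rw [dirac_snd_succ, dirac_snd_succ, neg_neg]
        rfl
  grading_comm a := by
    rw [grading, diagOp_eq, rep_apply, blockOp_mul, blockOp_mul]
    simp
  commutator_bounded a := by
    obtain ⟨b, c, -, -, h⟩ := exists_isCommutator_rep a
    exact ⟨_, h⟩

end QuantumSurface

/-! ### The Fredholm module and its index pairing -/

namespace SpectralTriple

open scoped LinearMap.FiniteRangeSetoid in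
/-- An operator with a continuous right inverse is Fredholm if its kernel is finite dimensional, and
its index is the dimension of the kernel. -/
theorem isFredholm_of_rightInverse {V W : Type*} [AddCommGroup V] [Module ℂ V]
    [TopologicalSpace V] [IsTopologicalAddGroup V] [ContinuousSMul ℂ V] [T2Space V]
    [AddCommGroup W] [Module ℂ W] [TopologicalSpace W] [IsTopologicalAddGroup W]
    [ContinuousSMul ℂ W] [T2Space W] {T : V →L[ℂ] W} (R : W →L[ℂ] V) (h : ∀ w, T (R w) = w)
    [FiniteDimensional ℂ T.ker] :
    T.IsFredholm ∧ fredholmIndex T = Module.finrank ℂ T.ker := by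
  constructor
  · refine .of_isQuasiInverse (v := R) ⟨?_, ?_⟩
    · change (R : W →ₗ[ℂ] V) ∘ₗ (T : V →ₗ[ℂ] W) ≈ .id
      rw [LinearMap.FiniteRangeSetoid.equiv_iff_hasFiniteRange,
        LinearMap.hasFiniteRange_iff_range]
      have hle : ((R : W →ₗ[ℂ] V) ∘ₗ (T : V →ₗ[ℂ] W) - .id).range ≤ T.ker := by
        rintro _ ⟨v, rfl⟩
        change T (R (T v) - v) = 0
        rw [map_sub, h, sub_self]
      exact Submodule.fg_iff_finiteDimensional _ |>.2 (Submodule.finiteDimensional_of_le hle)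
    · have : (T : V →ₗ[ℂ] W) ∘ₗ (R : W →ₗ[ℂ] V) = .id := LinearMap.ext h
      change (T : V →ₗ[ℂ] W) ∘ₗ (R : W →ₗ[ℂ] V) ≈ .id
      rw [this]
  · have hr : T.range = ⊤ := LinearMap.range_eq_top.2 fun w => ⟨R w, h w⟩
    have : Subsingleton (W ⧸ T.range) := by
      rw [hr]
      infer_instance
    rw [fredholmIndex, Module.finrank_zero_of_subsingleton (M := W ⧸ T.range), Nat.cast_zero,
      sub_zero]

end SpectralTriple

namespace QuantumSurface

open Filter Unbounded SpectralTriple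

theorem isCompactOperator_blockOp {a b c d : Ell2 →L[ℂ] Ell2} (ha : IsCompactOperator a)
    (hb : IsCompactOperator b) (hc : IsCompactOperator c) (hd : IsCompactOperator d) :
    IsCompactOperator (blockOp a b c d) := by
  set E := WithLp.prodContinuousLinearEquiv 2 ℂ Ell2 Ell2
  set i₁ : Ell2 →L[ℂ] Hilb := (E.symm : Ell2 × Ell2 →L[ℂ] Hilb) ∘L .inl ℂ Ell2 Ell2
  set i₂ : Ell2 →L[ℂ] Hilb := (E.symm : Ell2 × Ell2 →L[ℂ] Hilb) ∘L .inr ℂ Ell2 Ell2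
  set p₁ : Hilb →L[ℂ] Ell2 := .fst ℂ Ell2 Ell2 ∘L (E : Hilb →L[ℂ] Ell2 × Ell2)
  set p₂ : Hilb →L[ℂ] Ell2 := .snd ℂ Ell2 Ell2 ∘L (E : Hilb →L[ℂ] Ell2 × Ell2)
  have h := (((ha.comp_clm p₁).clm_comp i₁).add ((hb.comp_clm p₂).clm_comp i₁)).add
    (((hc.comp_clm p₁).clm_comp i₂).add ((hd.comp_clm p₂).clm_comp i₂))
  convert! h using 1
  funext v
  refine hilb_ext ?_ ?_
  · change _ = a v.fst + b v.snd + (0 + 0)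
    rw [add_zero, add_zero, blockOp_fst]
  · change _ = (0 + 0) + (c v.fst + d v.snd)
    rw [zero_add, zero_add, blockOp_snd]

theorem isEvenFredholmModule_phase (g : ℕ) :
    IsEvenFredholmModule (rep (smoothAlgebra g)) phase grading where
  grading_selfAdjoint := by
    rw [isSelfAdjoint_iff, grading, diagOp_eq, star_blockOp]
    simp
  grading_sq := by
    rw [grading, diagOp_eq, blockOp_mul, ← blockOp_one]
    simp
  grading_comm a := by
    rw [grading, diagOp_eq, rep_apply, blockOp_mul, blockOp_mul]
    simp
  grading_anticomm := by
    rw [grading, phase, diagOp_eq, blockOp_mul, blockOp_mul, blockOp_neg]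
    simp
  compact_adjoint := by
    rw [star_phase, sub_self]
    exact isCompactOperator_zero
  compact_sq := by
    have h : IsCompactOperator (shift * star shift - 1 : Ell2 →L[ℂ] Ell2) := by
      rw [← neg_sub, one_sub_shift_mul_star_shift]
      exact ((rapid_matUnit 0 0).isCompactOperator).neg
    rw [phase_mul_phase, ← blockOp_one, blockOp_sub, sub_self, sub_self]
    exact isCompactOperator_blockOp isCompactOperator_zero isCompactOperator_zero
      isCompactOperator_zero h
  compact_comm a := by
    rw [rep_apply, phase, blockOp_mul, blockOp_mul, blockOp_sub]
    simp only [zero_mul, mul_zero, add_zero, zero_add, sub_self]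
    exact isCompactOperator_blockOp isCompactOperator_zero
      (rapid_star_shift_commutator a.2).isCompactOperator
      (rapid_shift_commutator a.2).isCompactOperator isCompactOperator_zero

theorem matrixOp_one {g n : ℕ} (v : Fin n → Hilb) :
    matrixOp (rep (smoothAlgebra g)) (1 : Matrix (Fin n) (Fin n) (smoothAlgebra g)) v = v := by
  funext i
  simp only [matrixOp, ContinuousLinearMap.pi_apply, sum_apply, ContinuousLinearMap.comp_apply,
    ContinuousLinearMap.proj_apply]
  rw [Finset.sum_eq_single i]
  · rw [Matrix.one_apply_eq, map_one]
    rfl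
  · intro j _ hj
    rw [Matrix.one_apply_ne' hj, map_zero]
    rfl
  · simp

theorem mem_compressedSpace_one {g n : ℕ} {c : ℂ} {v : Fin n → Hilb} :
    v ∈ compressedSpace (rep (smoothAlgebra g)) grading c
      (1 : Matrix (Fin n) (Fin n) (smoothAlgebra g)) ↔ ∀ i, grading (v i) = c • v i := by
  have : (matrixOp (rep (smoothAlgebra g)) (1 : Matrix (Fin n) (Fin n) (smoothAlgebra g)) :
      (Fin n → Hilb) →ₗ[ℂ] (Fin n → Hilb)) = LinearMap.id := LinearMap.ext matrixOp_one
  rw [compressedSpace, this, Submodule.map_id]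
  simp [Submodule.mem_pi]

theorem grading_eq_iff (v : Hilb) : grading v = (1 : ℂ) • v ↔ v.snd = 0 := by
  rw [one_smul]
  constructor
  · intro h
    have h1 : -v.snd = v.snd := congrArg WithLp.snd h
    exact ell2_ext fun k => self_eq_neg.1 (congrArg (fun w : Ell2 => w k) h1.symm)
  · intro h
    refine hilb_ext rfl ?_
    change -v.snd = v.snd
    rw [h, neg_zero]

theorem grading_eq_neg_iff (v : Hilb) : grading v = (-1 : ℂ) • v ↔ v.fst = 0 := by
  rw [neg_one_smul]
  constructor
  · intro h
    have h1 : v.fst = -v.fst := congrArg WithLp.fst h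
    exact ell2_ext fun k => self_eq_neg.1 (congrArg (fun w : Ell2 => w k) h1)
  · intro h
    refine hilb_ext ?_ rfl
    change v.fst = -v.fst
    rw [h, neg_zero]

/-- The phase applied to each component of `Hⁿ`. -/
def phaseOn (n : ℕ) : (Fin n → Hilb) →L[ℂ] (Fin n → Hilb) :=
  ContinuousLinearMap.pi fun i => phase ∘L ContinuousLinearMap.proj i

theorem phaseOn_apply {n : ℕ} (v : Fin n → Hilb) (i : Fin n) : phaseOn n v i = phase (v i) := rfl

theorem phase_fst (v : Hilb) : (phase v).fst = star shift v.snd := by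
  rw [phase, blockOp_fst, zero_apply, zero_add]

theorem phase_snd (v : Hilb) : (phase v).snd = shift v.fst := by
  rw [phase, blockOp_snd, zero_apply, add_zero]

/-- The pairing of the fundamental class with the unit: `S* : H_- → H_+` has index `1`. -/
theorem isIndexPairing_one (g : ℕ) : IsIndexPairing (rep (smoothAlgebra g)) phase grading
    (1 : Matrix (Fin 1) (Fin 1) (smoothAlgebra g)) 1 := by
  have h1 : ∀ v ∈ compressedSpace (rep (smoothAlgebra g)) grading (-1)
      (1 : Matrix (Fin 1) (Fin 1) (smoothAlgebra g)), phaseOn 1 v ∈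
      compressedSpace (rep (smoothAlgebra g)) grading 1
      (1 : Matrix (Fin 1) (Fin 1) (smoothAlgebra g)) := fun v hv => by
    rw [mem_compressedSpace_one] at hv ⊢
    intro i
    rw [grading_eq_iff, phaseOn_apply, phase_snd, (grading_eq_neg_iff _).1 (hv i), map_zero]
  have h2 : ∀ v ∈ compressedSpace (rep (smoothAlgebra g)) grading 1
      (1 : Matrix (Fin 1) (Fin 1) (smoothAlgebra g)), phaseOn 1 v ∈
      compressedSpace (rep (smoothAlgebra g)) grading (-1)
      (1 : Matrix (Fin 1) (Fin 1) (smoothAlgebra g)) := fun v hv => by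
    rw [mem_compressedSpace_one] at hv ⊢
    intro i
    rw [grading_eq_neg_iff, phaseOn_apply, phase_fst, (grading_eq_iff _).1 (hv i), map_zero]
  -- `S S* + e₀ ⟨e₀, ·⟩ = 1 = S* S`: the right inverse is `S`, and the kernel is spanned by `e₀`
  set T := (phaseOn 1).restrict h1 with hT
  have hinv : ∀ w, T ((phaseOn 1).restrict h2 w) = w := fun w => by
    refine Subtype.ext (funext fun i => hilb_ext ?_ ?_)
    · change (phase (phase ((w : Fin 1 → Hilb) i))).fst = _
      rw [phase_fst, phase_snd, ← mul_apply_eq_comp, star_shift_mul_shift]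
      rfl
    · have hw := (grading_eq_iff _).1 (mem_compressedSpace_one.1 w.2 i)
      change (phase (phase ((w : Fin 1 → Hilb) i))).snd = _
      rw [phase_snd, phase_fst, hw, map_zero, map_zero]
  have hb : (fun _ : Fin 1 => eigenvector 0) ∈ compressedSpace (rep (smoothAlgebra g)) grading (-1)
      (1 : Matrix (Fin 1) (Fin 1) (smoothAlgebra g)) := by
    rw [mem_compressedSpace_one]
    exact fun _ => (grading_eq_neg_iff _).2 rfl
  have hb0 : (⟨_, hb⟩ : compressedSpace (rep (smoothAlgebra g)) grading (-1)
      (1 : Matrix (Fin 1) (Fin 1) (smoothAlgebra g))) ≠ 0 := fun h =>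
    orthonormal_eigenvector.ne_zero 0 (congrFun (congrArg Subtype.val h) 0)
  have hker : T.ker = ℂ ∙ (⟨_, hb⟩ : compressedSpace (rep (smoothAlgebra g)) grading (-1)
      (1 : Matrix (Fin 1) (Fin 1) (smoothAlgebra g))) := by
    ext v
    rw [Submodule.mem_span_singleton]
    have hv := (grading_eq_neg_iff _).1 (mem_compressedSpace_one.1 v.2 0)
    constructor
    · intro h
      have h3 : star shift ((v : Fin 1 → Hilb) 0).snd = 0 := by
        rw [← phase_fst]
        exact congrArg (fun w : compressedSpace (rep (smoothAlgebra g)) grading 1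
          (1 : Matrix (Fin 1) (Fin 1) (smoothAlgebra g)) => ((w : Fin 1 → Hilb) 0).fst) h
      refine ⟨((v : Fin 1 → Hilb) 0).snd 0, Subtype.ext (funext fun i => ?_)⟩
      rw [Subsingleton.elim i 0]
      refine hilb_ext ?_ (ell2_ext fun k => ?_)
      · rw [hv]
        exact smul_zero _
      · change _ * (e 0 : Ell2) k = _
        rw [e_apply]
        cases k with
        | zero => simp
        | succ k =>
          rw [← star_shift_apply, h3, if_neg k.succ_ne_zero, mul_zero]
          rfl
    · rintro ⟨c, rfl⟩
      refine Submodule.smul_mem _ _ (Subtype.ext (funext fun i => hilb_ext ?_ ?_))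
      · change (phase (eigenvector 0)).fst = 0
        rw [phase_fst]
        exact star_shift_apply_e_zero
      · change (phase (eigenvector 0)).snd = 0
        rw [phase_snd]
        exact map_zero _
  have : FiniteDimensional ℂ T.ker := by
    rw [hker]
    infer_instance
  obtain ⟨h3, h4⟩ := isFredholm_of_rightInverse _ hinv
  refine ⟨T, fun v => ?_, h3, ?_⟩
  · rw [matrixOp_one]
    rfl
  · rw [h4, hker, finrank_span_singleton hb0, Nat.cast_one]

theorem hasNontrivialFundamentalClass_dirac (g : ℕ) :
    HasNontrivialFundamentalClass (rep (smoothAlgebra g)) dirac grading :=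
  ⟨phase, absDirac, isPolarDecomposition_dirac, isEvenFredholmModule_phase g, 1, 1, one_mul 1,
    Matrix.isHermitian_one, 1, one_ne_zero, isIndexPairing_one g⟩

end QuantumSurface

/-! ### Traces of diagonal operators -/

namespace Unbounded

open Filter

variable {ι H : Type*} [NormedAddCommGroup H] [InnerProductSpace ℂ H]

theorem nonneg_of_inner_apply (b : HilbertBasis ι ℂ H) {T : H →L[ℂ] H} {μ : ι → ℝ}
    (hμ : ∀ i, 0 ≤ μ i) (hT : ∀ i v, ⟪b i, T v⟫_ℂ = μ i * ⟪b i, v⟫_ℂ) : 0 ≤ T := by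
  rw [ContinuousLinearMap.nonneg_iff_isPositive, ContinuousLinearMap.isPositive_def]
  have hsymm : (T : H →ₗ[ℂ] H).IsSymmetric := fun v w => by
    refine (b.hasSum_inner_mul_inner (T v) w).unique
      ((b.hasSum_inner_mul_inner v (T w)).congr_fun fun i => ?_)
    rw [hT, ← inner_conj_symm, hT, map_mul, Complex.conj_ofReal, inner_conj_symm]
    ring
  refine ⟨hsymm, fun v => ?_⟩
  have h := ((b.hasSum_inner_mul_inner v (T v)).mapL Complex.reCLM)
  have h0 : 0 ≤ Complex.reCLM ⟪v, T v⟫_ℂ := h.nonneg fun i => by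
    rw [hT, mul_left_comm, ← inner_conj_symm, Complex.conj_mul', ← Complex.ofReal_pow,
      ← Complex.ofReal_mul]
    exact mul_nonneg (hμ i) (sq_nonneg _)
  have hv : ⟪T v, v⟫_ℂ = ⟪v, T v⟫_ℂ := hsymm v v
  rw [ContinuousLinearMap.reApplyInnerSelf, hv]
  exact h0

theorem hasSum_norm_inner_sq (b : HilbertBasis ι ℂ H) (v : H) :
    HasSum (fun i => ‖⟪b i, v⟫_ℂ‖ ^ 2) (‖v‖ ^ 2) := by
  have h := (b.hasSum_inner_mul_inner v v).mapL Complex.reCLM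
  convert! h using 2 with i
  · rw [← inner_conj_symm v, Complex.conj_mul', ← Complex.ofReal_pow]
    rfl
  · rw [inner_self_eq_norm_sq_to_K]
    simp [← Complex.ofReal_pow]

variable [CompleteSpace H]

/-- An eigenvector of `a` is an eigenvector of `f(a)`. -/
theorem cfc_apply_eigenvector {a : H →L[ℂ] H} (ha : IsSelfAdjoint a) {v : H} (hv0 : v ≠ 0) {r : ℝ}
    (hv : a v = (r : ℂ) • v) (f : ℝ → ℝ) (hf : ContinuousOn f (spectrum ℝ a)) :
    cfc f a v = ((f r : ℝ) : ℂ) • v := by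
  have hr : r ∈ spectrum ℝ a := by
    intro hu
    obtain ⟨y, hy⟩ := hu.exists_left_inv
    apply hv0
    have h1 : (algebraMap ℝ (H →L[ℂ] H) r - a) v = 0 := by
      rw [sub_apply, hv, sub_eq_zero]
      rfl
    have h2 := DFunLike.congr_fun hy v
    rw [mul_apply_eq_comp, h1, map_zero] at h2
    exact h2.symm
  have key : ∀ φ : C(spectrum ℝ a, ℝ), cfcHom ha φ v = ((φ ⟨r, hr⟩ : ℝ) : ℂ) • v := by
    intro φ
    have hid : cfcHom ha (.restrict (spectrum ℝ a) (.id ℝ)) v = ((r : ℝ) : ℂ) • v := by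
      rw [cfcHom_id, hv]
    induction φ using ContinuousMap.induction_on_of_compact with
    | const c =>
      have : ContinuousMap.const (spectrum ℝ a) c = algebraMap ℝ C(spectrum ℝ a, ℝ) c := rfl
      rw [this, AlgHomClass.commutes]
      rfl
    | id => exact hid
    | star_id =>
      rw [star_trivial]
      exact hid
    | add φ ψ h1 h2 =>
      rw [map_add, add_apply, h1, h2, ← add_smul, ← Complex.ofReal_add]
      rfl
    | mul φ ψ h1 h2 =>
      rw [map_mul, mul_apply_eq_comp, h2, map_smul, h1, smul_smul, ← Complex.ofReal_mul, mul_comm]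
      rfl
    | frequently φ h =>
      refine h.mem_of_closed (isClosed_eq ?_ ?_)
      · exact ((ContinuousLinearMap.apply ℂ H v).continuous).comp (cfcHom_continuous ha)
      · exact (Complex.continuous_ofReal.comp (continuous_eval_const _)).smul continuous_const
  rw [cfc_apply f a ha hf, key]
  rfl

theorem inner_apply_of_apply_basis (b : HilbertBasis ι ℂ H) {T : H →L[ℂ] H} (hs : IsSelfAdjoint T)
    {μ : ι → ℝ} (hT : ∀ i, T (b i) = (μ i : ℂ) • b i) (i : ι) (v : H) :
    ⟪b i, T v⟫_ℂ = μ i * ⟪b i, v⟫_ℂ := by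
  rw [← ContinuousLinearMap.adjoint_inner_left, ← ContinuousLinearMap.star_eq_adjoint, hs.star_eq,
    hT, inner_smul_left, Complex.conj_ofReal]

/-- A positive operator with eigenvalues `μ i` on an orthonormal basis is trace class if and only
if `∑ μ i` converges. The trace may be computed in any orthonormal basis. -/
theorem isTraceClass_iff (b : HilbertBasis ι ℂ H) {T : H →L[ℂ] H} (h0 : 0 ≤ T) {μ : ι → ℝ}
    (hμ : ∀ i, 0 ≤ μ i) (hT : ∀ i, T (b i) = (μ i : ℂ) • b i) :
    IsTraceClass T ↔ Summable μ := by
  classical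
  have habs : CFC.abs T = T := CFC.abs_of_nonneg T h0
  constructor
  · rintro ⟨s, b', hs⟩
    rw [habs] at hs
    have hin := inner_apply_of_apply_basis b (IsSelfAdjoint.of_nonneg h0) hT
    have h1 : ∀ j, HasSum (fun i => μ i * ‖⟪b' j, b i⟫_ℂ‖ ^ 2) (⟪b' j, T (b' j)⟫_ℂ).re := fun j => by
      have h := (b.hasSum_inner_mul_inner (b' j) (T (b' j))).mapL Complex.reCLM
      convert! h using 2 with i
      rw [hin, mul_left_comm, ← inner_conj_symm (b i), Complex.mul_conj', ← Complex.ofReal_pow,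
        ← Complex.ofReal_mul]
      rfl
    -- by Parseval, each `μ i` is the sum over `j` of `μ i * ‖⟪b' j, b i⟫‖ ^ 2`, so the finite partial
    -- sums of `μ` are bounded by the trace in the basis `b'`
    refine summable_of_sum_le (c := ∑' j, (⟪b' j, T (b' j)⟫_ℂ).re) hμ fun u => ?_
    have h2 : HasSum (fun j => ∑ i ∈ u, μ i * ‖⟪b' j, b i⟫_ℂ‖ ^ 2) (∑ i ∈ u, μ i) := by
      refine hasSum_sum fun i _ => ?_
      have h := (hasSum_norm_inner_sq b' (b i)).mul_left (μ i)
      rwa [b.orthonormal.1, one_pow, mul_one] at h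
    refine hasSum_le (fun j => ?_) h2 hs.hasSum
    exact sum_le_hasSum u (fun i _ => mul_nonneg (hμ i) (sq_nonneg _)) (h1 j)
  · intro h
    have hsp : ⊤ ≤ (Submodule.span ℂ (Set.range ((↑) : Set.range b → H))).topologicalClosure := by
      rw [Subtype.range_coe, b.dense_span]
    refine ⟨Set.range b, HilbertBasis.mk b.orthonormal.toSubtypeRange hsp, ?_⟩
    -- the definition of trace class asks for a basis indexed by a set of vectors
    rw [habs, HilbertBasis.coe_mk]
    rw [← (Equiv.ofInjective b b.orthonormal.linearIndependent.injective).summable_iff]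
    refine h.congr fun i => ?_
    change μ i = (⟪b i, T (b i)⟫_ℂ).re
    rw [hT, inner_smul_right, inner_basis, if_pos rfl, mul_one, Complex.ofReal_re]

/-- The powers `R ^ y` in the continuous functional calculus are diagonal in the same basis, with
eigenvalues `μ i ^ y`. -/
theorem isTraceClass_rpow_iff (b : HilbertBasis ι ℂ H) {R : H →L[ℂ] H} (h0 : 0 ≤ R) {μ : ι → ℝ}
    (hμ : ∀ i, 0 ≤ μ i) (hR : ∀ i, R (b i) = (μ i : ℂ) • b i) {y : ℝ} (hy : 0 ≤ y) :
    IsTraceClass (CFC.rpow R y) ↔ Summable fun i => μ i ^ y := by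
  refine isTraceClass_iff b CFC.rpow_nonneg (fun i => Real.rpow_nonneg (hμ i) y) fun i => ?_
  have hcont : Continuous fun x : ℝ => ((x.toNNReal ^ y : NNReal) : ℝ) :=
    NNReal.continuous_coe.comp ((NNReal.continuous_rpow_const hy).comp continuous_real_toNNReal)
  have h := cfc_apply_eigenvector (IsSelfAdjoint.of_nonneg h0) (b.orthonormal.ne_zero i) (hR i)
    (fun x : ℝ => ((x.toNNReal ^ y : NNReal) : ℝ)) hcont.continuousOn
  rw [← cfc_nnreal_eq_real (fun x : NNReal => x ^ y) R h0, NNReal.coe_rpow,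
    Real.coe_toNNReal _ (hμ i)] at h
  exact h

end Unbounded

namespace QuantumSurface

open Filter Unbounded

theorem summable_one_add_abs_rpow {y : ℝ} (hy : 1 < y) :
    Summable fun k : ℤ => (1 + |(k : ℝ)|)⁻¹ ^ y := by
  refine Summable.of_norm_bounded_eventually (Real.summable_abs_int_rpow hy) ?_
  refine (Set.finite_singleton (0 : ℤ)).subset fun k hk => ?_
  by_contra hk0
  apply hk
  have hpos : 0 < |(k : ℝ)| := abs_pos.2 (Int.cast_ne_zero.2 hk0)
  change ‖(1 + |(k : ℝ)|)⁻¹ ^ y‖ ≤ |(k : ℝ)| ^ (-y)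
  rw [Real.norm_of_nonneg (by positivity), Real.inv_rpow (by positivity),
    Real.rpow_neg (by positivity)]
  gcongr
  linarith

theorem not_summable_one_add_abs : ¬ Summable fun k : ℤ => (1 + |(k : ℝ)|)⁻¹ ^ (1 : ℝ) := by
  intro h
  have h1 := h.comp_injective (Nat.cast_injective (R := ℤ))
  refine Real.not_summable_one_div_natCast ((summable_nat_add_iff 1).1 (h1.congr fun n => ?_))
  simp [add_comm]

theorem isPlusSummable_dirac : SpectralTriple.IsPlusSummable dirac 1 := by
  have hne : ∀ k : ℤ, ((|(k : ℝ)| : ℝ) : ℂ) ≠ -1 := fun k h => by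
    have := congrArg Complex.re h
    have h1 := abs_nonneg (k : ℝ)
    simp at this
    linarith
  obtain ⟨R, hR⟩ := isDiag_absDirac.exists_isResolvent
    (by simpa only [abs_abs] using tendsto_abs_int_cast) hne
  have hb : ∀ k, R (diracBasis k) = (((1 + |(k : ℝ)|)⁻¹ : ℝ) : ℂ) • diracBasis k := fun k => by
    rw [isDiag_absDirac.resolvent_apply hR]
    congr 1
    push_cast
    ring
  have hpos : ∀ k : ℤ, 0 ≤ (1 + |(k : ℝ)|)⁻¹ := fun k => by positivity
  have hin : ∀ (k : ℤ) v, ⟪diracBasis k, R v⟫_ℂ =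
      (((1 + |(k : ℝ)|)⁻¹ : ℝ) : ℂ) * ⟪diracBasis k, v⟫_ℂ := fun k v => by
    obtain ⟨h, h1⟩ := hR.1 v
    have h2 := congrArg (fun w => ⟪diracBasis k, w⟫_ℂ) h1
    simp only [inner_sub_right, inner_smul_right, isDiag_absDirac.inner_apply] at h2
    have h3 : ((1 + |(k : ℝ)| : ℝ) : ℂ) ≠ 0 := Complex.ofReal_ne_zero.2 (by positivity)
    rw [← h2, Complex.ofReal_inv, eq_inv_mul_iff_mul_eq₀ h3]
    push_cast
    ring
  have h0 : 0 ≤ R := nonneg_of_inner_apply diracBasis hpos hin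
  refine ⟨phase, absDirac, R, isPolarDecomposition_dirac, hR, fun ε hε => ?_, ?_⟩
  · rw [isTraceClass_rpow_iff diracBasis h0 hpos hb (by linarith)]
    exact summable_one_add_abs_rpow (by linarith)
  · rw [isTraceClass_rpow_iff diracBasis h0 hpos hb zero_le_one]
    exact not_summable_one_add_abs

end QuantumSurface

end

theorem mainTheorem3 (g : ℕ) (hg : 1 ≤ g) :
    SpectralTriple.IsEven (QuantumSurface.surface g) (QuantumSurface.smoothAlgebra g)
        (QuantumSurface.rep (QuantumSurface.smoothAlgebra g))
        QuantumSurface.dirac QuantumSurface.grading ∧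
      SpectralTriple.IsPlusSummable QuantumSurface.dirac 1 ∧
      SpectralTriple.IsRegular (QuantumSurface.rep (QuantumSurface.smoothAlgebra g))
        QuantumSurface.dirac ∧
      Unbounded.spec QuantumSurface.dirac = Set.range (fun k : ℤ => (k : ℂ)) ∧
      (∀ k : ℤ, Module.finrank ℂ (Unbounded.eigenspace QuantumSurface.dirac (k : ℂ)) = 1) ∧
      (∀ k : ℤ, QuantumSurface.eigenvector k ∈
        Unbounded.eigenspace QuantumSurface.dirac (k : ℂ)) ∧
      (∃ b : HilbertBasis ℤ ℂ QuantumSurface.Hilb, ⇑b = QuantumSurface.eigenvector) ∧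
      SpectralTriple.HasNontrivialFundamentalClass
        (QuantumSurface.rep (QuantumSurface.smoothAlgebra g))
        QuantumSurface.dirac QuantumSurface.grading := by
  refine ⟨QuantumSurface.isEven_dirac hg, QuantumSurface.isPlusSummable_dirac,
    QuantumSurface.isRegular_dirac g, ?_, fun k => ?_, fun k => ?_,
    ⟨QuantumSurface.diracBasis, QuantumSurface.coe_diracBasis⟩,
    QuantumSurface.hasNontrivialFundamentalClass_dirac g⟩
  · have h := QuantumSurface.isDiag_dirac.spec_eq QuantumSurface.tendsto_abs_int_cast
    simpa using h
  · have h := QuantumSurface.isDiag_dirac.finrank_eigenspace Int.cast_injective k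
    rwa [Complex.ofReal_intCast] at h
  · have h := QuantumSurface.isDiag_dirac.eigenspace_eq Int.cast_injective k
    rw [Complex.ofReal_intCast, QuantumSurface.coe_diracBasis] at h
    rw [h]
    exact Submodule.mem_span_singleton_self _
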